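/- **Setting.** Let $(\xi,J)$ be a (possibly killed) Markov additive process (MAP) on $\mathbb R\times\{\pm1\}$ with respect to a filtration $(\mathscr G_t)_{t\ge 0}$, with laws $\mathbb P_{z,i}$ when started from $(z,i)\in\mathbb R\times\{\pm1\}$. That is, $(\xi,J)$ is adapted and càdlàg; $J$ is a two-state continuous-time Markov chain with respect to $(\mathscr G_t)$; $\xi$ is sent to the absorbing state $-\infty$ when it is killed (with $e^{z\cdot(-\infty)}:=0$ for every real $z$); and for all $i\in\{\pm1\}$ and $s,t\ge0$, given $J(t)=i$ and that the process has not been killed by time $t$, the pair $(\xi(t+s)-\xi(t),J(t+s))$ is independent of $\mathscr G_t$ and distributed as $(\xi(s)-\xi(0),J(s))$ given $J(0)=i$. Let $Q=(q_{ij})$ be the intensity matrix of $J$. Let $\psi_i$ be the Laplace exponent of the (possibly killed) Lévy process $\xi_i$ followed by $\xi$ while $J$ is in state $i$, that is, $\psi_i(z)=\log\mathbb E[e^{z\xi_i(1)}]$. For $i\ne j$ let $U_{ij}$ be the additional jump of $\xi$ when $J$ switches from $i$ to $j$, and put $G_{ij}(z)=\mathbb E[e^{zU_{ij}}]$ for $i\neq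 j$ and $G_{ii}(z)=1$. For real $z$ the matrix exponent $$F(z)=\operatorname{diag}(\psi_1(z),\psi_{-1}(z))+Q\circ G(z)$$ ($\circ$ is the entrywise product) exists if $\mathbb E[e^{z\xi_i(1)}]$, for $i=\pm1$, and $G_{ij}(z)$, for $i\ne j$ with $q_{ij}>0$, are finite (if $q_{ij}=0$ the product $q_{ij}G_{ij}(z)$ is $0$). In that case $\kappa(z)$ denotes the leading eigenvalue of $F(z)$, that is, its real eigenvalue which is the largest real part of all its eigenvalues. **Lemma.** Let $\alpha>0$, $s\in(0,1)$ and $I=\int_0^\infty e^{\alpha\xi(t)}\,\mathrm dt\in[0,\infty]$. Then $F(\alpha s)$ exists and $\kappa(\alpha s)<0$ if and only if $\mathbb E_{0,i}[I^s]<\infty$ for both $i=1$ and $i=-1$. -/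

import Mathlib

open MeasureTheory ProbabilityTheory Filter Topology
open scoped NNReal ENNReal Matrix

noncomputable section

/-- `e^{z x}` for `x ∈ ℝ ∪ {-∞}`, where `-∞` is the killed state and contributes `0`
(for every real `z`). The level `+∞` is never reached by the processes considered below. -/
def killedExp (z : ℝ) (x : EReal) : ℝ≥0∞ :=
  if x = ⊥ then 0 else ENNReal.ofReal (Real.exp (z * x.toReal))

/-- `((ξ, J), P)` is a (possibly killed) Markov additive process on `ℝ × {±1}` with respect to
the filtration `𝓖`; the set `{±1}` is `ℤˣ = {1, -1}`, every subset of which is measurable. The process `ξ` has values in `ℝ ∪ {-∞}`, where `-∞` is the absorbing state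
to which it is sent when it is killed, and `P z i` is the law `ℙ_{z,i}` under which the process
starts from `(z, i)`. -/
structure IsMAP {Ω : Type*} [mΩ : MeasurableSpace Ω] (𝓖 : Filtration ℝ≥0 mΩ)
    (ξ : ℝ≥0 → Ω → EReal) (J : ℝ≥0 → Ω → ℤˣ) (P : ℝ → ℤˣ → Measure Ω) : Prop where
  isProbabilityMeasure : ∀ z i, IsProbabilityMeasure (P z i)
  start : ∀ (z : ℝ) (i : ℤˣ), ∀ᵐ ω ∂(P z i), ξ 0 ω = (z : EReal) ∧ J 0 ω = i
  measurable_fst : ∀ t, Measurable[𝓖 t] (ξ t)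
  measurable_snd : ∀ t, Measurable[𝓖 t] (J t)
  ne_top : ∀ t ω, ξ t ω ≠ ⊤
  absorbed : ∀ s t ω, s ≤ t → ξ s ω = ⊥ → ξ t ω = ⊥
  /-- `ξ` is right-continuous (up to, at, and after the killing time). -/
  rightCts_fst : ∀ t ω, Tendsto (fun u => ξ u ω) (𝓝[>] t) (𝓝 (ξ t ω))
  /-- `ξ` has finite left limits, up to and including the killing time. -/
  leftLim_fst : ∀ t ω, (∃ u < t, ξ u ω = ⊥) ∨
    ∃ l : ℝ, Tendsto (fun u => ξ u ω) (𝓝[<] t) (𝓝 (l : EReal))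
  rightCts_snd : ∀ t ω, ∀ᶠ u in 𝓝[>] t, J u ω = J t ω
  leftLim_snd : ∀ t ω, ∃ j : ℤˣ, ∀ᶠ u in 𝓝[<] t, J u ω = j
  /-- `J` is a time-homogeneous continuous-time Markov chain with respect to `𝓖`. -/
  markov : ∀ (z : ℝ) (i : ℤˣ) (t s : ℝ≥0) (j k : ℤˣ) (A : Set Ω), MeasurableSet[𝓖 t] A →
    P z i (A ∩ {ω | J t ω = j} ∩ {ω | J (t + s) ω = k})
      = P z i (A ∩ {ω | J t ω = j}) * P 0 j {ω | J s ω = k}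
  /-- Given `J t = j` (and that the process has not been killed by time `t`), the pair
  `(ξ (t + s) - ξ t, J (t + s))` is independent of `𝓖 t` and has the same distribution as
  `(ξ s - ξ 0, J s)` given `J 0 = j`. -/
  additive : ∀ (z : ℝ) (i : ℤˣ) (t s : ℝ≥0) (j : ℤˣ) (A : Set Ω) (B : Set (EReal × ℤˣ)),
    MeasurableSet[𝓖 t] A → MeasurableSet B →
    P z i (A ∩ {ω | J t ω = j ∧ ξ t ω ≠ ⊥} ∩ {ω | (ξ (t + s) ω - ξ t ω, J (t + s) ω) ∈ B})
      = P z i (A ∩ {ω | J t ω = j ∧ ξ t ω ≠ ⊥}) * P 0 j {ω | (ξ s ω - ξ 0 ω, J s ω) ∈ B}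

namespace MAP

variable {Ω : Type*} [MeasurableSpace Ω]

/-! The characteristics of a MAP: the intensity matrix of `J`, the Laplace exponents of the two
(possibly killed) Lévy processes, and the transforms of the two transitional jumps. -/

/-- The intensity matrix `Q = (q_{ij})` of the chain `J`: the right derivative at time `0` of the
transition probabilities `ℙ_{0,i}(J t = j)`. -/
def rateMatrix (J : ℝ≥0 → Ω → ℤˣ) (P : ℝ → ℤˣ → Measure Ω) : Matrix ℤˣ ℤˣ ℝ :=
  Matrix.of fun i j =>
    derivWithin (fun t : ℝ => (P 0 i).real {ω | J t.toNNReal ω = j}) (Set.Ici 0) 0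

/-- `𝔼[e^{z ξ_i(1)}]`, possibly infinite, for the (possibly killed) Lévy process `ξ_i` which `ξ`
follows while `J` stays in the state `i`. This process is independent of `J`, so that `ξ_i(1)` has
the law of `ξ(1)` under `ℙ_{0,i}` given that `J` does not leave `i` during `[0,1]`. -/
def levyMoment (ξ : ℝ≥0 → Ω → EReal) (J : ℝ≥0 → Ω → ℤˣ) (P : ℝ → ℤˣ → Measure Ω)
    (i : ℤˣ) (z : ℝ) : ℝ≥0∞ :=
  ∫⁻ ω, killedExp z (ξ 1 ω) ∂((P 0 i)[|{ω | ∀ u : ℝ≥0, u ≤ 1 → J u ω = i}])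

/-- The Laplace exponent `ψ_i(z) = log 𝔼[e^{z ξ_i(1)}]` (meaningful when the moment is finite). -/
def psi (ξ : ℝ≥0 → Ω → EReal) (J : ℝ≥0 → Ω → ℤˣ) (P : ℝ → ℤˣ → Measure Ω)
    (i : ℤˣ) (z : ℝ) : ℝ :=
  Real.log (levyMoment ξ J P i z).toReal

/-- The first jump time of `J` (meaningful on paths along which `J` jumps). -/
def switchTime (J : ℝ≥0 → Ω → ℤˣ) (ω : Ω) : ℝ≥0 := sInf {t | J t ω ≠ J 0 ω}

/-- The left limit `ξ(S-)` at the first jump time `S` of `J`. -/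
def preSwitch (ξ : ℝ≥0 → Ω → EReal) (J : ℝ≥0 → Ω → ℤˣ) (ω : Ω) : EReal :=
  Function.leftLim (fun t => ξ t ω) (switchTime J ω)

/-- `𝔼[e^{z U_{ij}}]` for `i ≠ j`, possibly infinite, where `U_{ij}` is the transitional jump
`ξ(S) - ξ(S-)` of `ξ` at the first jump time `S` of `J`, when `J` jumps from `i` to `j` before the
process is killed. For `i = j` the value is `1`. (If no such transition is possible, that is if
`q_{ij} = 0`, the value is `0`; it then plays no role.) -/
def jumpMoment (ξ : ℝ≥0 → Ω → EReal) (J : ℝ≥0 → Ω → ℤˣ) (P : ℝ → ℤˣ → Measure Ω)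
    (i j : ℤˣ) (z : ℝ) : ℝ≥0∞ :=
  if i = j then 1 else
    ∫⁻ ω, killedExp z (ξ (switchTime J ω) ω - preSwitch ξ J ω)
      ∂((P 0 i)[|{ω | (∃ t, J t ω ≠ J 0 ω) ∧ J (switchTime J ω) ω = j ∧ preSwitch ξ J ω ≠ ⊥}])

/-- The matrix `G(z)` with entries `𝔼[e^{z U_{ij}}]`, and `1` on the diagonal. -/
def jumpMatrix (ξ : ℝ≥0 → Ω → EReal) (J : ℝ≥0 → Ω → ℤˣ) (P : ℝ → ℤˣ → Measure Ω)
    (z : ℝ) : Matrix ℤˣ ℤˣ ℝ :=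
  Matrix.of fun i j => (jumpMoment ξ J P i j z).toReal

/-- `F(z)` exists: the Laplace exponents `ψ_i(z)` and the moments `𝔼[e^{z U_{ij}}]` are finite. -/
def ExponentExists (ξ : ℝ≥0 → Ω → EReal) (J : ℝ≥0 → Ω → ℤˣ) (P : ℝ → ℤˣ → Measure Ω)
    (z : ℝ) : Prop :=
  (∀ i, levyMoment ξ J P i z < ∞) ∧ ∀ i j, jumpMoment ξ J P i j z < ∞

/-- The matrix exponent `F(z) = diag(ψ_1(z), ψ_{-1}(z)) + Q ∘ G(z)`, with the Hadamard product. -/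
def matrixExponent (ξ : ℝ≥0 → Ω → EReal) (J : ℝ≥0 → Ω → ℤˣ) (P : ℝ → ℤˣ → Measure Ω)
    (z : ℝ) : Matrix ℤˣ ℤˣ ℝ :=
  Matrix.diagonal (fun i => psi ξ J P i z) + (rateMatrix J P) ⊙ (jumpMatrix ξ J P z)

/-- The leading eigenvalue `κ(z)`: the largest real part of an eigenvalue of `F(z)`. (The
off-diagonal entries of `F(z)` are nonnegative, so `κ(z)` is itself an eigenvalue.) -/
def kappa (ξ : ℝ≥0 → Ω → EReal) (J : ℝ≥0 → Ω → ℤˣ) (P : ℝ → ℤˣ → Measure Ω) (z : ℝ) : ℝ :=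
  sSup (Complex.re '' spectrum ℂ ((matrixExponent ξ J P z).map (fun x : ℝ => (x : ℂ))))

/-- The exponential functional `I = ∫_0^∞ e^{α ξ(t)} dt`, with values in `[0, ∞]`. -/
def expFunctional (ξ : ℝ≥0 → Ω → EReal) (α : ℝ) (ω : Ω) : ℝ≥0∞ :=
  ∫⁻ t in Set.Ioi (0 : ℝ), killedExp α (ξ t.toNNReal ω)

end MAP

end

noncomputable section

/-! Write z = αs and let S be the first switch of J. For each starting state i consider two numbers:
e_i, the mean of e^{zξ(1)} on the event S > 1 (`sojournMoment` at time 1), and K_i, the mean of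
e^{zξ(S)} on S < ∞ (the mean of `switchWeight`). Both sides of the theorem are equivalent to one
condition: e_i < 1 and K_i < ∞ for both i, and K_1 K_{-1} < 1.

Spectral side (`exponentExists_and_kappa_neg_iff`). The holding time in i is exponential with rate
q_i, so conditioning on S > 1 divides by e^{-q_i}, and F_ii = ψ_i - q_i = log e_i. When e_i < 1,
integrating over the switch time gives K_i = F_{i,-i} / (-F_ii) (`lintegral_switchWeight`). A
two-state matrix with nonnegative off-diagonal entries has negative leading eigenvalue exactly when
its diagonal is negative and its determinant positive (`Matrix.sSup_re_spectrum_neg_iff`), and the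
determinant condition reads K_1 K_{-1} < 1.

Necessity (`moments_lt_of_lintegral_lt_top`). Put m_i for the mean of I^s. The part of I after a
time T > 0 is e^{αξ(T)} times a copy of I, and it is strictly smaller than I because the process
starts alive. Taking T = 1 without a switch gives e_i m_i < m_i; taking T = S gives K_i m_{-i} <
m_i. The three conditions follow.

Sufficiency (`lintegral_totalIntegral_lt_top`). Since s ≤ 1, I^s is at most the sum of the s-th
powers of the contributions of the successive sojourns. A single sojourn is cut into unit intervals;
an Ottaviani-type inequality bounds the mean supremum over one interval by a multiple of e_i, and
e_i < 1 makes the sum over intervals geometric. The sum over sojourns is then controlled by the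
recursion C_i = A_i + K_i C_{-i}, solvable because K_1 K_{-1} < 1.

The hypotheses give the Markov property at fixed times only. At S it is replaced by dyadic
approximation: from the right, with Fatou's lemma, when an inequality is enough; by one-step cells
and dominated convergence for the exact formula for K_i. -/

instance discreteMeasurableSpaceIntUnits : DiscreteMeasurableSpace ℤˣ where
  forall_measurableSet s :=
    ⟨Units.val '' s, MeasurableSet.of_discrete, Set.preimage_image_eq s Units.val_injective⟩

lemma intUnits_ne_iff {i j : ℤˣ} : j ≠ i ↔ j = -i := by
  rcases Int.units_eq_one_or i with rfl | rfl <;>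
    rcases Int.units_eq_one_or j with rfl | rfl <;> decide

/-! ### Paths and the Markov property at a fixed time -/

/-- Paths with values in `[-∞, ∞] × {±1}`. -/
abbrev MAPPath := ℝ≥0 → EReal × ℤˣ

namespace MAPPath

/-- The path seen from time `t` on, with the level at time `t` subtracted. -/
def shift (t : ℝ≥0) (x : MAPPath) : MAPPath :=
  fun u => ((x (t + u)).1 - (x t).1, (x (t + u)).2)

end MAPPath

namespace IsMAP

open MAPPath

variable {Ω : Type*} [mΩ : MeasurableSpace Ω] {𝓖 : Filtration ℝ≥0 mΩ}
  {ξ : ℝ≥0 → Ω → EReal} {J : ℝ≥0 → Ω → ℤˣ} {P : ℝ → ℤˣ → Measure Ω}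

/-- The path of the process. -/
def path (ξ : ℝ≥0 → Ω → EReal) (J : ℝ≥0 → Ω → ℤˣ) (ω : Ω) : MAPPath := fun u => (ξ u ω, J u ω)

omit mΩ in
@[simp] lemma path_apply (ω : Ω) (u : ℝ≥0) : path ξ J ω u = (ξ u ω, J u ω) := rfl

section
variable (h : IsMAP 𝓖 ξ J P)
include h

lemma measurable_level (t : ℝ≥0) : Measurable (ξ t) := (h.measurable_fst t).mono (𝓖.le t) le_rfl

lemma measurable_state (t : ℝ≥0) : Measurable (J t) := (h.measurable_snd t).mono (𝓖.le t) le_rfl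

lemma measurable_path : Measurable (path ξ J) :=
  measurable_pi_lambda _ fun u => (h.measurable_level u).prodMk (h.measurable_state u)

lemma measurable_shift_path (t : ℝ≥0) : Measurable fun ω => shift t (path ξ J ω) :=
  measurable_pi_lambda _ fun u =>
    ((h.measurable_level (t + u)).sub (h.measurable_level t)).prodMk (h.measurable_state (t + u))

lemma measurableSet_state {t r : ℝ≥0} (htr : t ≤ r) (B : Set ℤˣ) :
    MeasurableSet[𝓖 r] {ω | J t ω ∈ B} :=
  𝓖.mono htr _ (h.measurable_snd t (MeasurableSet.of_discrete))

lemma measurableSet_alive {t r : ℝ≥0} (htr : t ≤ r) : MeasurableSet[𝓖 r] {ω | ξ t ω ≠ ⊥} :=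
  𝓖.mono htr _ (h.measurable_fst t (measurableSet_singleton (⊥ : EReal)).compl)

/-- The transition kernel of the pair `(ξ, J)`, applied to a function. -/
lemma measurable_transition {g : EReal × ℤˣ → ℝ≥0∞} (hg : Measurable g) (s : ℝ≥0) :
    Measurable fun p : EReal × ℤˣ =>
      ∫⁻ ω, g (p.1 + (ξ s ω - ξ 0 ω), J s ω) ∂(P 0 p.2) := by
  refine measurable_from_prod_countable_left fun j => ?_
  have := h.isProbabilityMeasure 0 j
  refine Measurable.lintegral_prod_right' (ν := P 0 j) (f := fun q : EReal × Ω =>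
    g (q.1 + (ξ s q.2 - ξ 0 q.2), J s q.2)) ?_
  refine hg.comp (Measurable.prodMk ?_ ((h.measurable_state s).comp _root_.measurable_snd))
  exact _root_.measurable_fst.add
    (((h.measurable_level s).comp _root_.measurable_snd).sub
      ((h.measurable_level 0).comp _root_.measurable_snd))

/-- Only the middle level must be real for the telescoping, since it is the term that cancels. -/
lemma sub_add_sub_of_alive {t r s : ℝ≥0} (ω : Ω) (hr : ξ r ω ≠ ⊥) :
    (ξ r ω - ξ t ω) + (ξ (r + s) ω - ξ r ω) = ξ (r + s) ω - ξ t ω := by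
  have hr' := h.ne_top r ω
  lift ξ r ω to ℝ using ⟨hr', hr⟩ with a
  rw [sub_eq_add_neg, sub_eq_add_neg, sub_eq_add_neg, add_comm (ξ (r + s) ω), ← add_assoc,
    add_comm (a : EReal), add_assoc (- ξ t ω), ← EReal.coe_neg, ← EReal.coe_add, add_neg_cancel]
  simp [add_comm]

/-- On rectangles, `additive` says that the joint law of the increment up to `r` and of the pair
after `r` is a product measure; the rest is Fubini. -/
lemma lintegral_step_alive (z : ℝ) (i : ℤˣ) {r t : ℝ≥0} (s : ℝ≥0) (htr : t ≤ r) {A : Set Ω}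
    (hA : MeasurableSet[𝓖 r] A) (j : ℤˣ) {g : EReal × ℤˣ → ℝ≥0∞} (hg : Measurable g) :
    ∫⁻ ω in A ∩ {ω | J r ω = j ∧ ξ r ω ≠ ⊥}, g (ξ (r + s) ω - ξ t ω, J (r + s) ω) ∂(P z i) =
    ∫⁻ ω in A ∩ {ω | J r ω = j ∧ ξ r ω ≠ ⊥},
      (∫⁻ ω', g ((ξ r ω - ξ t ω) + (ξ s ω' - ξ 0 ω'), J s ω') ∂(P 0 (J r ω))) ∂(P z i) := by
  have := h.isProbabilityMeasure z i
  have := h.isProbabilityMeasure 0 j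
  set D := A ∩ {ω | J r ω = j ∧ ξ r ω ≠ ⊥} with hD
  have hDr : MeasurableSet[𝓖 r] D :=
    hA.inter ((h.measurableSet_state le_rfl {j}).inter (h.measurableSet_alive le_rfl))
  have hDm : MeasurableSet D := 𝓖.le r _ hDr
  have hY : Measurable[𝓖 r] fun ω => ξ r ω - ξ t ω :=
    (h.measurable_fst r).sub ((h.measurable_fst t).mono (𝓖.mono htr) le_rfl)
  have hY' : Measurable fun ω => ξ r ω - ξ t ω := hY.mono (𝓖.le r) le_rfl
  have hZ : Measurable fun ω => (ξ (r + s) ω - ξ r ω, J (r + s) ω) :=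
    ((h.measurable_level _).sub (h.measurable_level _)).prodMk (h.measurable_state _)
  have hZ0 : Measurable fun ω => (ξ s ω - ξ 0 ω, J s ω) :=
    ((h.measurable_level _).sub (h.measurable_level _)).prodMk (h.measurable_state _)
  have key : ((P z i).restrict D).map (fun ω => (ξ r ω - ξ t ω, (ξ (r + s) ω - ξ r ω, J (r + s) ω)))
      = (((P z i).restrict D).map (fun ω => ξ r ω - ξ t ω)).prod
        ((P 0 j).map fun ω => (ξ s ω - ξ 0 ω, J s ω)) := by
    have : IsProbabilityMeasure ((P 0 j).map fun ω => (ξ s ω - ξ 0 ω, J s ω)) :=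
      Measure.isProbabilityMeasure_map hZ0.aemeasurable
    symm
    refine Measure.prod_eq fun B C hB hC => ?_
    rw [Measure.map_apply (hY'.prodMk hZ) (hB.prod hC), Measure.map_apply hY' hB,
      Measure.map_apply hZ0 hC, Measure.restrict_apply ((hY'.prodMk hZ) (hB.prod hC)),
      Measure.restrict_apply (hY' hB)]
    have := h.additive z i r s j (A ∩ (fun ω => ξ r ω - ξ t ω) ⁻¹' B) C (hA.inter (hY hB)) hC
    rw [show A ∩ (fun ω => ξ r ω - ξ t ω) ⁻¹' B ∩ {ω | J r ω = j ∧ ξ r ω ≠ ⊥} =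
      (fun ω => ξ r ω - ξ t ω) ⁻¹' B ∩ D by ext ω; simp [hD]; tauto] at this
    refine Eq.trans ?_ this
    congr 1
    ext ω
    simp only [Set.mem_inter_iff, Set.mem_preimage, Set.mem_prod, Set.mem_ofPred_eq]
    tauto
  have hg2 : Measurable fun p : EReal × (EReal × ℤˣ) => g (p.1 + p.2.1, p.2.2) :=
    hg.comp (by fun_prop)
  calc
    _ = ∫⁻ ω in D, g ((ξ r ω - ξ t ω) + (ξ (r + s) ω - ξ r ω), J (r + s) ω) ∂(P z i) := by
      refine setLIntegral_congr_fun hDm fun ω hω => ?_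
      simp only [h.sub_add_sub_of_alive ω hω.2.2]
    _ = ∫⁻ p, g (p.1 + p.2.1, p.2.2) ∂(((P z i).restrict D).map
          (fun ω => (ξ r ω - ξ t ω, (ξ (r + s) ω - ξ r ω, J (r + s) ω)))) := by
      rw [lintegral_map hg2 (hY'.prodMk hZ)]
    _ = ∫⁻ ω in D, (∫⁻ ω', g ((ξ r ω - ξ t ω) + (ξ s ω' - ξ 0 ω'), J s ω') ∂(P 0 j)) ∂(P z i) := by
      have : IsProbabilityMeasure ((P 0 j).map fun ω => (ξ s ω - ξ 0 ω, J s ω)) :=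
        Measure.isProbabilityMeasure_map hZ0.aemeasurable
      rw [key, lintegral_prod _ hg2.aemeasurable, lintegral_map hg2.lintegral_prod_right' hY']
      refine lintegral_congr fun ω => ?_
      rw [lintegral_map (f := fun q : EReal × ℤˣ => g ((ξ r ω - ξ t ω) + q.1, q.2))
        (hg.comp (by fun_prop)) hZ0]
    _ = _ := by
      refine setLIntegral_congr_fun hDm fun ω hω => ?_
      simp only [show J r ω = j from hω.2.1]

lemma lintegral_state (ν : Measure Ω) (s : ℝ≥0) (g : ℤˣ → ℝ≥0∞) :
    ∫⁻ ω, g (J s ω) ∂ν = ∑ k, g k * ν {ω | J s ω = k} := by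
  rw [← lintegral_map (μ := ν) (f := g) (Measurable.of_discrete) (h.measurable_state s),
    lintegral_fintype]
  refine Finset.sum_congr rfl fun k _ => ?_
  rw [Measure.map_apply (h.measurable_state s) (measurableSet_singleton k)]
  rfl

/-- After killing the level is `⊥` on both sides, so only the state matters. `additive` is silent
there; `markov` supplies the law of the state. -/
lemma lintegral_step_dead (z : ℝ) (i : ℤˣ) {r t : ℝ≥0} (s : ℝ≥0) {A : Set Ω}
    (hA : MeasurableSet[𝓖 r] A) (j : ℤˣ) {g : EReal × ℤˣ → ℝ≥0∞} :
    ∫⁻ ω in A ∩ {ω | J r ω = j ∧ ξ r ω = ⊥}, g (ξ (r + s) ω - ξ t ω, J (r + s) ω) ∂(P z i) =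
    ∫⁻ ω in A ∩ {ω | J r ω = j ∧ ξ r ω = ⊥},
      (∫⁻ ω', g ((ξ r ω - ξ t ω) + (ξ s ω' - ξ 0 ω'), J s ω') ∂(P 0 (J r ω))) ∂(P z i) := by
  have hdead : MeasurableSet[𝓖 r] {ω | ξ r ω = ⊥} :=
    h.measurable_fst r (measurableSet_singleton (⊥ : EReal))
  set D := A ∩ {ω | J r ω = j ∧ ξ r ω = ⊥} with hD
  have hDm : MeasurableSet D :=
    𝓖.le r _ (hA.inter ((h.measurableSet_state le_rfl {j}).inter hdead))
  have h1 : ∫⁻ ω in D, g (ξ (r + s) ω - ξ t ω, J (r + s) ω) ∂(P z i) =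
      ∫⁻ ω in D, g (⊥, J (r + s) ω) ∂(P z i) := by
    refine setLIntegral_congr_fun hDm fun ω hω => ?_
    have := h.absorbed r (r + s) ω le_self_add hω.2.2
    simp [this, sub_eq_add_neg]
  have h2 : ∫⁻ ω in D, (∫⁻ ω', g ((ξ r ω - ξ t ω) + (ξ s ω' - ξ 0 ω'), J s ω')
        ∂(P 0 (J r ω))) ∂(P z i) =
      ∫⁻ ω in D, (∫⁻ ω', g (⊥, J s ω') ∂(P 0 j)) ∂(P z i) := by
    refine setLIntegral_congr_fun hDm fun ω hω => ?_
    have h2 : ξ r ω = ⊥ := hω.2.2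
    simp [h2, show J r ω = j from hω.2.1, sub_eq_add_neg]
  rw [h1, h2, setLIntegral_const, h.lintegral_state _ (r + s) (fun k => g (⊥, k)),
    h.lintegral_state _ s (fun k => g (⊥, k)), Finset.sum_mul]
  refine Finset.sum_congr rfl fun k _ => ?_
  have hk : MeasurableSet {ω | J (r + s) ω = k} :=
    h.measurable_state _ (measurableSet_singleton k)
  rw [Measure.restrict_apply hk, mul_assoc]
  congr 1
  have := h.markov z i r s j k (A ∩ {ω | ξ r ω = ⊥}) (hA.inter hdead)
  have e1 : A ∩ {ω | ξ r ω = ⊥} ∩ {ω | J r ω = j} = D := by ext; simp [hD]; tauto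
  rw [e1] at this
  rw [mul_comm, ← this, Set.inter_comm]

lemma lintegral_step (z : ℝ) (i : ℤˣ) {r t : ℝ≥0} (s : ℝ≥0) (htr : t ≤ r) {A : Set Ω}
    (hA : MeasurableSet[𝓖 r] A) {g : EReal × ℤˣ → ℝ≥0∞} (hg : Measurable g) :
    ∫⁻ ω in A, g (ξ (r + s) ω - ξ t ω, J (r + s) ω) ∂(P z i) =
    ∫⁻ ω in A,
      (∫⁻ ω', g ((ξ r ω - ξ t ω) + (ξ s ω' - ξ 0 ω'), J s ω') ∂(P 0 (J r ω))) ∂(P z i) := by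
  have hal : MeasurableSet {ω | ξ r ω ≠ ⊥} := 𝓖.le r _ (h.measurableSet_alive le_rfl)
  have hst : MeasurableSet {ω | J r ω = 1} := 𝓖.le r _ (h.measurableSet_state le_rfl {1})
  have split : ∀ f : Ω → ℝ≥0∞, ∫⁻ ω in A, f ω ∂(P z i) =
      (∫⁻ ω in A ∩ {ω | J r ω = 1 ∧ ξ r ω ≠ ⊥}, f ω ∂(P z i) +
        ∫⁻ ω in A ∩ {ω | J r ω = -1 ∧ ξ r ω ≠ ⊥}, f ω ∂(P z i)) +
      (∫⁻ ω in A ∩ {ω | J r ω = 1 ∧ ξ r ω = ⊥}, f ω ∂(P z i) +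
        ∫⁻ ω in A ∩ {ω | J r ω = -1 ∧ ξ r ω = ⊥}, f ω ∂(P z i)) := by
    intro f
    rw [← lintegral_inter_add_sdiff f A hal, ← lintegral_inter_add_sdiff f (A ∩ _) hst,
      ← lintegral_inter_add_sdiff f (A \ _) hst]
    congr 4 <;> ext ω <;> simp [← intUnits_ne_iff (i := 1)] <;> tauto
  rw [split, split, h.lintegral_step_alive z i s htr hA 1 hg,
    h.lintegral_step_alive z i s htr hA (-1) hg, h.lintegral_step_dead z i s hA 1,
    h.lintegral_step_dead z i s hA (-1)]

lemma ae_start (j : ℤˣ) : ∀ᵐ ω ∂(P 0 j), ξ 0 ω = 0 ∧ J 0 ω = j := by simpa using h.start 0 j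

/-- The Markov property for cylinder sets, with a function of a later position as a weight. -/
lemma lintegral_cylinder (z : ℝ) (i j : ℤˣ) (t : ℝ≥0) {A : Set Ω} (hA : MeasurableSet[𝓖 t] A)
    {B : ℝ≥0 → Set (EReal × ℤˣ)} (hB : ∀ u, MeasurableSet (B u)) (I : Finset ℝ≥0) :
    ∀ (r : ℝ≥0), (∀ u ∈ I, u ≤ r) → ∀ g : EReal × ℤˣ → ℝ≥0∞, Measurable g →
    ∫⁻ ω in (A ∩ {ω | J t ω = j ∧ ξ t ω ≠ ⊥}) ∩ {ω | ∀ u ∈ I, shift t (path ξ J ω) u ∈ B u},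
        g (shift t (path ξ J ω) r) ∂(P z i) =
      P z i (A ∩ {ω | J t ω = j ∧ ξ t ω ≠ ⊥}) *
      ∫⁻ ω in {ω | ∀ u ∈ I, shift 0 (path ξ J ω) u ∈ B u},
        g (shift 0 (path ξ J ω) r) ∂(P 0 j) := by
  have meas : ∀ t r (I : Finset ℝ≥0), (∀ u ∈ I, u ≤ r) →
      MeasurableSet[𝓖 (t + r)] {ω | ∀ u ∈ I, shift t (path ξ J ω) u ∈ B u} := by
    intro t r I hI
    rw [show {ω | ∀ u ∈ I, shift t (path ξ J ω) u ∈ B u} =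
      ⋂ u ∈ I, {ω | shift t (path ξ J ω) u ∈ B u} by ext; simp]
    refine MeasurableSet.biInter I.countable_toSet fun u hu => ?_
    refine 𝓖.mono (add_le_add_right (hI u hu) t) _ ?_
    exact (((h.measurable_fst (t + u)).sub ((h.measurable_fst t).mono (𝓖.mono le_self_add)
      le_rfl)).prodMk (h.measurable_snd (t + u))) (hB u)
  set D := A ∩ {ω | J t ω = j ∧ ξ t ω ≠ ⊥} with hD
  have hDt : MeasurableSet[𝓖 t] D :=
    hA.inter ((h.measurableSet_state le_rfl {j}).inter (h.measurableSet_alive le_rfl))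
  -- The constraint at the largest time is absorbed into the weight: `g` is replaced by its
  -- transition average, cut off to `B a`. Hence the quantification over `r` and `g`.
  induction I using Finset.induction_on_max with
  | empty =>
    intro r _ g hg
    have := h.lintegral_step_alive z i r (le_refl t) hA j hg
    simp only [Finset.notMem_empty, IsEmpty.forall_iff, implies_true, Set.ofPred_true,
      Set.inter_univ, Measure.restrict_univ, shift, path_apply, zero_add]
    rw [this, ← hD, mul_comm, ← setLIntegral_const]
    refine setLIntegral_congr_fun (𝓖.le t _ hDt) fun ω hω => ?_
    have e : ξ t ω - ξ t ω = 0 := by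
      have h1 := hω.2.2; have h2 := h.ne_top t ω
      lift ξ t ω to ℝ using ⟨h2, h1⟩ with a
      rw [← EReal.coe_sub]; simp
    simp only [e, zero_add, show J t ω = j from hω.2.1]
  | insert a I ha ih =>
    intro r hr g hg
    have har : a ≤ r := hr a (Finset.mem_insert_self a I)
    obtain ⟨s, rfl⟩ := exists_add_of_le har
    set g' : EReal × ℤˣ → ℝ≥0∞ := fun p =>
      ∫⁻ ω, g (p.1 + (ξ s ω - ξ 0 ω), J s ω) ∂(P 0 p.2)
    have hg' : Measurable g' := h.measurable_transition hg s
    have hg'' : Measurable ((B a).indicator g') := hg'.indicator (hB a)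
    have key : ∀ (t : ℝ≥0) (D : Set Ω) (_ : MeasurableSet[𝓖 t] D) (z : ℝ) (i : ℤˣ),
        ∫⁻ ω in D ∩ {ω | ∀ u ∈ insert a I, shift t (path ξ J ω) u ∈ B u},
          g (shift t (path ξ J ω) (a + s)) ∂(P z i) =
        ∫⁻ ω in D ∩ {ω | ∀ u ∈ I, shift t (path ξ J ω) u ∈ B u},
          ((B a).indicator g') (shift t (path ξ J ω) a) ∂(P z i) := by
      intro t D hDt z i
      have hm := meas t a (insert a I) (by
        intro u hu; rcases Finset.mem_insert.1 hu with rfl | hu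
        exacts [le_rfl, (ha u hu).le])
      have := h.lintegral_step z i s (le_self_add : t ≤ t + a)
        ((𝓖.mono le_self_add _ hDt).inter hm) hg
      simp only [shift, path_apply, ← add_assoc] at this ⊢
      rw [this]
      have hC : MeasurableSet {ω | shift t (path ξ J ω) a ∈ B a} :=
        ((measurable_pi_apply a).comp (h.measurable_shift_path t)) (hB a)
      have hset : D ∩ {ω | ∀ u ∈ insert a I, shift t (path ξ J ω) u ∈ B u} =
          {ω | shift t (path ξ J ω) a ∈ B a} ∩
            (D ∩ {ω | ∀ u ∈ I, shift t (path ξ J ω) u ∈ B u}) := by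
        ext ω; simp; tauto
      simp only [shift, path_apply] at hC hset
      rw [hset, ← Measure.restrict_restrict hC, ← lintegral_indicator hC]
      rfl
    rw [key t D hDt z i, ih a (fun u hu => (ha u hu).le) _ hg'']
    -- The same reduction on the whole space at time `0` treats the right-hand side.
    have := key 0 Set.univ MeasurableSet.univ 0 j
    rw [Set.univ_inter, Set.univ_inter] at this
    rw [this]

lemma ae_shift_zero (j : ℤˣ) : ∀ᵐ ω ∂(P 0 j), shift 0 (path ξ J ω) = path ξ J ω := by
  filter_upwards [h.ae_start j] with ω hω
  funext u
  simp [shift, hω.1]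

/-- The Markov property at a fixed time, for the law of the whole future. -/
lemma map_shift_path (z : ℝ) (i j : ℤˣ) (t : ℝ≥0) {A : Set Ω} (hA : MeasurableSet[𝓖 t] A) :
    ((P z i).restrict (A ∩ {ω | J t ω = j ∧ ξ t ω ≠ ⊥})).map (fun ω => shift t (path ξ J ω)) =
      P z i (A ∩ {ω | J t ω = j ∧ ξ t ω ≠ ⊥}) • (P 0 j).map (path ξ J) := by
  have := h.isProbabilityMeasure z i
  have := h.isProbabilityMeasure 0 j
  set D := A ∩ {ω | J t ω = j ∧ ξ t ω ≠ ⊥} with hD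
  have e0 : (P 0 j).map (path ξ J) = (P 0 j).map fun ω => shift 0 (path ξ J ω) :=
    Measure.map_congr ((h.ae_shift_zero j).mono fun ω hω => hω.symm)
  rw [e0]
  have : IsFiniteMeasure (((P z i).restrict D).map fun ω => shift t (path ξ J ω)) := inferInstance
  refine ext_of_generate_finite (squareCylinders fun _ : ℝ≥0 => {s | MeasurableSet s})
    generateFrom_squareCylinders.symm
    (isPiSystem_squareCylinders (fun _ => MeasurableSpace.isPiSystem_measurableSet)
      (fun _ => Set.mem_ofPred_eq ▸ MeasurableSet.univ)) ?_ ?_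
  · rintro _ ⟨I, B, hB, rfl⟩
    have hB' : ∀ u, MeasurableSet (B u) := fun u => hB u (Set.mem_univ u)
    have hset : ∀ t : ℝ≥0, (fun ω => shift t (path ξ J ω)) ⁻¹' (I : Set ℝ≥0).pi B =
        {ω | ∀ u ∈ I, shift t (path ξ J ω) u ∈ B u} := by
      intro t; ext ω; simp [Set.mem_pi]
    have hpi : MeasurableSet ((I : Set ℝ≥0).pi B) :=
      MeasurableSet.pi I.countable_toSet fun u _ => hB' u
    obtain ⟨r, hr⟩ : ∃ r, ∀ u ∈ I, u ≤ r := ⟨I.sup id, fun u hu => Finset.le_sup (f := id) hu⟩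
    have := h.lintegral_cylinder z i j t hA hB' I r hr (fun _ => 1) measurable_const
    simp only [setLIntegral_const, one_mul] at this
    change ((P z i).restrict D).map (fun ω => shift t (path ξ J ω)) ((I : Set ℝ≥0).pi B) =
      (P z i D • (P 0 j).map fun ω => shift 0 (path ξ J ω)) ((I : Set ℝ≥0).pi B)
    rw [Measure.map_apply (h.measurable_shift_path t) hpi, Measure.smul_apply,
      Measure.map_apply (h.measurable_shift_path 0) hpi, hset, hset, smul_eq_mul, ← this,
      Measure.restrict_apply, Set.inter_comm]
    rw [← hset]
    exact h.measurable_shift_path t hpi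
  · rw [Measure.map_apply (h.measurable_shift_path t) MeasurableSet.univ, Measure.smul_apply,
      Measure.map_apply (h.measurable_shift_path 0) MeasurableSet.univ]
    simp

/-- The Markov property at a fixed time. -/
lemma lintegral_markov (z : ℝ) (i j : ℤˣ) (t : ℝ≥0) {f : Ω → ℝ≥0∞} (hf : Measurable[𝓖 t] f)
    {Φ : MAPPath → ℝ≥0∞} (hΦ : Measurable Φ) :
    ∫⁻ ω in {ω | J t ω = j ∧ ξ t ω ≠ ⊥}, f ω * Φ (shift t (path ξ J ω)) ∂(P z i) =
      (∫⁻ ω in {ω | J t ω = j ∧ ξ t ω ≠ ⊥}, f ω ∂(P z i)) * ∫⁻ ω, Φ (path ξ J ω) ∂(P 0 j) := by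
  have hE : MeasurableSet {ω | J t ω = j ∧ ξ t ω ≠ ⊥} :=
    𝓖.le t _ ((h.measurableSet_state le_rfl {j}).inter (h.measurableSet_alive le_rfl))
  have hΦt : Measurable fun ω => Φ (shift t (path ξ J ω)) := hΦ.comp (h.measurable_shift_path t)
  refine @Measurable.ennreal_induction Ω (𝓖 t) (fun f =>
    ∫⁻ ω in {ω | J t ω = j ∧ ξ t ω ≠ ⊥}, f ω * Φ (shift t (path ξ J ω)) ∂(P z i) =
      (∫⁻ ω in {ω | J t ω = j ∧ ξ t ω ≠ ⊥}, f ω ∂(P z i)) * ∫⁻ ω, Φ (path ξ J ω) ∂(P 0 j))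
      ?_ ?_ ?_ f hf
  · intro c A hA
    have hAm := 𝓖.le t _ hA
    have e1 : ∀ ω, A.indicator (fun _ => c) ω * Φ (shift t (path ξ J ω)) =
        A.indicator (fun ω => c * Φ (shift t (path ξ J ω))) ω := by
      intro ω; by_cases hω : ω ∈ A <;> simp [hω]
    simp_rw [e1]
    rw [lintegral_indicator hAm, lintegral_indicator hAm, Measure.restrict_restrict hAm,
      lintegral_const_mul _ hΦt, setLIntegral_const, mul_assoc]
    congr 1
    rw [← lintegral_map (μ := (P z i).restrict _) hΦ (h.measurable_shift_path t),
      h.map_shift_path z i j t hA, lintegral_smul_measure, lintegral_map hΦ h.measurable_path]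
    rfl
  · intro f g _ hf hg hf' hg'
    have hfm := hf.mono (𝓖.le t) le_rfl
    simp only [Pi.add_apply, add_mul]
    rw [lintegral_add_left (show Measurable fun ω => f ω * Φ (shift t (path ξ J ω)) from
      hfm.mul hΦt), hf', hg', lintegral_add_left hfm, add_mul]
  · intro f hf hmono hf'
    have hfm := fun n => (hf n).mono (𝓖.le t) le_rfl
    simp only [ENNReal.iSup_mul]
    rw [lintegral_iSup (f := fun n ω => f n ω * Φ (shift t (path ξ J ω))) (fun n => (hfm n).mul hΦt)
      (fun m n hmn ω => mul_le_mul_left (hmono hmn ω) _), lintegral_iSup hfm hmono,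
      ENNReal.iSup_mul]
    simp only [hf']

end

end IsMAP

/-! ### The exponential weight with a killed state -/

section KilledExp

variable {z : ℝ} {a b : EReal}

@[simp] lemma killedExp_bot (z : ℝ) : killedExp z ⊥ = 0 := by simp [killedExp]

@[simp] lemma killedExp_coe (z r : ℝ) :
    killedExp z (r : EReal) = ENNReal.ofReal (Real.exp (z * r)) := by
  simp [killedExp]

lemma killedExp_ne_top (z : ℝ) (a : EReal) : killedExp z a ≠ ∞ := by
  unfold killedExp; split_ifs <;> simp

lemma killedExp_ne_zero (z : ℝ) (ha : a ≠ ⊥) : killedExp z a ≠ 0 := by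
  simp [killedExp, ha, Real.exp_pos]

@[simp] lemma killedExp_zero_right (z : ℝ) : killedExp z 0 = 1 := by
  rw [← EReal.coe_zero, killedExp_coe]; simp

lemma killedExp_mul_killedExp_sub (z : ℝ) (ha : a ≠ ⊤) (hb : b ≠ ⊤) (hb' : b ≠ ⊥) :
    killedExp z b * killedExp z (a - b) = killedExp z a := by
  lift b to ℝ using ⟨hb, hb'⟩
  induction a with
  | bot => simp
  | top => exact absurd rfl ha
  | coe a =>
    rw [← EReal.coe_sub, killedExp_coe, killedExp_coe, killedExp_coe,
      ← ENNReal.ofReal_mul (Real.exp_pos _).le, ← Real.exp_add]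
    congr 3; ring

lemma killedExp_rpow (α : ℝ) {s : ℝ} (hs : 0 < s) (a : EReal) :
    killedExp α a ^ s = killedExp (α * s) a := by
  unfold killedExp
  split_ifs
  · simp [hs]
  · rw [ENNReal.ofReal_rpow_of_pos (Real.exp_pos _), ← Real.exp_mul]; ring_nf

lemma measurable_killedExp (z : ℝ) : Measurable (killedExp z) :=
  Measurable.ite (measurableSet_singleton _) measurable_const
    (ENNReal.measurable_ofReal.comp (Real.measurable_exp.comp
      (measurable_ereal_toReal.const_mul z)))

/-- The level `⊥` is excluded because continuity there fails for `z ≤ 0`, and `z = 0` is needed to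
turn weights into indicators of survival. -/
lemma tendsto_killedExp_of_ne_bot (z : ℝ) (ha : a ≠ ⊤) (ha' : a ≠ ⊥) :
    Tendsto (killedExp z) (𝓝 a) (𝓝 (killedExp z a)) := by
  have h1 : Tendsto (fun a : EReal => ENNReal.ofReal (Real.exp (z * a.toReal))) (𝓝 a)
      (𝓝 (ENNReal.ofReal (Real.exp (z * a.toReal)))) :=
    ENNReal.tendsto_ofReal ((Real.continuous_exp.tendsto _).comp
      ((EReal.tendsto_toReal ha ha').const_mul z))
  have e : killedExp z a = ENNReal.ofReal (Real.exp (z * a.toReal)) := by simp [killedExp, ha']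
  rw [e]
  refine h1.congr' ?_
  filter_upwards [isOpen_ne.mem_nhds ha'] with b hb
  simp [killedExp, show b ≠ ⊥ from hb]

end KilledExp

/-! ### Dyadic grids and Lebesgue measure on the time axis -/

/-- The grid points of mesh `2⁻ⁿ`. -/
def gridPoint (n k : ℕ) : ℝ≥0 := k / 2 ^ n

/-- The index of the first grid point strictly after `t`. -/
def gridIndex (n : ℕ) (t : ℝ≥0) : ℕ := ⌊t * 2 ^ n⌋₊ + 1

lemma lt_gridPoint_gridIndex (n : ℕ) (t : ℝ≥0) : t < gridPoint n (gridIndex n t) := by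
  rw [gridPoint, gridIndex, lt_div_iff₀ (by positivity)]
  exact_mod_cast Nat.lt_floor_add_one _

lemma gridPoint_succ (n k : ℕ) : gridPoint n (k + 1) = gridPoint n k + gridPoint n 1 := by
  simp [gridPoint, add_div]

lemma gridPoint_pred_gridIndex_le (n : ℕ) (t : ℝ≥0) : gridPoint n (gridIndex n t - 1) ≤ t := by
  rw [gridPoint, gridIndex, div_le_iff₀ (by positivity)]
  simpa using Nat.floor_le (by positivity : 0 ≤ t * 2 ^ n)

lemma gridPoint_gridIndex_le (n : ℕ) (t : ℝ≥0) :
    gridPoint n (gridIndex n t) ≤ t + gridPoint n 1 := by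
  have := gridPoint_pred_gridIndex_le n t
  have e : gridIndex n t = gridIndex n t - 1 + 1 := by simp [gridIndex]
  rw [e, gridPoint_succ]
  gcongr

lemma tendsto_gridPoint_one : Tendsto (fun n => gridPoint n 1) atTop (𝓝 0) := by
  have := tendsto_pow_atTop_nhds_zero_of_lt_one (r := (1 / 2 : ℝ≥0)) (by positivity)
    (by rw [← NNReal.coe_lt_coe]; norm_num)
  refine this.congr fun n => ?_
  simp [gridPoint]

/-- The approach is strictly from the right even when `t` is a grid point, so right-continuity in
the form `𝓝[>] t` applies directly. -/
lemma tendsto_gridPoint_gridIndex (t : ℝ≥0) :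
    Tendsto (fun n => gridPoint n (gridIndex n t)) atTop (𝓝[>] t) := by
  refine tendsto_nhdsWithin_iff.2 ⟨?_, Eventually.of_forall fun n => lt_gridPoint_gridIndex n t⟩
  refine tendsto_of_tendsto_of_tendsto_of_le_of_le tendsto_const_nhds
    (h := fun n => t + gridPoint n 1) ?_
    (fun n => (lt_gridPoint_gridIndex n t).le) (fun n => gridPoint_gridIndex_le n t)
  simpa using tendsto_gridPoint_one.const_add t

lemma measurable_gridIndex (n : ℕ) : Measurable (gridIndex n) :=
  (Nat.measurable_floor.comp (measurable_id.mul_const _)).add_const 1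

/-- Lebesgue measure on the time axis. -/
def timeMeasure : Measure ℝ≥0 := (volume.restrict (Set.Ioi (0 : ℝ))).map Real.toNNReal

instance : SFinite timeMeasure := by
  unfold timeMeasure
  infer_instance

lemma lintegral_timeMeasure {f : ℝ≥0 → ℝ≥0∞} (hf : Measurable f) :
    ∫⁻ u, f u ∂timeMeasure = ∫⁻ t in Set.Ioi (0 : ℝ), f t.toNNReal :=
  lintegral_map hf measurable_real_toNNReal

lemma lintegral_timeMeasure_shift (t : ℝ≥0) {f : ℝ≥0 → ℝ≥0∞} (hf : Measurable f) :
    ∫⁻ u, f (t + u) ∂timeMeasure = ∫⁻ u in Set.Ioi t, f u ∂timeMeasure := by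
  rw [← lintegral_indicator measurableSet_Ioi, lintegral_timeMeasure (by fun_prop),
    lintegral_timeMeasure (hf.indicator measurableSet_Ioi),
    ← lintegral_indicator measurableSet_Ioi, ← lintegral_indicator measurableSet_Ioi,
    ← lintegral_add_left_eq_self _ (-(t : ℝ))]
  refine lintegral_congr fun v => ?_
  by_cases hv : (t : ℝ) < v
  · have h0 : 0 < v := lt_of_le_of_lt t.2 hv
    have h1 : t < v.toNNReal := by rwa [Real.lt_toNNReal_iff_coe_lt]
    have e : t + (-(t : ℝ) + v).toNNReal = v.toNNReal := by
      apply NNReal.coe_injective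
      rw [NNReal.coe_add, Real.coe_toNNReal _ (by linarith), Real.coe_toNNReal _ h0.le]
      ring
    rw [Set.indicator_of_mem (by simpa using hv), Set.indicator_of_mem (by simpa using h0),
      Set.indicator_of_mem (by exact h1), e]
  · have h1 : ¬ t < v.toNNReal := by rwa [Real.lt_toNNReal_iff_coe_lt]
    rw [Set.indicator_of_notMem (by simpa using hv)]
    by_cases h0 : 0 < v
    · rw [Set.indicator_of_mem (by simpa using h0), Set.indicator_of_notMem (by exact h1)]
    · rw [Set.indicator_of_notMem (by simpa using h0)]

lemma timeMeasure_Ioc (a b : ℝ≥0) : timeMeasure (Set.Ioc a b) = ENNReal.ofReal (b - a) := by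
  rw [timeMeasure, Measure.map_apply measurable_real_toNNReal measurableSet_Ioc,
    Measure.restrict_apply (measurable_real_toNNReal measurableSet_Ioc), ← Real.volume_Ioc]
  congr 1
  ext v
  simp only [Set.mem_inter_iff, Set.mem_preimage, Set.mem_Ioc, Set.mem_Ioi,
    Real.lt_toNNReal_iff_coe_lt]
  constructor
  · rintro ⟨⟨h1, h2⟩, h3⟩
    exact ⟨h1, (Real.toNNReal_le_iff_le_coe).1 h2⟩
  · rintro ⟨h1, h2⟩
    exact ⟨⟨h1, (Real.toNNReal_le_iff_le_coe).2 h2⟩, lt_of_le_of_lt a.2 h1⟩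

instance : NullSingletonClass timeMeasure where
  measure_singleton a := by
    rw [timeMeasure, Measure.map_apply measurable_real_toNNReal (measurableSet_singleton _),
      Measure.restrict_apply (measurable_real_toNNReal (measurableSet_singleton _))]
    refine measure_mono_null (t := {(a : ℝ)}) ?_ (measure_singleton _)
    rintro v ⟨hv, hv0⟩
    rw [Set.mem_singleton_iff, ← (show v.toNNReal = a from hv), Real.coe_toNNReal _ (le_of_lt hv0)]

/-! ### Functionals of right-continuous paths -/

namespace MAPPath

/-- Paths that are right-continuous, avoid the level `∞` and are absorbed at the level `-∞`. -/
structure RightCts (x : MAPPath) : Prop where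
  ne_top : ∀ t, (x t).1 ≠ ⊤
  absorbed : ∀ s t, s ≤ t → (x s).1 = ⊥ → (x t).1 = ⊥
  fst : ∀ t, Tendsto (fun u => (x u).1) (𝓝[>] t) (𝓝 (x t).1)
  snd : ∀ t, ∀ᶠ u in 𝓝[>] t, (x u).2 = (x t).2

lemma tendsto_add_left_nhdsGT (t u : ℝ≥0) :
    Tendsto (fun v => t + v) (𝓝[>] u) (𝓝[>] (t + u)) :=
  tendsto_nhdsWithin_iff.2 ⟨((continuous_const.add continuous_id).tendsto u).mono_left
    nhdsWithin_le_nhds, eventually_nhdsWithin_of_forall fun v (hv : u < v) =>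
      add_lt_add_right hv t⟩

lemma tendsto_sub_coe (a : EReal) (b : ℝ) :
    Tendsto (fun c : EReal => c - b) (𝓝 a) (𝓝 (a - b)) := by
  have := (EReal.continuousAt_add (p := (a, ((-b : ℝ) : EReal))) (by simp) (by simp)).tendsto
  have h2 : Tendsto (fun c : EReal => (c, ((-b : ℝ) : EReal))) (𝓝 a)
      (𝓝 (a, ((-b : ℝ) : EReal))) := tendsto_id.prodMk_nhds tendsto_const_nhds
  simpa [sub_eq_add_neg, Function.comp_def] using this.comp h2

lemma bot_or_tendsto_sub {x : MAPPath} (hx : RightCts x) (t : ℝ≥0) :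
    (∀ u, t ≤ u → (x u).1 - (x t).1 = ⊥) ∨ ∃ r : ℝ, (x t).1 = r := by
  by_cases hb : (x t).1 = ⊥
  · left
    intro u hu
    rw [hx.absorbed t u hu hb]
    simp [sub_eq_add_neg]
  · right
    have := hx.ne_top t
    lift (x t).1 to ℝ using ⟨this, hb⟩ with r
    exact ⟨r, rfl⟩

/-- If the path is dead at `t`, the convention `⊥ - ⊥ = ⊥` keeps the shifted path dead forever;
otherwise a real constant is subtracted. -/
lemma RightCts.shift {x : MAPPath} (hx : RightCts x) (t : ℝ≥0) : RightCts (shift t x) := by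
  have h2 : ∀ u, ∀ᶠ v in 𝓝[>] u, (MAPPath.shift t x v).2 = (MAPPath.shift t x u).2 := fun u =>
    (tendsto_add_left_nhdsGT t u).eventually (hx.snd (t + u))
  rcases bot_or_tendsto_sub hx t with hb | ⟨r, hr⟩
  · have hb' : ∀ u, (MAPPath.shift t x u).1 = ⊥ := fun u => hb (t + u) le_self_add
    refine ⟨fun u => ?_, fun u v _ _ => hb' v, fun u => ?_, h2⟩
    · rw [hb' u]; exact bot_ne_top
    · simp only [hb']; exact tendsto_const_nhds
  · have e : ∀ u, (MAPPath.shift t x u).1 = (x (t + u)).1 - r := fun u => by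
      simp [MAPPath.shift, hr]
    refine ⟨fun u => ?_, fun u v huv hu => ?_, fun u => ?_, h2⟩
    · have := hx.ne_top (t + u)
      rw [e]
      generalize (x (t + u)).1 = y at this ⊢
      induction y with
      | bot => simp
      | top => exact absurd rfl this
      | coe y => rw [← EReal.coe_sub]; exact EReal.coe_ne_top _
    · rw [e] at hu ⊢
      have : (x (t + u)).1 = ⊥ := by
        generalize (x (t + u)).1 = y at hu ⊢
        induction y with
        | bot => rfl
        | top => simp at hu
        | coe y => rw [← EReal.coe_sub] at hu; exact absurd hu (EReal.coe_ne_bot _)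
      rw [hx.absorbed _ _ (add_le_add_right huv t) this]
      simp
    · simp only [e]
      exact (tendsto_sub_coe _ r).comp ((hx.fst (t + u)).comp (tendsto_add_left_nhdsGT t u))

lemma shift_shift {x : MAPPath} (hx : RightCts x) (t u : ℝ≥0) (ht : (x t).1 ≠ ⊥)
    (hu : (x (t + u)).1 ≠ ⊥) : shift u (shift t x) = shift (t + u) x := by
  funext v
  have h1 := hx.ne_top t
  have h2 := hx.ne_top (t + u)
  have h3 := hx.ne_top (t + u + v)
  simp only [shift, ← add_assoc]
  lift (x t).1 to ℝ using ⟨h1, ht⟩ with a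
  lift (x (t + u)).1 to ℝ using ⟨h2, hu⟩ with b
  generalize (x (t + u + v)).1 = c at h3 ⊢
  induction c with
  | bot => simp
  | top => exact absurd rfl h3
  | coe c => simp only [← EReal.coe_sub]; congr 2; ring

lemma RightCts.tendsto_killedExp {x : MAPPath} (hx : RightCts x) (z : ℝ) (t : ℝ≥0) :
    Tendsto (fun u => killedExp z (x u).1) (𝓝[>] t) (𝓝 (killedExp z (x t).1)) := by
  by_cases hb : (x t).1 = ⊥
  · refine tendsto_const_nhds.congr' ?_
    filter_upwards [self_mem_nhdsWithin] with u hu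
    rw [hx.absorbed t u (le_of_lt hu) hb, hb]
  · exact (tendsto_killedExp_of_ne_bot z (hx.ne_top t) hb).comp (hx.fst t)

/-- The first time at which the second coordinate leaves its initial state. -/
def firstSwitch (x : MAPPath) : ℝ≥0∞ :=
  ⨅ (n : ℕ) (k : ℕ) (_ : (x (gridPoint n k)).2 ≠ (x 0).2), (gridPoint n k : ℝ≥0∞)

lemma measurable_firstSwitch : Measurable firstSwitch := by
  refine Measurable.iInf fun n => Measurable.iInf fun k => ?_
  have hm : MeasurableSet {x : MAPPath | (x (gridPoint n k)).2 ≠ (x 0).2} :=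
    (measurableSet_eq_fun (measurable_snd.comp (measurable_pi_apply _))
      (measurable_snd.comp (measurable_pi_apply _))).compl
  have : (fun x : MAPPath => ⨅ (_ : (x (gridPoint n k)).2 ≠ (x 0).2), (gridPoint n k : ℝ≥0∞)) =
      {x : MAPPath | (x (gridPoint n k)).2 ≠ (x 0).2}.piecewise
        (fun _ => (gridPoint n k : ℝ≥0∞)) (fun _ => ⊤) := by
    funext x
    by_cases hx : (x (gridPoint n k)).2 = (x 0).2 <;> simp [Set.piecewise, hx]
  rw [this]
  exact measurable_const.piecewise hm measurable_const

section
variable {x : MAPPath} (hx : RightCts x)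
include hx

/-- Looking at grid points only makes `firstSwitch` measurable. Nothing is lost, since by
right-continuity a departure at `v` is still visible at grid points just after `v`. The inequality
is strict because at the switch time the state has already changed. -/
lemma lt_firstSwitch_iff (u : ℝ≥0) :
    (u : ℝ≥0∞) < firstSwitch x ↔ ∀ v ≤ u, (x v).2 = (x 0).2 := by
  constructor
  · intro hu v hv
    by_contra hne
    have h1 : ∀ᶠ n in atTop, (x (gridPoint n (gridIndex n v))).2 = (x v).2 :=
      (tendsto_gridPoint_gridIndex v).eventually (hx.snd v)
    have h2 : ∀ᶠ n in atTop, ((gridPoint n (gridIndex n v) : ℝ≥0) : ℝ≥0∞) < firstSwitch x := by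
      have := (ENNReal.tendsto_coe.2 ((tendsto_gridPoint_gridIndex v).mono_right
        nhdsWithin_le_nhds))
      exact this.eventually (gt_mem_nhds (lt_of_le_of_lt (by exact_mod_cast hv) hu))
    obtain ⟨n, hn1, hn2⟩ := (h1.and h2).exists
    refine absurd hn2 (not_lt.2 ?_)
    exact iInf_le_of_le n (iInf_le_of_le (gridIndex n v) (iInf_le _ (by rw [hn1]; exact hne)))
  · intro hu
    obtain ⟨b, hb, hb'⟩ := (mem_nhdsGT_iff_exists_Ioo_subset).1 (hx.snd u)
    have : (b : ℝ≥0∞) ≤ firstSwitch x := by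
      refine le_iInf fun n => le_iInf fun k => le_iInf fun hk => ?_
      by_contra hlt
      have hlt' : gridPoint n k < b := by exact_mod_cast not_le.1 hlt
      apply hk
      rcases le_or_gt (gridPoint n k) u with h1 | h1
      · exact hu _ h1
      · have := hb' ⟨h1, hlt'⟩
        exact Eq.trans this (hu u le_rfl)
    exact lt_of_lt_of_le (by exact_mod_cast hb) this

lemma snd_firstSwitch_ne {S : ℝ≥0} (hS : firstSwitch x = S) : (x S).2 ≠ (x 0).2 := by
  have h1 : ¬ ((S : ℝ≥0∞) < firstSwitch x) := by simp [hS]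
  rw [lt_firstSwitch_iff hx] at h1
  push Not at h1
  obtain ⟨v, hv, hv'⟩ := h1
  rcases hv.eq_or_lt with rfl | hlt
  · exact hv'
  · have : (v : ℝ≥0∞) < firstSwitch x := by rw [hS]; exact_mod_cast hlt
    exact absurd ((lt_firstSwitch_iff hx v).1 this v le_rfl) hv'

lemma firstSwitch_pos : 0 < firstSwitch x := by
  have := (lt_firstSwitch_iff hx 0).2 (by intro v hv; rw [nonpos_iff_eq_zero.1 hv])
  simpa using this

lemma add_lt_firstSwitch_iff (t u : ℝ≥0) : ((t + u : ℝ≥0) : ℝ≥0∞) < firstSwitch x ↔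
    (t : ℝ≥0∞) < firstSwitch x ∧ (u : ℝ≥0∞) < firstSwitch (shift t x) := by
  rw [lt_firstSwitch_iff hx, lt_firstSwitch_iff hx, lt_firstSwitch_iff (hx.shift t)]
  constructor
  · intro H
    refine ⟨fun v hv => H v (hv.trans le_self_add), fun v hv => ?_⟩
    simp only [shift, add_zero]
    rw [H _ (add_le_add_right hv t), H t le_self_add]
  · rintro ⟨h1, h2⟩ v hv
    rcases le_total v t with hvt | hvt
    · exact h1 v hvt
    · obtain ⟨w, rfl⟩ := exists_add_of_le hvt
      have := h2 w (le_of_add_le_add_left hv)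
      simp only [shift, add_zero] at this
      rw [this, h1 t le_rfl]

lemma firstSwitch_eq_add {t : ℝ≥0} (ht : (t : ℝ≥0∞) < firstSwitch x) :
    firstSwitch x = t + firstSwitch (shift t x) := by
  refine eq_of_forall_lt_iff fun c => ?_
  induction c with
  | top => simp
  | coe c =>
    rcases le_total c t with hct | hct
    · have h1 : (c : ℝ≥0∞) ≤ t := by exact_mod_cast hct
      refine iff_of_true (lt_of_le_of_lt h1 ht) (lt_of_le_of_lt h1 ?_)
      exact ENNReal.lt_add_right ENNReal.coe_ne_top (firstSwitch_pos (hx.shift t)).ne'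
    · obtain ⟨w, rfl⟩ := exists_add_of_le hct
      rw [add_lt_firstSwitch_iff hx, and_iff_right ht, ENNReal.coe_add,
        ENNReal.add_lt_add_iff_left ENNReal.coe_ne_top]

end

/-- The exponential weight `e^{z ξ}` at time `u`, provided that no switch has occurred by then. -/
def sojourn (z : ℝ) (x : MAPPath) (u : ℝ≥0) : ℝ≥0∞ :=
  if (u : ℝ≥0∞) < firstSwitch x then killedExp z (x u).1 else 0

lemma measurable_sojourn (z : ℝ) (u : ℝ≥0) : Measurable fun x => sojourn z x u :=
  Measurable.ite (measurableSet_lt measurable_const measurable_firstSwitch)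
    ((measurable_killedExp z).comp (measurable_fst.comp (measurable_pi_apply u))) measurable_const

lemma sojourn_le_killedExp (z : ℝ) (x : MAPPath) (u : ℝ≥0) :
    sojourn z x u ≤ killedExp z (x u).1 := by
  unfold sojourn; split_ifs <;> simp

lemma sojourn_ne_top (z : ℝ) (x : MAPPath) (u : ℝ≥0) : sojourn z x u ≠ ∞ :=
  ((sojourn_le_killedExp z x u).trans_lt (killedExp_ne_top z _).lt_top).ne

section
variable {x : MAPPath} (hx : RightCts x)
include hx

lemma killedExp_add_time (z : ℝ) (t u : ℝ≥0) :
    killedExp z (x (t + u)).1 = killedExp z (x t).1 * killedExp z (shift t x u).1 := by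
  by_cases hb : (x t).1 = ⊥
  · simp [hx.absorbed t (t + u) le_self_add hb, hb]
  · exact (killedExp_mul_killedExp_sub z (hx.ne_top _) (hx.ne_top _) hb).symm

/-- Both the exponential weight and the indicator of no switch are multiplicative along shifts.
Together with the Markov property this makes the mean of `sojourn` multiplicative in time. -/
lemma sojourn_add (z : ℝ) (t u : ℝ≥0) :
    sojourn z x (t + u) = sojourn z x t * sojourn z (shift t x) u := by
  simp only [sojourn, add_lt_firstSwitch_iff hx]
  by_cases h1 : (t : ℝ≥0∞) < firstSwitch x
  · by_cases h2 : (u : ℝ≥0∞) < firstSwitch (shift t x)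
    · simp [h1, h2, killedExp_add_time hx]
    · simp [h1, h2]
  · simp [h1]

lemma tendsto_sojourn (z : ℝ) (t : ℝ≥0) :
    Tendsto (fun u => sojourn z x u) (𝓝[>] t) (𝓝 (sojourn z x t)) := by
  by_cases h1 : (t : ℝ≥0∞) < firstSwitch x
  · have e : sojourn z x t = killedExp z (x t).1 := by simp [sojourn, h1]
    rw [e]
    refine (hx.tendsto_killedExp z t).congr' ?_
    have : ∀ᶠ u : ℝ≥0 in 𝓝[>] t, (u : ℝ≥0∞) < firstSwitch x :=
      nhdsWithin_le_nhds ((ENNReal.continuous_coe.tendsto t).eventually (gt_mem_nhds h1))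
    filter_upwards [this] with u hu
    simp [sojourn, hu]
  · have e : sojourn z x t = 0 := by simp [sojourn, h1]
    rw [e]
    refine tendsto_const_nhds.congr' ?_
    filter_upwards [self_mem_nhdsWithin] with u hu
    have : ¬ ((u : ℝ≥0∞) < firstSwitch x) := fun H => h1 (lt_trans (by exact_mod_cast hu) H)
    simp [sojourn, this]

end

/-- A jointly measurable version of `killedExp z (x u).1`. -/
def levelVersion (z : ℝ) (p : MAPPath × ℝ≥0) : ℝ≥0∞ :=
  liminf (fun n => killedExp z (p.1 (gridPoint n (gridIndex n p.2))).1) atTop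

lemma measurable_levelVersion (z : ℝ) : Measurable (levelVersion z) := by
  refine Measurable.liminf fun n => ((measurable_killedExp z).comp
    (measurable_fst : Measurable fun q : EReal × ℤˣ => q.1)).comp ?_
  have h1 : Measurable fun q : MAPPath × ℕ => q.1 (gridPoint n q.2) :=
    measurable_from_prod_countable_left fun k => by
      exact measurable_pi_apply (gridPoint n k)
  exact h1.comp (measurable_fst.prodMk ((measurable_gridIndex n).comp measurable_snd))

lemma levelVersion_eq {x : MAPPath} (hx : RightCts x) (z : ℝ) (u : ℝ≥0) :
    levelVersion z (x, u) = killedExp z (x u).1 :=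
  ((hx.tendsto_killedExp z u).comp (tendsto_gridPoint_gridIndex u)).liminf_eq

lemma measurable_level_path {x : MAPPath} (hx : RightCts x) (z : ℝ) :
    Measurable fun u => killedExp z (x u).1 := by
  have := (measurable_levelVersion z).comp (measurable_prodMk_left (x := x))
  simpa only [Function.comp_def, levelVersion_eq hx] using this

/-- The functional agrees on right-continuous paths with a measurable one. -/
def HasMeasurableVersion (Φ : MAPPath → ℝ≥0∞) : Prop :=
  ∃ Ψ : MAPPath → ℝ≥0∞, Measurable Ψ ∧ ∀ x, RightCts x → Φ x = Ψ x

/-- The exponential functional of a path. -/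
def totalIntegral (α : ℝ) (x : MAPPath) : ℝ≥0∞ := ∫⁻ u, killedExp α (x u).1 ∂timeMeasure

/-- The exponential functional of a path up to its first switch. -/
def sojournIntegral (α : ℝ) (x : MAPPath) : ℝ≥0∞ := ∫⁻ u, sojourn α x u ∂timeMeasure

/-- The exponential weight at the first switch. -/
def switchWeight (z : ℝ) (x : MAPPath) : ℝ≥0∞ :=
  if firstSwitch x = ∞ then 0 else killedExp z (x (firstSwitch x).toNNReal).1

/-- The supremum of `sojourn z x` over the unit interval, taken over the grid points. -/
def unitSup (z : ℝ) (x : MAPPath) : ℝ≥0∞ :=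
  ⨆ (n : ℕ) (k : Fin (2 ^ n + 1)), sojourn z x (gridPoint n k)

lemma measurable_unitSup (z : ℝ) : Measurable (unitSup z) :=
  Measurable.iSup fun _ => Measurable.iSup fun _ => measurable_sojourn z _

/-- The product σ-algebra on all paths sees only countably many coordinates at a time, so
measurability of path integrals is claimed only up to agreement on right-continuous paths. -/
lemma hasMeasurableVersion_totalIntegral (α : ℝ) : HasMeasurableVersion (totalIntegral α) :=
  ⟨fun x => ∫⁻ u, levelVersion α (x, u) ∂timeMeasure,
    (measurable_levelVersion α).lintegral_prod_right',
    fun _ hx => lintegral_congr fun u => (levelVersion_eq hx α u).symm⟩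

lemma hasMeasurableVersion_sojournIntegral (α : ℝ) :
    HasMeasurableVersion (sojournIntegral α) := by
  refine ⟨fun x => ∫⁻ u, (if (u : ℝ≥0∞) < firstSwitch x then levelVersion α (x, u) else 0)
    ∂timeMeasure, Measurable.lintegral_prod_right' (f := fun p : MAPPath × ℝ≥0 =>
    if (p.2 : ℝ≥0∞) < firstSwitch p.1 then levelVersion α p else 0) ?_,
    fun x hx => lintegral_congr fun u => ?_⟩
  · exact Measurable.ite (measurableSet_lt (measurable_coe_nnreal_ennreal.comp measurable_snd)
      (measurable_firstSwitch.comp measurable_fst)) (measurable_levelVersion α) measurable_const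
  · simp only [sojourn, levelVersion_eq hx]

lemma hasMeasurableVersion_switchWeight (z : ℝ) : HasMeasurableVersion (switchWeight z) := by
  refine ⟨fun x => if firstSwitch x = ∞ then 0 else levelVersion z (x, (firstSwitch x).toNNReal),
    ?_, fun x hx => ?_⟩
  · exact Measurable.ite (measurable_firstSwitch (measurableSet_singleton _)) measurable_const
      ((measurable_levelVersion z).comp (measurable_id.prodMk
        measurable_firstSwitch.ennreal_toNNReal))
  · simp only [switchWeight, levelVersion_eq hx]

lemma HasMeasurableVersion.rpow {Φ : MAPPath → ℝ≥0∞} (hΦ : HasMeasurableVersion Φ) (s : ℝ) :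
    HasMeasurableVersion fun x => Φ x ^ s := by
  obtain ⟨Ψ, hΨ, e⟩ := hΦ
  exact ⟨fun x => Ψ x ^ s, hΨ.pow_const s, fun x hx => by simp only [e x hx]⟩

lemma _root_.Measurable.hasMeasurableVersion {Φ : MAPPath → ℝ≥0∞} (hΦ : Measurable Φ) :
    HasMeasurableVersion Φ := ⟨Φ, hΦ, fun _ _ => rfl⟩

section
variable {x : MAPPath} (hx : RightCts x)
include hx

lemma measurable_sojourn_path (z : ℝ) : Measurable fun u => sojourn z x u :=
  Measurable.ite (measurableSet_lt measurable_coe_nnreal_ennreal measurable_const)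
    (measurable_level_path hx z) measurable_const

lemma lintegral_Ioi_level (α : ℝ) (t : ℝ≥0) :
    ∫⁻ u in Set.Ioi t, killedExp α (x u).1 ∂timeMeasure =
      killedExp α (x t).1 * totalIntegral α (shift t x) := by
  rw [← lintegral_timeMeasure_shift t (measurable_level_path hx α), totalIntegral,
    ← lintegral_const_mul _ (measurable_level_path (hx.shift t) α)]
  simp only [killedExp_add_time hx]

lemma lintegral_Ioi_sojourn (α : ℝ) (t : ℝ≥0) :
    ∫⁻ u in Set.Ioi t, sojourn α x u ∂timeMeasure =
      sojourn α x t * sojournIntegral α (shift t x) := by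
  rw [← lintegral_timeMeasure_shift t (measurable_sojourn_path hx α), sojournIntegral,
    ← lintegral_const_mul _ (measurable_sojourn_path (hx.shift t) α)]
  simp only [sojourn_add hx]

/-- A time `u < 1` is a limit from the right of grid points in the unit interval. The endpoint `1`
has no such approximation inside the interval, but is itself a grid point. -/
lemma sojourn_le_unitSup (z : ℝ) {u : ℝ≥0} (hu : u ≤ 1) : sojourn z x u ≤ unitSup z x := by
  have key : ∀ n k, k ≤ 2 ^ n → sojourn z x (gridPoint n k) ≤ unitSup z x := fun n k hk =>
    le_iSup_of_le n (le_iSup_of_le (⟨k, Nat.lt_succ_of_le hk⟩ : Fin (2 ^ n + 1)) le_rfl)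
  rcases hu.eq_or_lt with rfl | hu
  · simpa [gridPoint] using key 0 1 (by simp)
  · refine le_of_tendsto ((tendsto_sojourn hx z u).comp (tendsto_gridPoint_gridIndex u))
      (Eventually.of_forall fun n => key n _ ?_)
    have h2 : u * 2 ^ n < ((2 ^ n : ℕ) : ℝ≥0) := by
      push_cast
      exact mul_lt_of_lt_one_left (by positivity) hu
    exact (Nat.floor_lt (by positivity)).2 h2

omit hx in
lemma sojourn_rpow (α : ℝ) {s : ℝ} (hs : 0 < s) (u : ℝ≥0) :
    sojourn α x u ^ s = sojourn (α * s) x u := by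
  unfold sojourn
  split_ifs
  · exact killedExp_rpow α hs _
  · simp [hs]

/-- The interval has length one, so the integral is at most the supremum of the integrand; the power
`s` turns the exponent `α` into `α * s`. -/
lemma rpow_lintegral_unit_le (α : ℝ) {s : ℝ} (hs : 0 < s) (n : ℕ) :
    (∫⁻ u in Set.Ioc (n : ℝ≥0) (n + 1), sojourn α x u ∂timeMeasure) ^ s ≤
      sojourn (α * s) x n * unitSup (α * s) (shift n x) := by
  set C := sojourn (α * s) x n * unitSup (α * s) (shift n x)
  have h1 : ∀ u ∈ Set.Ioc (n : ℝ≥0) (n + 1), sojourn α x u ≤ C ^ s⁻¹ := by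
    rintro u ⟨hu1, hu2⟩
    obtain ⟨v, rfl⟩ := exists_add_of_le hu1.le
    rw [ENNReal.le_rpow_inv_iff hs, sojourn_rpow α hs, sojourn_add hx]
    exact mul_le_mul_right (sojourn_le_unitSup (hx.shift _) _ (le_of_add_le_add_left hu2)) _
  have h2 : ∫⁻ u in Set.Ioc (n : ℝ≥0) (n + 1), sojourn α x u ∂timeMeasure ≤ C ^ s⁻¹ := by
    refine (setLIntegral_mono measurable_const h1).trans ?_
    rw [setLIntegral_const, timeMeasure_Ioc]
    simp
  exact (ENNReal.le_rpow_inv_iff hs).1 h2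

omit hx in
lemma sojournIntegral_le_tsum (α : ℝ) : sojournIntegral α x ≤
    ∑' n : ℕ, ∫⁻ u in Set.Ioc (n : ℝ≥0) (n + 1), sojourn α x u ∂timeMeasure := by
  have hU : (⋃ n : ℕ, Set.Ioc (n : ℝ≥0) (n + 1)) = ({0} : Set ℝ≥0)ᶜ := by
    ext u
    simp only [Set.mem_iUnion, Set.mem_Ioc, Set.mem_compl_iff, Set.mem_singleton_iff]
    constructor
    · rintro ⟨n, h1, _⟩ rfl
      exact absurd h1 (by simp)
    · intro hu
      have h1 : 0 < ⌈u⌉₊ := Nat.ceil_pos.2 (pos_iff_ne_zero.2 hu)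
      refine ⟨⌈u⌉₊ - 1, Nat.lt_ceil.1 (by lia), ?_⟩
      have h2 : ((⌈u⌉₊ - 1 : ℕ) : ℝ≥0) + 1 = (⌈u⌉₊ : ℕ) := by
        exact_mod_cast Nat.sub_add_cancel h1
      rw [h2]
      exact Nat.le_ceil u
  refine le_trans (le_of_eq ?_) (lintegral_iUnion_le _ _)
  rw [hU, setLIntegral_congr (t := Set.univ), setLIntegral_univ]
  · rfl
  · exact (ae_eq_univ.2 (by rw [compl_compl]; exact measure_singleton 0))

end

end MAPPath

/-- Countable subadditivity of `x ↦ x ^ s` for `0 < s ≤ 1`. -/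
lemma ENNReal.rpow_tsum_le {s : ℝ} (hs : 0 < s) (hs1 : s ≤ 1) (f : ℕ → ℝ≥0∞) :
    (∑' n, f n) ^ s ≤ ∑' n, f n ^ s := by
  have h1 : Tendsto (fun N => (∑ n ∈ Finset.range N, f n) ^ s) atTop (𝓝 ((∑' n, f n) ^ s)) :=
    ((ENNReal.continuous_rpow_const (y := s)).tendsto _).comp
      ENNReal.summable.hasSum.tendsto_sum_nat
  refine le_of_tendsto h1 (Eventually.of_forall fun N => ?_)
  refine le_trans ?_ (ENNReal.sum_le_tsum (Finset.range N))
  induction N with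
  | zero => simp [hs]
  | succ N ih =>
    rw [Finset.sum_range_succ, Finset.sum_range_succ]
    exact (ENNReal.rpow_add_le_add_rpow _ _ hs.le hs1).trans (by gcongr)

/-! ### The Markov property for path functionals, and holding times -/

namespace IsMAP

open MAPPath

variable {Ω : Type*} [mΩ : MeasurableSpace Ω] {𝓖 : Filtration ℝ≥0 mΩ}
  {ξ : ℝ≥0 → Ω → EReal} {J : ℝ≥0 → Ω → ℤˣ} {P : ℝ → ℤˣ → Measure Ω}

section
variable (h : IsMAP 𝓖 ξ J P)
include h

lemma rightCts_path (ω : Ω) : RightCts (path ξ J ω) :=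
  ⟨fun t => h.ne_top t ω, fun s t => h.absorbed s t ω, fun t => h.rightCts_fst t ω,
    fun t => h.rightCts_snd t ω⟩

lemma measurable_comp_shift_path {Φ : MAPPath → ℝ≥0∞} (hΦ : HasMeasurableVersion Φ) (t : ℝ≥0) :
    Measurable fun ω => Φ (shift t (path ξ J ω)) := by
  obtain ⟨Ψ, hΨ, e⟩ := hΦ
  simpa only [e _ ((h.rightCts_path _).shift t), Function.comp_def] using
    hΨ.comp (h.measurable_shift_path t)

lemma measurable_comp_path {Φ : MAPPath → ℝ≥0∞} (hΦ : HasMeasurableVersion Φ) :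
    Measurable fun ω => Φ (path ξ J ω) := by
  obtain ⟨Ψ, hΨ, e⟩ := hΦ
  simpa only [e _ (h.rightCts_path _), Function.comp_def] using hΨ.comp h.measurable_path

lemma lintegral_markov_version (z : ℝ) (i j : ℤˣ) (t : ℝ≥0) {f : Ω → ℝ≥0∞}
    (hf : Measurable[𝓖 t] f) {Φ : MAPPath → ℝ≥0∞} (hΦ : HasMeasurableVersion Φ) :
    ∫⁻ ω in {ω | J t ω = j ∧ ξ t ω ≠ ⊥}, f ω * Φ (shift t (path ξ J ω)) ∂(P z i) =
      (∫⁻ ω in {ω | J t ω = j ∧ ξ t ω ≠ ⊥}, f ω ∂(P z i)) * ∫⁻ ω, Φ (path ξ J ω) ∂(P 0 j) := by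
  obtain ⟨Ψ, hΨ, e⟩ := hΦ
  simp only [e _ ((h.rightCts_path _).shift t), e _ (h.rightCts_path _)]
  exact h.lintegral_markov z i j t hf hΨ

lemma lt_firstSwitch_path_iff (ω : Ω) (u : ℝ≥0) :
    (u : ℝ≥0∞) < firstSwitch (path ξ J ω) ↔ ∀ v ≤ u, J v ω = J 0 ω :=
  lt_firstSwitch_iff (h.rightCts_path ω) u

/-- A departure before `u` is visible at grid points which are still before `u`. Testing `u` itself
and the grid points up to `u` is therefore enough, with no look into the future. -/
lemma measurableSet_lt_firstSwitch {u t : ℝ≥0} (hut : u ≤ t) :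
    MeasurableSet[𝓖 t] {ω | (u : ℝ≥0∞) < firstSwitch (path ξ J ω)} := by
  have e : {ω | (u : ℝ≥0∞) < firstSwitch (path ξ J ω)} = {ω | J u ω = J 0 ω} ∩
      ⋂ (n : ℕ) (k : ℕ) (_ : gridPoint n k ≤ u), {ω | J (gridPoint n k) ω = J 0 ω} := by
    ext ω
    simp only [Set.mem_ofPred_eq, Set.mem_inter_iff, Set.mem_iInter, h.lt_firstSwitch_path_iff]
    refine ⟨fun H => ⟨H u le_rfl, fun n k hk => H _ hk⟩, fun ⟨H1, H2⟩ v hv => ?_⟩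
    rcases hv.eq_or_lt with rfl | hlt
    · exact H1
    · have h1 := (tendsto_gridPoint_gridIndex v).eventually (h.rightCts_snd v ω)
      have h2 := ((tendsto_gridPoint_gridIndex v).mono_right nhdsWithin_le_nhds).eventually
        (gt_mem_nhds hlt)
      obtain ⟨n, hn1, hn2⟩ := (h1.and h2).exists
      rw [← hn1]
      exact H2 n _ hn2.le
  have m : ∀ v ≤ u, MeasurableSet[𝓖 t] {ω | J v ω = J 0 ω} := fun v hv =>
    measurableSet_eq_fun (m := 𝓖 t)
      ((h.measurable_snd v).mono (𝓖.mono (hv.trans hut)) le_rfl)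
      ((h.measurable_snd 0).mono (𝓖.mono zero_le) le_rfl)
  rw [e]
  exact (m u le_rfl).inter (MeasurableSet.iInter fun n => MeasurableSet.iInter fun k =>
    MeasurableSet.iInter fun hk => m _ hk)

lemma measurable_sojourn_adapted (z : ℝ) {u t : ℝ≥0} (hut : u ≤ t) :
    Measurable[𝓖 t] fun ω => sojourn z (path ξ J ω) u :=
  Measurable.ite (h.measurableSet_lt_firstSwitch hut)
    ((measurable_killedExp z).comp ((h.measurable_fst u).mono (𝓖.mono hut) le_rfl))
    measurable_const

/-- The Markov property on the event that no switch has occurred. -/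
lemma lintegral_sojourn_markov (z : ℝ) (i : ℤˣ) (t : ℝ≥0) {f : Ω → ℝ≥0∞}
    (hf : Measurable[𝓖 t] f) {Φ : MAPPath → ℝ≥0∞} (hΦ : HasMeasurableVersion Φ) :
    ∫⁻ ω, f ω * sojourn z (path ξ J ω) t * Φ (shift t (path ξ J ω)) ∂(P 0 i) =
      (∫⁻ ω, f ω * sojourn z (path ξ J ω) t ∂(P 0 i)) * ∫⁻ ω, Φ (path ξ J ω) ∂(P 0 i) := by
  have hE : MeasurableSet {ω | J t ω = i ∧ ξ t ω ≠ ⊥} :=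
    𝓖.le t _ ((h.measurableSet_state le_rfl {i}).inter (h.measurableSet_alive le_rfl))
  have key := h.lintegral_markov_version 0 i i t
    (hf.mul (h.measurable_sojourn_adapted z (le_refl t))) hΦ
  -- The weight already carries the event on which the fixed-time Markov property restarts from `i`,
  -- so restricting to that event costs nothing.
  have zero : ∀ᵐ ω ∂(P 0 i), ω ∉ {ω | J t ω = i ∧ ξ t ω ≠ ⊥} → sojourn z (path ξ J ω) t = 0 := by
    filter_upwards [h.ae_start i] with ω hω hne
    by_cases h1 : (t : ℝ≥0∞) < firstSwitch (path ξ J ω)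
    · have h2 : J t ω = i := ((h.lt_firstSwitch_path_iff ω t).1 h1 t le_rfl).trans hω.2
      have h3 : ξ t ω = ⊥ := by by_contra h3; exact hne ⟨h2, h3⟩
      simp [sojourn, h3]
    · simp [sojourn, h1]
  have red : ∀ g : Ω → ℝ≥0∞, ∫⁻ ω, f ω * sojourn z (path ξ J ω) t * g ω ∂(P 0 i) =
      ∫⁻ ω in {ω | J t ω = i ∧ ξ t ω ≠ ⊥}, f ω * sojourn z (path ξ J ω) t * g ω ∂(P 0 i) := by
    intro g
    rw [← lintegral_indicator hE]
    refine lintegral_congr_ae ?_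
    filter_upwards [zero] with ω hω
    by_cases hm : ω ∈ {ω | J t ω = i ∧ ξ t ω ≠ ⊥}
    · rw [Set.indicator_of_mem hm]
    · rw [Set.indicator_of_notMem hm, hω hm]; simp
  have red1 := red fun _ => 1
  simp only [mul_one] at red1
  rw [red, red1]
  exact key

end

/-- The mean of the weight `e^{z ξ(t)}` on the event that no switch occurs by time `t`. -/
def sojournMoment (ξ : ℝ≥0 → Ω → EReal) (J : ℝ≥0 → Ω → ℤˣ) (P : ℝ → ℤˣ → Measure Ω)
    (i : ℤˣ) (z : ℝ) (t : ℝ≥0) : ℝ≥0∞ :=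
  ∫⁻ ω, sojourn z (path ξ J ω) t ∂(P 0 i)

/-- The probability that no switch occurs by time `t`. -/
def stayProb (ξ : ℝ≥0 → Ω → EReal) (J : ℝ≥0 → Ω → ℤˣ) (P : ℝ → ℤˣ → Measure Ω)
    (i : ℤˣ) (t : ℝ≥0) : ℝ :=
  (P 0 i).real {ω | (t : ℝ≥0∞) < firstSwitch (path ξ J ω)}

section
variable (h : IsMAP 𝓖 ξ J P)
include h

lemma sojournMoment_add (i : ℤˣ) (z : ℝ) (t u : ℝ≥0) :
    sojournMoment ξ J P i z (t + u) = sojournMoment ξ J P i z t * sojournMoment ξ J P i z u := by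
  have := h.lintegral_sojourn_markov z i t (f := fun _ => 1) measurable_const
    (measurable_sojourn z u).hasMeasurableVersion
  simp only [one_mul] at this
  simp only [sojournMoment, sojourn_add (h.rightCts_path _), this]

lemma sojournMoment_zero (i : ℤˣ) (z : ℝ) : sojournMoment ξ J P i z 0 = 1 := by
  have := h.isProbabilityMeasure 0 i
  have e : ∀ᵐ ω ∂(P 0 i), sojourn z (path ξ J ω) 0 = 1 := by
    filter_upwards [h.ae_start i] with ω hω
    have : ((0 : ℝ≥0) : ℝ≥0∞) < firstSwitch (path ξ J ω) := by
      simpa using firstSwitch_pos (h.rightCts_path ω)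
    simp [sojourn, hω.1, firstSwitch_pos (h.rightCts_path ω)]
  rw [sojournMoment, lintegral_congr_ae e]
  simp

lemma sojournMoment_nsmul (i : ℤˣ) (z : ℝ) (t : ℝ≥0) (n : ℕ) :
    sojournMoment ξ J P i z (n * t) = sojournMoment ξ J P i z t ^ n := by
  induction n with
  | zero => simp [h.sojournMoment_zero]
  | succ n ih => rw [Nat.cast_succ, add_mul, one_mul, h.sojournMoment_add, ih, pow_succ]

/-! ### The rates of the chain `J` -/

lemma measurableSet_state_eq (t : ℝ≥0) (j : ℤˣ) : MeasurableSet {ω | J t ω = j} :=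
  h.measurable_state t (measurableSet_singleton j)

lemma markov_real (i : ℤˣ) (t s : ℝ≥0) (j k : ℤˣ) {A : Set Ω} (hA : MeasurableSet[𝓖 t] A) :
    (P 0 i).real (A ∩ {ω | J t ω = j} ∩ {ω | J (t + s) ω = k}) =
      (P 0 i).real (A ∩ {ω | J t ω = j}) * (P 0 j).real {ω | J s ω = k} := by
  simp only [measureReal_def, h.markov 0 i t s j k A hA, ENNReal.toReal_mul]

lemma prob_state_self_add_neg (i : ℤˣ) (t : ℝ≥0) (k : ℤˣ) :
    (P 0 k).real {ω | J t ω = i} + (P 0 k).real {ω | J t ω = -i} = 1 := by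
  have := h.isProbabilityMeasure 0 k
  rw [← probReal_add_probReal_compl (μ := P 0 k) (h.measurableSet_state_eq t i)]
  congr 2
  ext ω
  simp [← intUnits_ne_iff]

/-- The Chapman–Kolmogorov equations. -/
lemma prob_state_add (i k : ℤˣ) (t s : ℝ≥0) : (P 0 i).real {ω | J (t + s) ω = k} =
    (P 0 i).real {ω | J t ω = i} * (P 0 i).real {ω | J s ω = k} +
      (P 0 i).real {ω | J t ω = -i} * (P 0 (-i)).real {ω | J s ω = k} := by
  have := h.isProbabilityMeasure 0 i
  have h1 := h.markov_real i t s i k MeasurableSet.univ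
  have h2 := h.markov_real i t s (-i) k MeasurableSet.univ
  rw [Set.univ_inter] at h1 h2
  rw [← h1, ← h2, ← measureReal_inter_add_sdiff (s := {ω | J (t + s) ω = k})
    (h.measurableSet_state_eq t i)]
  congr 2
  · ext ω; simp [and_comm]
  · ext ω; simp [← intUnits_ne_iff, and_comm]

lemma prob_forall_grid (i : ℤˣ) (t u : ℝ≥0) {A : Set Ω} (hA : MeasurableSet[𝓖 t] A) (m : ℕ) :
    (P 0 i).real (A ∩ {ω | ∀ l ≤ m, J (t + l * u) ω = i}) =
      (P 0 i).real (A ∩ {ω | J t ω = i}) * (P 0 i).real {ω | J u ω = i} ^ m := by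
  induction m with
  | zero => simp
  | succ m ih =>
    have hB : MeasurableSet[𝓖 (t + m * u)] (A ∩ {ω | ∀ l ≤ m, J (t + l * u) ω = i}) := by
      refine (𝓖.mono le_self_add _ hA).inter ?_
      rw [show {ω | ∀ l ≤ m, J (t + l * u) ω = i} =
        ⋂ (l : ℕ) (_ : l ≤ m), {ω | J (t + l * u) ω = i} by ext; simp]
      refine MeasurableSet.iInter fun l => MeasurableSet.iInter fun hl => ?_
      exact h.measurableSet_state (by gcongr) {i}
    have := h.markov_real i (t + m * u) u i i hB
    rw [pow_succ, ← mul_assoc, ← ih]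
    convert this using 2
    · ext ω
      simp only [Set.mem_inter_iff, Set.mem_ofPred_eq]
      constructor
      · rintro ⟨h1, h2⟩
        refine ⟨⟨⟨h1, fun l hl => h2 l (hl.trans (Nat.le_succ m))⟩, h2 m (Nat.le_succ m)⟩, ?_⟩
        have := h2 (m + 1) le_rfl
        rwa [Nat.cast_succ, add_mul, one_mul, ← add_assoc] at this
      · rintro ⟨⟨⟨h1, h2⟩, -⟩, h3⟩
        refine ⟨h1, fun l hl => ?_⟩
        rcases Nat.le_succ_iff.1 hl with hl | rfl
        · exact h2 l hl
        · rwa [Nat.succ_eq_add_one, Nat.cast_succ, add_mul, one_mul, ← add_assoc]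
    · congr 1
      ext ω
      simp only [Set.mem_inter_iff, Set.mem_ofPred_eq]
      exact ⟨fun H => ⟨H, H.2 m le_rfl⟩, fun H => H.1⟩

/-- Staying in a state throughout `[t, t + u]` is approximated by grids. -/
lemma forall_grid_iff (ω : Ω) (i : ℤˣ) (t u : ℝ≥0) :
    (∀ N : ℕ, ∀ l : ℕ, l ≤ 2 ^ N → J (t + l * (u / 2 ^ N)) ω = i) ↔ ∀ v ≤ u, J (t + v) ω = i := by
  constructor
  · intro H v hv
    rcases hv.eq_or_lt with rfl | hlt
    · simpa using H 0 1 (by simp)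
    · have hu : 0 < u := lt_of_le_of_lt zero_le hlt
      have hlim : Tendsto (fun N => t + u * gridPoint N (gridIndex N (v / u))) atTop
          (𝓝[>] (t + v)) := by
        refine tendsto_nhdsWithin_iff.2 ⟨?_, Eventually.of_forall fun N => ?_⟩
        · have := ((tendsto_gridPoint_gridIndex (v / u)).mono_right nhdsWithin_le_nhds).const_mul u
          rw [mul_div_cancel₀ _ hu.ne'] at this
          exact this.const_add t
        · have := lt_gridPoint_gridIndex N (v / u)
          rw [div_lt_iff₀ hu, mul_comm] at this
          exact add_lt_add_right this t
      obtain ⟨N, hN⟩ := (hlim.eventually (h.rightCts_snd (t + v) ω)).exists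
      rw [← hN]
      have hle : gridIndex N (v / u) ≤ 2 ^ N := by
        have h2 : v / u * 2 ^ N < ((2 ^ N : ℕ) : ℝ≥0) := by
          push_cast
          exact mul_lt_of_lt_one_left (by positivity) ((div_lt_one hu).2 hlt)
        exact (Nat.floor_lt (by positivity)).2 h2
      have := H N _ hle
      rwa [show (gridIndex N (v / u) : ℝ≥0) * (u / 2 ^ N) =
        u * gridPoint N (gridIndex N (v / u)) by rw [gridPoint]; ring] at this
  · intro H N l hl
    refine H _ ?_
    rw [← mul_div_assoc, div_le_iff₀ (by positivity), mul_comm]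
    gcongr
    exact_mod_cast hl

/-- The events of staying along finer and finer grids decrease, and by right-continuity their
intersection is staying throughout; each has a product probability by the Markov property. -/
lemma tendsto_prob_grid (i : ℤˣ) (t u : ℝ≥0) {A : Set Ω} (hA : MeasurableSet[𝓖 t] A) :
    Tendsto (fun N : ℕ => (P 0 i).real (A ∩ {ω | J t ω = i}) *
      (P 0 i).real {ω | J (u / 2 ^ N) ω = i} ^ (2 ^ N)) atTop
      (𝓝 ((P 0 i).real (A ∩ {ω | ∀ v ≤ u, J (t + v) ω = i}))) := by
  have := h.isProbabilityMeasure 0 i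
  simp only [← h.prob_forall_grid i t _ hA]
  have hset : A ∩ {ω | ∀ v ≤ u, J (t + v) ω = i} =
      ⋂ N : ℕ, A ∩ {ω | ∀ l : ℕ, l ≤ 2 ^ N → J (t + l * (u / 2 ^ N)) ω = i} := by
    rw [← Set.inter_iInter]
    congr 1
    ext ω
    simp only [Set.mem_ofPred_eq, Set.mem_iInter, h.forall_grid_iff ω i t u]
  rw [hset]
  refine (ENNReal.tendsto_toReal (measure_ne_top _ _)).comp
    (tendsto_measure_iInter_atTop (fun N => ?_) ?_ ⟨0, measure_ne_top _ _⟩)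
  · refine ((𝓖.le t _ hA).inter ?_).nullMeasurableSet
    rw [show {ω | ∀ l : ℕ, l ≤ 2 ^ N → J (t + l * (u / 2 ^ N)) ω = i} =
        ⋂ (l : ℕ) (_ : l ≤ 2 ^ N), {ω | J (t + l * (u / 2 ^ N)) ω = i} by ext; simp]
    exact MeasurableSet.iInter fun l => MeasurableSet.iInter fun hl =>
      h.measurableSet_state_eq _ i
  · refine antitone_nat_of_succ_le fun N ω hω => ⟨hω.1, fun l hl => ?_⟩
    have := hω.2 (2 * l) (by rw [pow_succ]; lia)
    rwa [show ((2 * l : ℕ) : ℝ≥0) * (u / 2 ^ (N + 1)) = l * (u / 2 ^ N) by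
      push_cast; rw [pow_succ]; field_simp] at this

lemma stayProb_eq (i : ℤˣ) (t : ℝ≥0) :
    stayProb ξ J P i t = (P 0 i).real {ω | ∀ v ≤ t, J v ω = i} := by
  refine measureReal_congr ?_
  filter_upwards [h.ae_start i] with ω hω
  refine propext ((h.lt_firstSwitch_path_iff ω t).trans ?_)
  rw [hω.2]
  exact Iff.rfl

lemma tendsto_stayProb (i : ℤˣ) (u : ℝ≥0) :
    Tendsto (fun N : ℕ => (P 0 i).real {ω | J (u / 2 ^ N) ω = i} ^ (2 ^ N)) atTop
      (𝓝 (stayProb ξ J P i u)) := by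
  have := h.isProbabilityMeasure 0 i
  have h1 := h.tendsto_prob_grid i 0 u MeasurableSet.univ
  have h0 : (P 0 i).real {ω | J 0 ω = i} = 1 := by
    rw [measureReal_def, (mem_ae_iff_prob_eq_one (h.measurableSet_state_eq 0 i)).1,
      ENNReal.toReal_one]
    exact (h.ae_start i).mono fun ω hω => hω.2
  simpa [h.stayProb_eq, h0] using h1

/-- The Markov property for `sojourn` would lose the killed paths, whereas J keeps running after
killing. The semigroup property is therefore read off from the grid limits, which use J alone. -/
lemma stayProb_add (i : ℤˣ) (t u : ℝ≥0) :
    stayProb ξ J P i (t + u) = stayProb ξ J P i t * stayProb ξ J P i u := by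
  have hA : MeasurableSet[𝓖 t] {ω | (t : ℝ≥0∞) < firstSwitch (path ξ J ω)} :=
    h.measurableSet_lt_firstSwitch le_rfl
  have h1 := h.tendsto_prob_grid i t u hA
  have h2 := (h.tendsto_stayProb i u).const_mul (stayProb ξ J P i t)
  have e1 : (P 0 i).real ({ω | (t : ℝ≥0∞) < firstSwitch (path ξ J ω)} ∩ {ω | J t ω = i}) =
      stayProb ξ J P i t := by
    refine measureReal_congr ?_
    filter_upwards [h.ae_start i] with ω hω
    refine propext ⟨fun H => H.1, fun H => ⟨H, ?_⟩⟩
    exact ((h.lt_firstSwitch_path_iff ω t).1 H t le_rfl).trans hω.2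
  have e2 : (P 0 i).real ({ω | (t : ℝ≥0∞) < firstSwitch (path ξ J ω)} ∩
      {ω | ∀ v ≤ u, J (t + v) ω = i}) = stayProb ξ J P i (t + u) := by
    refine measureReal_congr ?_
    filter_upwards [h.ae_start i] with ω hω
    refine propext ?_
    change ((t : ℝ≥0∞) < firstSwitch (path ξ J ω) ∧ ∀ v ≤ u, J (t + v) ω = i) ↔
      ((t + u : ℝ≥0) : ℝ≥0∞) < firstSwitch (path ξ J ω)
    rw [h.lt_firstSwitch_path_iff, h.lt_firstSwitch_path_iff]
    constructor
    · rintro ⟨H1, H2⟩ v hv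
      rcases le_total v t with hvt | hvt
      · exact H1 v hvt
      · obtain ⟨w, rfl⟩ := exists_add_of_le hvt
        rw [H2 w (le_of_add_le_add_left hv), hω.2]
    · intro H
      exact ⟨fun v hv => H v (hv.trans le_self_add), fun v hv => by
        rw [H _ (add_le_add_right hv t), hω.2]⟩
  rw [e1, e2] at h1
  exact tendsto_nhds_unique h1 h2

lemma stayProb_antitone (i : ℤˣ) : Antitone (stayProb ξ J P i) := by
  have := h.isProbabilityMeasure 0 i
  intro t u htu
  refine measureReal_mono fun ω (hω : (u : ℝ≥0∞) < _) => ?_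
  exact lt_of_le_of_lt (by exact_mod_cast htu) hω

omit h in
lemma stayProb_nonneg (i : ℤˣ) (t : ℝ≥0) : 0 ≤ stayProb ξ J P i t := measureReal_nonneg

lemma stayProb_nsmul (i : ℤˣ) (t : ℝ≥0) (n : ℕ) :
    stayProb ξ J P i ((n + 1 : ℕ) * t) = stayProb ξ J P i t ^ (n + 1) := by
  induction n with
  | zero => simp
  | succ n ih => rw [Nat.cast_succ, add_mul, one_mul, h.stayProb_add, ih, pow_succ _ (n + 1)]

/-- The first switch is positive on every path, so staying for a short dyadic time has probability
close to one; the value at `1` is a power of this. -/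
lemma stayProb_one_pos (i : ℤˣ) : 0 < stayProb ξ J P i 1 := by
  have := h.isProbabilityMeasure 0 i
  have hlim : Tendsto (fun n => (P 0 i).real
      {ω | (gridPoint n 1 : ℝ≥0∞) < firstSwitch (path ξ J ω)}) atTop (𝓝 1) := by
    have hU : (⋃ n, {ω | (gridPoint n 1 : ℝ≥0∞) < firstSwitch (path ξ J ω)}) = Set.univ := by
      ext ω
      simp only [Set.mem_iUnion, Set.mem_ofPred_eq, Set.mem_univ, iff_true]
      have := (ENNReal.tendsto_coe.2 tendsto_gridPoint_one).eventually
        (gt_mem_nhds (by simpa using firstSwitch_pos (h.rightCts_path ω)))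
      exact this.exists
    have hm : Monotone fun n => {ω | (gridPoint n 1 : ℝ≥0∞) < firstSwitch (path ξ J ω)} := by
      intro m n hmn ω hω
      refine lt_of_le_of_lt (b := ((gridPoint m 1 : ℝ≥0) : ℝ≥0∞)) ?_ hω
      rw [ENNReal.coe_le_coe]
      unfold gridPoint
      gcongr
      norm_num
    have := (ENNReal.tendsto_toReal (measure_ne_top (P 0 i) _)).comp
      (tendsto_measure_iUnion_atTop (μ := P 0 i) hm)
    rwa [hU, measure_univ, ENNReal.toReal_one] at this
  obtain ⟨n, hn⟩ := (hlim.eventually (lt_mem_nhds one_pos)).exists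
  have e := h.stayProb_nsmul i (gridPoint n 1) (2 ^ n - 1)
  rw [Nat.sub_add_cancel Nat.one_le_two_pow] at e
  have e1 : ((2 ^ n : ℕ) : ℝ≥0) * gridPoint n 1 = 1 := by
    simp [gridPoint]
  rw [e1] at e
  rw [e]
  exact pow_pos hn _

end

/-- The rate at which `J` leaves the state `i`. -/
def exitRate (ξ : ℝ≥0 → Ω → EReal) (J : ℝ≥0 → Ω → ℤˣ) (P : ℝ → ℤˣ → Measure Ω) (i : ℤˣ) : ℝ :=
  -Real.log (stayProb ξ J P i 1)

section
variable (h : IsMAP 𝓖 ξ J P)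
include h

lemma exitRate_nonneg (i : ℤˣ) : 0 ≤ exitRate ξ J P i := by
  have := h.isProbabilityMeasure 0 i
  exact neg_nonneg.2 (Real.log_nonpos (stayProb_nonneg i 1) measureReal_le_one)

lemma stayProb_gridPoint (i : ℤˣ) (n k : ℕ) :
    stayProb ξ J P i (gridPoint n k) =
      Real.exp (-exitRate ξ J P i * (gridPoint n k : ℝ≥0)) := by
  rcases k with _ | k
  · have h0 : 0 < stayProb ξ J P i 0 :=
      (h.stayProb_one_pos i).trans_le (h.stayProb_antitone i zero_le_one)
    have h1 := h.stayProb_add i 0 0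
    rw [add_zero] at h1
    simpa [gridPoint] using (mul_eq_left₀ h0.ne').1 h1.symm
  have e := h.stayProb_nsmul i (gridPoint n 1) (2 ^ n - 1)
  rw [Nat.sub_add_cancel Nat.one_le_two_pow,
    show ((2 ^ n : ℕ) : ℝ≥0) * gridPoint n 1 = 1 by simp [gridPoint]] at e
  have hpos : 0 < stayProb ξ J P i (gridPoint n 1) := by
    have := h.stayProb_one_pos i
    rw [e] at this
    refine (stayProb_nonneg i _).lt_of_ne fun h0 => ?_
    rw [← h0, zero_pow (by positivity)] at this
    exact lt_irrefl _ this
  have e2 := h.stayProb_nsmul i (gridPoint n 1) k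
  rw [show ((k + 1 : ℕ) : ℝ≥0) * gridPoint n 1 = gridPoint n (k + 1) by
    simp [gridPoint, div_eq_mul_inv]] at e2
  rw [e2, exitRate, e, Real.log_pow, neg_neg, ← Real.exp_log (pow_pos hpos _), Real.log_pow]
  congr 1
  simp only [gridPoint, NNReal.coe_div, NNReal.coe_natCast, NNReal.coe_pow, NNReal.coe_ofNat]
  push_cast
  field_simp

/-- The multiplicative equation fixes the values at dyadic times, and monotonicity squeezes the
others between neighbouring grid points. -/
lemma stayProb_eq_exp (i : ℤˣ) (t : ℝ≥0) :
    stayProb ξ J P i t = Real.exp (-exitRate ξ J P i * t) := by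
  have hup : Tendsto (fun n => Real.exp (-exitRate ξ J P i * (gridPoint n (gridIndex n t) : ℝ≥0)))
      atTop (𝓝 (Real.exp (-exitRate ξ J P i * t))) :=
    (Real.continuous_exp.tendsto _).comp ((NNReal.tendsto_coe.2
      ((tendsto_gridPoint_gridIndex t).mono_right nhdsWithin_le_nhds)).const_mul _)
  have hlow : Tendsto (fun n => Real.exp
      (-exitRate ξ J P i * (gridPoint n (gridIndex n t - 1) : ℝ≥0)))
      atTop (𝓝 (Real.exp (-exitRate ξ J P i * t))) := by
    refine (Real.continuous_exp.tendsto _).comp (Tendsto.const_mul _ ?_)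
    have := (NNReal.tendsto_coe.2 ((tendsto_gridPoint_gridIndex t).mono_right
      nhdsWithin_le_nhds)).sub (NNReal.tendsto_coe.2 tendsto_gridPoint_one)
    simp only [NNReal.coe_zero, sub_zero] at this
    refine this.congr fun n => ?_
    conv_lhs => rw [show gridIndex n t = gridIndex n t - 1 + 1 by simp [gridIndex]]
    rw [gridPoint_succ]
    simp
  refine le_antisymm (ge_of_tendsto hlow (Eventually.of_forall fun n => ?_))
    (le_of_tendsto hup (Eventually.of_forall fun n => ?_))
  · exact (h.stayProb_antitone i (gridPoint_pred_gridIndex_le n t)).trans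
      (h.stayProb_gridPoint i n _).le
  · exact (h.stayProb_gridPoint i n _).symm.le.trans
      (h.stayProb_antitone i (lt_gridPoint_gridIndex n t).le)

/-- Lower bound for the probability of having switched along a grid. -/
lemma prob_state_neg_grid_ge (i : ℤˣ) (u : ℝ≥0) (m : ℕ) :
    (P 0 i).real {ω | J u ω = i} ^ m ≤ (P 0 i).real {ω | J (m * u) ω = i} ∧
    (1 - (P 0 i).real {ω | J u ω = i} ^ m) * (P 0 (-i)).real {ω | J u ω = -i} ^ m ≤
      (P 0 i).real {ω | J (m * u) ω = -i} := by
  have hp : ∀ j k t, 0 ≤ (P 0 j).real {ω | J t ω = k} := fun j k t => measureReal_nonneg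
  have hp1 : ∀ j k t, (P 0 j).real {ω | J t ω = k} ≤ 1 := fun j k t => by
    have := h.isProbabilityMeasure 0 j
    exact measureReal_le_one
  have stay : ∀ j (m : ℕ), (P 0 j).real {ω | J u ω = j} ^ m ≤
      (P 0 j).real {ω | J (m * u) ω = j} := by
    intro j m
    induction m with
    | zero =>
      have := h.isProbabilityMeasure 0 j
      have h0 : (P 0 j).real {ω | J 0 ω = j} = 1 := by
        rw [measureReal_def, (mem_ae_iff_prob_eq_one (h.measurableSet_state_eq 0 j)).1,
          ENNReal.toReal_one]
        exact (h.ae_start j).mono fun ω hω => hω.2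
      simp [h0]
    | succ m ih =>
      rw [Nat.cast_succ, add_mul, one_mul, add_comm _ u, h.prob_state_add j j, pow_succ']
      have := mul_le_mul_of_nonneg_left ih (hp j j u)
      have := mul_nonneg (hp j (-j) u) (hp (-j) j (m * u))
      linarith
  refine ⟨stay i m, ?_⟩
  induction m with
  | zero => simp [measureReal_nonneg]
  | succ m ih =>
    rw [Nat.cast_succ, add_mul, one_mul, add_comm _ u, h.prob_state_add i (-i)]
    have h1 := h.prob_state_self_add_neg i u i
    have h2 := stay (-i) m
    set q := (P 0 i).real {ω | J u ω = i}
    set r := (P 0 (-i)).real {ω | J u ω = -i}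
    have hq : 0 ≤ q := hp _ _ _
    have hq1 : q ≤ 1 := hp1 _ _ _
    have hr : 0 ≤ r := hp _ _ _
    have hr1 : r ≤ 1 := hp1 _ _ _
    have e1 : (P 0 i).real {ω | J u ω = -i} = 1 - q := by linarith
    rw [e1]
    -- Conditioning on the first step: with probability `q` the chain stays and the induction
    -- hypothesis applies; otherwise it has moved to `-i` and it suffices that it stays there.
    have a1 := mul_le_mul_of_nonneg_left ih hq
    have a2 := mul_le_mul_of_nonneg_left h2 (sub_nonneg.2 hq1)
    have a3 : (1 - q ^ (m + 1)) * r ^ (m + 1) ≤ (1 - q ^ (m + 1)) * r ^ m :=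
      mul_le_mul_of_nonneg_left (pow_le_pow_of_le_one hr hr1 (Nat.le_succ m))
        (sub_nonneg.2 (pow_le_one₀ hq hq1))
    have a4 : (1 - q ^ (m + 1)) * r ^ m = q * ((1 - q ^ m) * r ^ m) + (1 - q) * r ^ m := by ring
    linarith

/-- To be in `-i` at time `t` the chain must have left `i`; conversely it suffices that it leaves by
`t` and then stays in `-i`, which over a remaining time of at most `t` is at least as likely as over
`t`. -/
lemma prob_state_neg_bounds (i : ℤˣ) (t : ℝ≥0) :
    (1 - stayProb ξ J P i t) * stayProb ξ J P (-i) t ≤ (P 0 i).real {ω | J t ω = -i} ∧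
      (P 0 i).real {ω | J t ω = -i} ≤ 1 - stayProb ξ J P i t := by
  have hN : ∀ N : ℕ, ((2 ^ N : ℕ) : ℝ≥0) * (t / 2 ^ N) = t := fun N => by
    push_cast; field_simp
  constructor
  · refine le_of_tendsto (((h.tendsto_stayProb i t).const_sub 1).mul
      (h.tendsto_stayProb (-i) t)) (Eventually.of_forall fun N => ?_)
    have := (h.prob_state_neg_grid_ge i (t / 2 ^ N) (2 ^ N)).2
    rwa [hN] at this
  · have h1 := h.prob_state_self_add_neg i t i
    have h2 : stayProb ξ J P i t ≤ (P 0 i).real {ω | J t ω = i} := by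
      refine le_of_tendsto (h.tendsto_stayProb i t) (Eventually.of_forall fun N => ?_)
      have := (h.prob_state_neg_grid_ge i (t / 2 ^ N) (2 ^ N)).1
      rwa [hN] at this
    linarith

/-- Both bounds of `prob_state_neg_bounds` vanish at `0` with the same derivative there, so
differentiability of the transition probability follows by squeezing. -/
lemma hasDerivWithinAt_prob_neg (i : ℤˣ) :
    HasDerivWithinAt (fun t : ℝ => (P 0 i).real {ω | J t.toNNReal ω = -i})
      (exitRate ξ J P i) (Set.Ici 0) 0 := by
  set c := exitRate ξ J P i
  set c' := exitRate ξ J P (-i)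
  set a : ℝ → ℝ := fun t => (P 0 i).real {ω | J t.toNNReal ω = -i}
  have hb : ∀ t : ℝ, 0 ≤ t → (1 - Real.exp (-c * t)) * Real.exp (-c' * t) ≤ a t ∧
      a t ≤ 1 - Real.exp (-c * t) := by
    intro t ht
    have := h.prob_state_neg_bounds i t.toNNReal
    rwa [h.stayProb_eq_exp, h.stayProb_eq_exp, Real.coe_toNNReal t ht] at this
  have ha0 : a 0 = 0 := by
    have := hb 0 le_rfl
    simp only [mul_zero, Real.exp_zero, sub_self, zero_mul] at this
    exact le_antisymm this.2 this.1
  have d1 : HasDerivAt (fun t : ℝ => 1 - Real.exp (-c * t)) c 0 := by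
    have := (((hasDerivAt_id (0 : ℝ)).const_mul (-c)).exp).const_sub 1
    simpa using this
  have d2 : HasDerivAt (fun t : ℝ => (1 - Real.exp (-c * t)) * Real.exp (-c' * t)) c 0 := by
    have := d1.mul ((hasDerivAt_id (0 : ℝ)).const_mul (-c')).exp
    simp only [id, mul_zero, Real.exp_zero, sub_self, zero_mul, mul_one, add_zero] at this
    exact this
  rw [hasDerivWithinAt_iff_tendsto_slope]
  have s1 := (hasDerivWithinAt_iff_tendsto_slope.1 (d1.hasDerivWithinAt (s := Set.Ici 0)))
  have s2 := (hasDerivWithinAt_iff_tendsto_slope.1 (d2.hasDerivWithinAt (s := Set.Ici 0)))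
  refine tendsto_of_tendsto_of_tendsto_of_le_of_le' s2 s1 ?_ ?_
  · filter_upwards [self_mem_nhdsWithin] with t ht
    have ht0 : 0 < t := lt_of_le_of_ne ht.1 (Ne.symm ht.2)
    simp only [slope_def_field, ha0, sub_zero, mul_zero, Real.exp_zero, sub_self, zero_mul]
    exact div_le_div_of_nonneg_right (hb t ht0.le).1 ht0.le
  · filter_upwards [self_mem_nhdsWithin] with t ht
    have ht0 : 0 < t := lt_of_le_of_ne ht.1 (Ne.symm ht.2)
    simp only [slope_def_field, ha0, sub_zero, mul_zero, Real.exp_zero, sub_self]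
    exact div_le_div_of_nonneg_right (hb t ht0.le).2 ht0.le

lemma rateMatrix_neg (i : ℤˣ) : MAP.rateMatrix J P i (-i) = exitRate ξ J P i :=
  (h.hasDerivWithinAt_prob_neg i).derivWithin (uniqueDiffOn_Ici 0 0 Set.self_mem_Ici)

lemma rateMatrix_self (i : ℤˣ) : MAP.rateMatrix J P i i = -exitRate ξ J P i := by
  have := (h.hasDerivWithinAt_prob_neg i).const_sub 1
  refine (this.congr_of_mem (fun t _ => ?_) Set.self_mem_Ici).derivWithin
    (uniqueDiffOn_Ici 0 0 Set.self_mem_Ici)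
  have := h.prob_state_self_add_neg i t.toNNReal i
  linarith

end

end IsMAP

/-! ### A maximal inequality and integrability over one sojourn -/

namespace MAPPath

/-- A bound for all the weights `sojourn z x u`, as a sum over unit intervals. -/
def sojournBound (z : ℝ) (x : MAPPath) : ℝ≥0∞ :=
  ∑' n : ℕ, sojourn z x n * unitSup z (shift n x)

/-- The bound is independent of `u`, which makes it the majorant for dominated convergence along
grids; it also controls the power of the sojourn integral. -/
lemma sojourn_le_sojournBound {x : MAPPath} (hx : RightCts x) (z : ℝ) (u : ℝ≥0) :
    sojourn z x u ≤ sojournBound z x := by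
  obtain ⟨v, hv⟩ := exists_add_of_le (Nat.floor_le (zero_le : 0 ≤ u))
  have hv1 : v ≤ 1 := by
    have := (Nat.lt_floor_add_one u).le
    rw [hv] at this
    simpa using le_of_add_le_add_left (this.trans (by simp [← hv]))
  refine le_trans ?_ (ENNReal.le_tsum ⌊u⌋₊)
  conv_lhs => rw [hv, sojourn_add hx]
  gcongr
  exact sojourn_le_unitSup (hx.shift _) z hv1

lemma rpow_sojournIntegral_le {x : MAPPath} (hx : RightCts x) (α : ℝ) {s : ℝ} (hs : 0 < s)
    (hs1 : s ≤ 1) : sojournIntegral α x ^ s ≤ sojournBound (α * s) x := by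
  refine (ENNReal.rpow_le_rpow (sojournIntegral_le_tsum α) hs.le).trans
    ((ENNReal.rpow_tsum_le hs hs1 _).trans ?_)
  exact ENNReal.tsum_le_tsum fun n => rpow_lintegral_unit_le hx α hs n

end MAPPath

namespace IsMAP

open MAPPath

variable {Ω : Type*} [mΩ : MeasurableSpace Ω] {𝓖 : Filtration ℝ≥0 mΩ}
  {ξ : ℝ≥0 → Ω → EReal} {J : ℝ≥0 → Ω → ℤˣ} {P : ℝ → ℤˣ → Measure Ω}

section
variable (h : IsMAP 𝓖 ξ J P)
include h

lemma measurable_sojourn_path (z : ℝ) (u : ℝ≥0) :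
    Measurable fun ω => sojourn z (path ξ J ω) u :=
  (measurable_sojourn z u).comp h.measurable_path

lemma measurable_sojourn_shift (z : ℝ) (t u : ℝ≥0) :
    Measurable fun ω => sojourn z (shift t (path ξ J ω)) u :=
  (measurable_sojourn z u).comp (h.measurable_shift_path t)

/-- With exponent `0` the weight is the indicator of being alive and unswitched. Thus `hA'` puts `A`
inside the event on which the process restarts from the state `i`. -/
lemma prob_inter_sojourn_shift (z : ℝ) (i : ℤˣ) (t u : ℝ≥0) {A : Set Ω}
    (hA : MeasurableSet[𝓖 t] A) (hA' : ∀ ω ∈ A, sojourn 0 (path ξ J ω) t = 1) (c : ℝ≥0∞) :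
    P 0 i (A ∩ {ω | c ≤ sojourn z (shift t (path ξ J ω)) u}) =
      P 0 i A * P 0 i {ω | c ≤ sojourn z (path ξ J ω) u} := by
  have hB : MeasurableSet {x : MAPPath | c ≤ sojourn z x u} :=
    measurableSet_le measurable_const (measurable_sojourn z u)
  have hAm := 𝓖.le t _ hA
  have hf : Measurable[𝓖 t] (A.indicator (1 : Ω → ℝ≥0∞)) :=
    (measurable_const (a := (1 : ℝ≥0∞))).indicator hA
  have key := h.lintegral_sojourn_markov 0 i t hf
    (Φ := Set.indicator {x : MAPPath | c ≤ sojourn z x u} 1)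
    ((measurable_const (a := (1 : ℝ≥0∞))).indicator hB).hasMeasurableVersion
  have e1 : ∀ ω, A.indicator (1 : Ω → ℝ≥0∞) ω * sojourn 0 (path ξ J ω) t = A.indicator 1 ω := by
    intro ω
    by_cases hω : ω ∈ A <;> simp [hω, hA']
  have e2 : ∀ ω, Set.indicator {x : MAPPath | c ≤ sojourn z x u} (1 : MAPPath → ℝ≥0∞)
      (path ξ J ω) = Set.indicator {ω | c ≤ sojourn z (path ξ J ω) u} 1 ω := fun ω => rfl
  have e3 : ∀ ω, A.indicator (1 : Ω → ℝ≥0∞) ω * Set.indicator {x : MAPPath | c ≤ sojourn z x u} 1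
      (shift t (path ξ J ω)) =
      (A ∩ {ω | c ≤ sojourn z (shift t (path ξ J ω)) u}).indicator 1 ω := by
    intro ω
    rw [Set.inter_indicator_one]
    rfl
  simp only [e1, e2, e3] at key
  rwa [lintegral_indicator_one (hAm.inter (measurableSet_le measurable_const
      (h.measurable_sojourn_shift z t u))), lintegral_indicator_one hAm,
    lintegral_indicator_one (measurableSet_le measurable_const
      (h.measurable_sojourn_path z u))] at key

omit h mΩ in
lemma sojourn_zero_eq_one {z : ℝ} {ω : Ω} {t : ℝ≥0} (hω : sojourn z (path ξ J ω) t ≠ 0) :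
    sojourn 0 (path ξ J ω) t = 1 := by
  unfold sojourn at hω ⊢
  split_ifs at hω ⊢ with h1
  · have : ξ t ω ≠ ⊥ := by
      intro hb
      simp [hb] at hω
    simp [killedExp, this]
  · exact absurd rfl hω

/-- The weight equals one almost surely at time `0` and is right-continuous, so the probability in
question tends to one. -/
lemma exists_small_time (z : ℝ) (i : ℤˣ) : ∃ r : ℝ≥0, 0 < r ∧ ∀ u ≤ r,
    2⁻¹ ≤ P 0 i {ω | 2⁻¹ ≤ sojourn z (path ξ J ω) u} := by
  have := h.isProbabilityMeasure 0 i
  have hm : ∀ u, MeasurableSet {ω | 2⁻¹ ≤ sojourn z (path ξ J ω) u} := fun u =>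
    measurableSet_le measurable_const (h.measurable_sojourn_path z u)
  have h0 : ∀ᵐ ω ∂(P 0 i), sojourn z (path ξ J ω) 0 = 1 := by
    filter_upwards [h.ae_start i] with ω hω
    simp [sojourn, hω.1, firstSwitch_pos (h.rightCts_path ω)]
  have hlim : Tendsto (fun u => ∫⁻ ω, ({ω | 2⁻¹ ≤ sojourn z (path ξ J ω) u}.indicator 1 ω : ℝ≥0∞)
      ∂(P 0 i)) (𝓝[>] 0) (𝓝 (∫⁻ ω, 1 ∂(P 0 i))) := by
    refine tendsto_lintegral_filter_of_dominated_convergence (fun _ => 1)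
      (Eventually.of_forall fun u => measurable_one.indicator (hm u))
      (Eventually.of_forall fun u => Eventually.of_forall fun ω =>
        Set.indicator_le (fun _ _ => le_rfl) ω) (by simp) ?_
    filter_upwards [h0] with ω hω
    refine tendsto_const_nhds.congr' ?_
    have ht := tendsto_sojourn (h.rightCts_path ω) z 0
    rw [hω] at ht
    filter_upwards [ht.eventually (lt_mem_nhds (a := 2⁻¹) (by simp))] with u hu
    rw [Set.indicator_of_mem (show ω ∈ {ω | 2⁻¹ ≤ sojourn z (path ξ J ω) u} from hu.le)]
    rfl
  simp only [lintegral_indicator_one (hm _), lintegral_one, measure_univ] at hlim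
  have hev := hlim.eventually (lt_mem_nhds (a := 2⁻¹) (by simp))
  obtain ⟨b, hb, hb'⟩ := mem_nhdsGT_iff_exists_Ioc_subset.1 hev
  refine ⟨b, hb, fun u hu => ?_⟩
  rcases eq_or_ne u 0 with rfl | hu0
  · have : P 0 i {ω | 2⁻¹ ≤ sojourn z (path ξ J ω) 0} = 1 := by
      rw [← mem_ae_iff_prob_eq_one (hm 0)]
      filter_upwards [h0] with ω hω
      simp [hω]
    rw [this]; simp
  · exact (hb' ⟨pos_iff_ne_zero.2 hu0, hu⟩).le

/-- The time range doubles by splitting `u` into independent halves, at the price of squaring both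
constants. Uniformity in `u` is what the maximal inequality requires. -/
lemma exists_lower_bound (z : ℝ) (i : ℤˣ) : ∃ θ δ : ℝ≥0, θ ≠ 0 ∧ δ ≠ 0 ∧ ∀ u ≤ (1 : ℝ≥0),
    (δ : ℝ≥0∞) ≤ P 0 i {ω | (θ : ℝ≥0∞) ≤ sojourn z (path ξ J ω) u} := by
  obtain ⟨r, hr, hr'⟩ := h.exists_small_time z i
  have step : ∀ n : ℕ, ∃ θ δ : ℝ≥0, θ ≠ 0 ∧ δ ≠ 0 ∧ ∀ u ≤ 2 ^ n * r,
      (δ : ℝ≥0∞) ≤ P 0 i {ω | (θ : ℝ≥0∞) ≤ sojourn z (path ξ J ω) u} := by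
    intro n
    induction n with
    | zero =>
      refine ⟨2⁻¹, 2⁻¹, by simp, by simp, fun u hu => ?_⟩
      simpa using hr' u (by simpa using hu)
    | succ n ih =>
      obtain ⟨θ, δ, hθ, hδ, H⟩ := ih
      refine ⟨θ * θ, δ * δ, mul_ne_zero hθ hθ, mul_ne_zero hδ hδ, fun u hu => ?_⟩
      have hv : u / 2 ≤ 2 ^ n * r := by
        rw [div_le_iff₀ (by norm_num)]
        refine hu.trans (le_of_eq ?_)
        ring
      set A : Set Ω := {ω | (θ : ℝ≥0∞) ≤ sojourn z (path ξ J ω) (u / 2)}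
      have hA : MeasurableSet[𝓖 (u / 2)] A :=
        measurableSet_le measurable_const (h.measurable_sojourn_adapted z le_rfl)
      have key := h.prob_inter_sojourn_shift z i (u / 2) (u / 2) hA
        (fun ω hω => sojourn_zero_eq_one (z := z) (fun h0 => by
          have : (θ : ℝ≥0∞) ≤ sojourn z (path ξ J ω) (u / 2) := hω
          rw [h0] at this
          exact hθ (by simpa using this))) θ
      rw [ENNReal.coe_mul]
      refine (mul_le_mul' (H _ hv) (H _ hv)).trans (key.symm.le.trans (measure_mono ?_))
      rintro ω ⟨h1, h2⟩
      have := sojourn_add (h.rightCts_path ω) z (u / 2) (u / 2)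
      rw [add_halves] at this
      simp only [Set.mem_ofPred_eq, this, ENNReal.coe_mul]
      exact mul_le_mul' h1 h2
  obtain ⟨n, hn⟩ := pow_unbounded_of_one_lt (r⁻¹) (one_lt_two : (1 : ℝ≥0) < 2)
  obtain ⟨θ, δ, hθ, hδ, H⟩ := step n
  refine ⟨θ, δ, hθ, hδ, fun u hu => H u (hu.trans ?_)⟩
  rw [← inv_mul_cancel₀ hr.ne']
  gcongr

lemma sojournMoment_one_pos (z : ℝ) (i : ℤˣ) : 0 < sojournMoment ξ J P i z 1 := by
  obtain ⟨θ, δ, hθ, hδ, H⟩ := h.exists_lower_bound z i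
  have := mul_meas_ge_le_lintegral (μ := P 0 i) (h.measurable_sojourn_path z 1) θ
  refine lt_of_lt_of_le ?_ this
  have h1 : (0 : ℝ≥0∞) < θ * δ := by
    rw [← ENNReal.coe_mul, ENNReal.coe_pos]
    exact pos_iff_ne_zero.2 (mul_ne_zero hθ hδ)
  exact h1.trans_le (mul_le_mul_right (H 1 le_rfl) _)

/-- An Ottaviani-type maximal inequality on a grid of the unit interval. -/
lemma ottaviani {z : ℝ} {i : ℤˣ} {θ δ : ℝ≥0} (hδ : ∀ u ≤ (1 : ℝ≥0),
    (δ : ℝ≥0∞) ≤ P 0 i {ω | (θ : ℝ≥0∞) ≤ sojourn z (path ξ J ω) u}) (n : ℕ) (l : ℝ≥0∞) :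
    P 0 i {ω | l < ⨆ k : Fin (2 ^ n + 1), sojourn z (path ξ J ω) (gridPoint n k)} * δ ≤
      P 0 i {ω | l * θ ≤ sojourn z (path ξ J ω) 1} := by
  set Y : ℕ → Ω → ℝ≥0∞ := fun k ω => sojourn z (path ξ J ω) (gridPoint n k)
  -- Decomposition according to the first grid index at which the level `l` is exceeded.
  set A : Fin (2 ^ n + 1) → Set Ω := fun k => {ω | l < Y k ω ∧ ∀ m < (k : ℕ), Y m ω ≤ l}
  have hmono : Monotone (gridPoint n) := fun a b hab => by unfold gridPoint; gcongr
  have hY : ∀ m k : ℕ, m ≤ k → Measurable[𝓖 (gridPoint n k)] (Y m) := fun m k hmk =>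
    h.measurable_sojourn_adapted z (hmono hmk)
  have hA : ∀ k : Fin (2 ^ n + 1), MeasurableSet[𝓖 (gridPoint n k)] (A k) := by
    intro k
    have e : A k = {ω | l < Y k ω} ∩ ⋂ (m : ℕ) (_ : m < (k : ℕ)), {ω | Y m ω ≤ l} := by
      ext ω; simp [A]
    rw [e]
    refine (measurableSet_lt measurable_const (hY k k le_rfl)).inter
      (MeasurableSet.iInter fun m => MeasurableSet.iInter fun hm => ?_)
    exact measurableSet_le (hY m k hm.le) measurable_const
  have hAm : ∀ k, MeasurableSet (A k) := fun k => 𝓖.le _ _ (hA k)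
  have hdisj : ∀ k l' : Fin (2 ^ n + 1), (k : ℕ) < l' → Disjoint (A k) (A l') := by
    intro k l' hkl
    rw [Set.disjoint_left]
    rintro ω ⟨h1, -⟩ ⟨-, h2⟩
    exact absurd (h2 k hkl) (not_le.2 h1)
  have hdisj' : Pairwise (Function.onFun Disjoint A) := by
    intro k l' hkl
    rcases lt_or_gt_of_ne (fun e => hkl (Fin.ext e) : (k : ℕ) ≠ l') with hlt | hlt
    · exact hdisj k l' hlt
    · exact (hdisj l' k hlt).symm
  have hU : {ω | l < ⨆ k : Fin (2 ^ n + 1), sojourn z (path ξ J ω) (gridPoint n k)} = ⋃ k, A k := by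
    ext ω
    simp only [Set.mem_ofPred_eq, lt_iSup_iff, Set.mem_iUnion]
    constructor
    · rintro ⟨k, hk⟩
      classical
      have hex : ∃ m, l < Y m ω := ⟨k, hk⟩
      have hle : Nat.find hex ≤ k := Nat.find_min' hex hk
      exact ⟨⟨Nat.find hex, lt_of_le_of_lt hle k.2⟩, Nat.find_spec hex,
        fun m hm => not_lt.1 (Nat.find_min hex hm)⟩
    · rintro ⟨k, hk⟩
      exact ⟨k, hk.1⟩
  set B : Set Ω := {ω | l * θ ≤ sojourn z (path ξ J ω) 1}
  have hB : MeasurableSet B := measurableSet_le measurable_const (h.measurable_sojourn_path z 1)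
  -- After the first exceedance, the weight over the remaining time is independent of the past and
  -- at least `θ` with probability at least `δ`.
  have hk : ∀ k, P 0 i (A k) * δ ≤ P 0 i (A k ∩ B) := by
    intro k
    have hk1 : gridPoint n k ≤ 1 := by
      rw [gridPoint, div_le_one (by positivity)]
      exact_mod_cast Nat.lt_succ_iff.1 k.2
    obtain ⟨u, hu⟩ := exists_add_of_le hk1
    have hu1 : u ≤ 1 := by rw [hu]; exact le_add_self
    have key := h.prob_inter_sojourn_shift z i (gridPoint n k) u (hA k)
      (fun ω hω => sojourn_zero_eq_one (z := z) (fun h0 => by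
        have h1 : l < Y k ω := hω.1
        simp only [Y, h0] at h1
        exact not_lt_zero h1)) θ
    refine (mul_le_mul_right (hδ u hu1) _).trans (key.symm.le.trans (measure_mono ?_))
    rintro ω ⟨h1, h2⟩
    refine ⟨h1, ?_⟩
    simp only [B, Set.mem_ofPred_eq]
    rw [hu, sojourn_add (h.rightCts_path ω)]
    exact mul_le_mul' (show l < Y k ω from h1.1).le h2
  rw [hU, measure_iUnion hdisj' hAm, tsum_fintype, Finset.sum_mul]
  calc ∑ k, P 0 i (A k) * δ ≤ ∑ k, P 0 i (A k ∩ B) := Finset.sum_le_sum fun k _ => hk k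
    _ = P 0 i (⋃ k, A k ∩ B) := by
      rw [measure_iUnion (fun k l' hkl => (hdisj' hkl).mono Set.inter_subset_left
        Set.inter_subset_left) (fun k => (hAm k).inter hB), tsum_fintype]
    _ ≤ P 0 i B := measure_mono (Set.iUnion_subset fun k => Set.inter_subset_right)

/-- Integrating `ottaviani` over the level bounds the mean grid maximum by the moment at time `1`
divided by `θ` and `δ`, uniformly in the mesh; monotone convergence does the rest. -/
lemma lintegral_unitSup_lt_top {z : ℝ} {i : ℤˣ} (he : sojournMoment ξ J P i z 1 < ∞) :
    ∫⁻ ω, unitSup z (path ξ J ω) ∂(P 0 i) < ∞ := by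
  obtain ⟨θ, δ, hθ, hδ, H⟩ := h.exists_lower_bound z i
  set M : ℕ → Ω → ℝ≥0∞ := fun n ω =>
    ⨆ k : Fin (2 ^ n + 1), sojourn z (path ξ J ω) (gridPoint n k)
  have hM : ∀ n, Measurable (M n) := fun n =>
    Measurable.iSup fun k => h.measurable_sojourn_path z _
  have hMtop : ∀ n ω, M n ω ≠ ∞ := fun n ω => by
    obtain ⟨k, hk⟩ := exists_eq_ciSup_of_finite
      (f := fun k : Fin (2 ^ n + 1) => sojourn z (path ξ J ω) (gridPoint n k))
    simp only [M, ← hk]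
    exact sojourn_ne_top z _ _
  have hbound : ∀ n, ∫⁻ ω, M n ω ∂(P 0 i) ≤ sojournMoment ξ J P i z 1 / θ / δ := by
    intro n
    -- The layer-cake formula is needed with strict and with weak inequality, matching the two sides
    -- of `ottaviani`.
    have hcake : ∀ (f : Ω → ℝ≥0∞), Measurable f → (∀ ω, f ω ≠ ∞) →
        ∫⁻ ω, f ω ∂(P 0 i) = ∫⁻ t in Set.Ioi (0 : ℝ), P 0 i {ω | t < (f ω).toReal} := by
      intro f hf hf'
      rw [← lintegral_eq_lintegral_meas_lt (P 0 i)
        (Eventually.of_forall fun ω => ENNReal.toReal_nonneg) hf.ennreal_toReal.aemeasurable]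
      exact lintegral_congr fun ω => (ENNReal.ofReal_toReal (hf' ω)).symm
    have hcake' : ∀ (f : Ω → ℝ≥0∞), Measurable f → (∀ ω, f ω ≠ ∞) →
        ∫⁻ ω, f ω ∂(P 0 i) = ∫⁻ t in Set.Ioi (0 : ℝ), P 0 i {ω | t ≤ (f ω).toReal} := by
      intro f hf hf'
      rw [← lintegral_eq_lintegral_meas_le (P 0 i)
        (Eventually.of_forall fun ω => ENNReal.toReal_nonneg) hf.ennreal_toReal.aemeasurable]
      exact lintegral_congr fun ω => (ENNReal.ofReal_toReal (hf' ω)).symm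
    have hθ' : (θ : ℝ≥0∞) ≠ 0 := by simpa using hθ
    have hδ' : (δ : ℝ≥0∞) ≠ 0 := by simpa using hδ
    have hY1 : ∀ ω, sojourn z (path ξ J ω) 1 / θ ≠ ∞ := fun ω =>
      ENNReal.div_ne_top (sojourn_ne_top z _ _) hθ'
    rw [ENNReal.le_div_iff_mul_le (Or.inl hδ') (Or.inl ENNReal.coe_ne_top), sojournMoment,
      ENNReal.div_eq_inv_mul, ← lintegral_const_mul _ (h.measurable_sojourn_path z 1),
      hcake _ (hM n) (hMtop n)]
    simp only [← ENNReal.div_eq_inv_mul]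
    rw [hcake' _ ((h.measurable_sojourn_path z 1).div_const _) hY1,
      ← lintegral_mul_const' _ _ ENNReal.coe_ne_top]
    refine setLIntegral_mono' measurableSet_Ioi fun t ht => ?_
    have := h.ottaviani H n (ENNReal.ofReal t)
    refine le_trans (mul_le_mul_left (measure_mono ?_) _) (this.trans (measure_mono ?_))
    · intro ω hω
      exact (ENNReal.ofReal_lt_iff_lt_toReal ht.le (hMtop n ω)).2 hω
    · intro ω hω
      simp only [Set.mem_ofPred_eq] at hω ⊢
      rw [← ENNReal.ofReal_le_iff_le_toReal (hY1 ω),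
        ENNReal.le_div_iff_mul_le (Or.inl hθ') (Or.inl ENNReal.coe_ne_top)]
      exact hω
  have hmono : Monotone M := by
    refine monotone_nat_of_le_succ fun n ω => iSup_le fun k => ?_
    have : gridPoint n k = gridPoint (n + 1) (2 * k) := by
      simp only [gridPoint, pow_succ]; push_cast; field_simp
    rw [this]
    have hk : 2 * (k : ℕ) < 2 ^ (n + 1) + 1 := by
      have := k.2
      rw [pow_succ]; lia
    exact le_iSup (fun k : Fin (2 ^ (n + 1) + 1) =>
      sojourn z (path ξ J ω) (gridPoint (n + 1) k)) ⟨2 * k, hk⟩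
  calc ∫⁻ ω, unitSup z (path ξ J ω) ∂(P 0 i) = ⨆ n, ∫⁻ ω, M n ω ∂(P 0 i) :=
      lintegral_iSup hM hmono
    _ ≤ sojournMoment ξ J P i z 1 / θ / δ := iSup_le hbound
    _ < ∞ := ENNReal.div_lt_top (ENNReal.div_lt_top he.ne (by simpa using hθ)).ne
      (by simpa using hδ)

/-- By the Markov property at integer times the mean is a geometric series in the moment at time
`1`, times the finite mean of `unitSup`. -/
lemma lintegral_sojournBound_lt_top {z : ℝ} {i : ℤˣ} (he : sojournMoment ξ J P i z 1 < 1) :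
    ∫⁻ ω, sojournBound z (path ξ J ω) ∂(P 0 i) < ∞ := by
  unfold sojournBound
  rw [lintegral_tsum (f := fun (n : ℕ) ω => sojourn z (path ξ J ω) n *
    unitSup z (shift n (path ξ J ω))) fun n : ℕ => ((h.measurable_sojourn_path z _).mul
    ((measurable_unitSup z).comp (h.measurable_shift_path n))).aemeasurable]
  have key : ∀ n : ℕ, ∫⁻ ω, sojourn z (path ξ J ω) n * unitSup z (shift n (path ξ J ω)) ∂(P 0 i) =
      sojournMoment ξ J P i z 1 ^ n * ∫⁻ ω, unitSup z (path ξ J ω) ∂(P 0 i) := by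
    intro n
    have := h.lintegral_sojourn_markov z i n (f := fun _ => 1) measurable_const
      (measurable_unitSup z).hasMeasurableVersion
    simp only [one_mul] at this
    rw [this, ← h.sojournMoment_nsmul, mul_one, sojournMoment]
  simp only [key]
  rw [ENNReal.tsum_mul_right, ENNReal.tsum_geometric]
  refine ENNReal.mul_lt_top ?_ (h.lintegral_unitSup_lt_top (he.trans ENNReal.one_lt_top))
  rw [ENNReal.inv_lt_top]
  exact tsub_pos_of_lt he

end

end IsMAP

/-! ### The jump at the first switch -/

/-- The index of the last grid point strictly before `t`, for `t > 0`. -/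
def gridIndexBefore (n : ℕ) (t : ℝ≥0) : ℕ := ⌈t * 2 ^ n⌉₊ - 1

section
variable {t : ℝ≥0} (ht : 0 < t)
include ht

lemma gridIndexBefore_add_one (n : ℕ) : gridIndexBefore n t + 1 = ⌈t * 2 ^ n⌉₊ :=
  Nat.sub_add_cancel (Nat.ceil_pos.2 (by positivity))

lemma gridPoint_gridIndexBefore_lt (n : ℕ) : gridPoint n (gridIndexBefore n t) < t := by
  rw [gridPoint, div_lt_iff₀ (by positivity), ← Nat.lt_ceil, ← gridIndexBefore_add_one ht]
  exact Nat.lt_succ_self _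

lemma le_gridPoint_gridIndexBefore_add_one (n : ℕ) :
    t ≤ gridPoint n (gridIndexBefore n t + 1) := by
  rw [gridPoint, le_div_iff₀ (by positivity), gridIndexBefore_add_one ht]
  exact Nat.le_ceil _

lemma tendsto_gridPoint_gridIndexBefore :
    Tendsto (fun n => gridPoint n (gridIndexBefore n t)) atTop (𝓝[<] t) := by
  refine tendsto_nhdsWithin_iff.2 ⟨?_, Eventually.of_forall fun n =>
    gridPoint_gridIndexBefore_lt ht n⟩
  refine tendsto_of_tendsto_of_tendsto_of_le_of_le (g := fun n => t - gridPoint n 1) ?_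
    tendsto_const_nhds (fun n => ?_) (fun n => (gridPoint_gridIndexBefore_lt ht n).le)
  · simpa using (tendsto_const_nhds (x := t)).sub tendsto_gridPoint_one
  · rw [tsub_le_iff_right, ← gridPoint_succ]
    exact le_gridPoint_gridIndexBefore_add_one ht n

lemma tendsto_gridPoint_gridIndexBefore_add_one :
    Tendsto (fun n => gridPoint n (gridIndexBefore n t + 1)) atTop (𝓝[≥] t) := by
  refine tendsto_nhdsWithin_iff.2 ⟨?_, Eventually.of_forall fun n =>
    le_gridPoint_gridIndexBefore_add_one ht n⟩
  have e : ∀ n, gridPoint n (gridIndexBefore n t + 1) =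
    gridPoint n (gridIndexBefore n t) + gridPoint n 1 := fun n => gridPoint_succ n _
  simp only [e]
  simpa using ((tendsto_gridPoint_gridIndexBefore ht).mono_right nhdsWithin_le_nhds).add
    tendsto_gridPoint_one

end

namespace MAPPath

/-- A function `φ` of the level at time `u`, provided that the state then differs from the
initial one. -/
def switchedBy (φ : EReal → ℝ≥0∞) (u : ℝ≥0) (x : MAPPath) : ℝ≥0∞ :=
  if (x u).2 = (x 0).2 then 0 else φ (x u).1

lemma measurable_switchedBy {φ : EReal → ℝ≥0∞} (hφ : Measurable φ) (u : ℝ≥0) :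
    Measurable (switchedBy φ u) :=
  Measurable.ite (measurableSet_eq_fun (measurable_snd.comp (measurable_pi_apply _))
      (measurable_snd.comp (measurable_pi_apply _))) measurable_const
    (hφ.comp (measurable_fst.comp (measurable_pi_apply u)))

/-- Approximation of a functional of the jump at the first switch along a grid. -/
def gridSwitch (z : ℝ) (φ : EReal → ℝ≥0∞) (n : ℕ) (x : MAPPath) : ℝ≥0∞ :=
  ∑' k : ℕ, sojourn z x (gridPoint n k) * switchedBy φ (gridPoint n 1) (shift (gridPoint n k) x)

variable {x : MAPPath} (hx : RightCts x)
include hx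

/-- In cells before the first switch the state does not change over the step; in cells after it the
sojourn weight vanishes. At most one term of `gridSwitch` survives. -/
lemma gridSwitch_term_eq_zero (z : ℝ) (φ : EReal → ℝ≥0∞) {n k : ℕ}
    (hk : ¬ ((gridPoint n k : ℝ≥0∞) < firstSwitch x ∧
      firstSwitch x ≤ (gridPoint n (k + 1) : ℝ≥0))) :
    sojourn z x (gridPoint n k) *
      switchedBy φ (gridPoint n 1) (shift (gridPoint n k) x) = 0 := by
  by_cases h1 : (gridPoint n k : ℝ≥0∞) < firstSwitch x
  · have h2 : ((gridPoint n (k + 1) : ℝ≥0) : ℝ≥0∞) < firstSwitch x := by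
      by_contra h2; exact hk ⟨h1, not_lt.1 h2⟩
    have h3 := (lt_firstSwitch_iff hx _).1 h2
    have : switchedBy φ (gridPoint n 1) (shift (gridPoint n k) x) = 0 := by
      simp only [switchedBy, shift, ← gridPoint_succ, add_zero]
      rw [if_pos]
      have h4 : gridPoint n k ≤ gridPoint n (k + 1) := by
        rw [gridPoint_succ]; exact le_self_add
      rw [h3 _ le_rfl, h3 _ h4]
    rw [this, mul_zero]
  · simp [sojourn, h1]

lemma gridSwitch_of_eq_top (z : ℝ) (φ : EReal → ℝ≥0∞) (n : ℕ) (hS : firstSwitch x = ∞) :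
    gridSwitch z φ n x = 0 := by
  rw [gridSwitch, ENNReal.tsum_eq_zero]
  intro k
  exact gridSwitch_term_eq_zero hx z φ (by simp [hS])

lemma gridSwitch_of_eq_coe (z : ℝ) (φ : EReal → ℝ≥0∞) (n : ℕ) {S : ℝ≥0}
    (hS : firstSwitch x = S) : gridSwitch z φ n x =
      sojourn z x (gridPoint n (gridIndexBefore n S)) * switchedBy φ (gridPoint n 1)
        (shift (gridPoint n (gridIndexBefore n S)) x) := by
  have hS0 : 0 < S := by
    have := firstSwitch_pos hx
    rw [hS] at this
    exact_mod_cast this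
  refine tsum_eq_single _ fun k hk => gridSwitch_term_eq_zero hx z φ fun ⟨h1, h2⟩ => hk ?_
  rw [hS] at h1 h2
  have h1' : gridPoint n k < S := by exact_mod_cast h1
  have h2' : S ≤ gridPoint n (k + 1) := by exact_mod_cast h2
  rw [gridPoint, div_lt_iff₀ (by positivity), ← Nat.lt_ceil] at h1'
  rw [gridPoint, le_div_iff₀ (by positivity), ← Nat.ceil_le] at h2'
  rw [gridIndexBefore]
  lia

lemma gridSwitch_le (z : ℝ) {φ : EReal → ℝ≥0∞} {M D : ℝ≥0∞} (hφ : ∀ a, φ a ≤ M)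
    (hD : ∀ u, sojourn z x u ≤ D) (n : ℕ) : gridSwitch z φ n x ≤ D * M := by
  cases hS : firstSwitch x with
  | top => simp [gridSwitch_of_eq_top hx z φ n hS]
  | coe S =>
    rw [gridSwitch_of_eq_coe hx z φ n hS]
    refine mul_le_mul' (hD _) ?_
    unfold switchedBy
    split_ifs
    exacts [zero_le, hφ _]

end MAPPath

namespace IsMAP

open MAPPath

variable {Ω : Type*} [mΩ : MeasurableSpace Ω] {𝓖 : Filtration ℝ≥0 mΩ}
  {ξ : ℝ≥0 → Ω → EReal} {J : ℝ≥0 → Ω → ℤˣ} {P : ℝ → ℤˣ → Measure Ω}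

/-- A functional of the level before the first switch and of the jump at the first switch. -/
def jumpFunctional (ξ : ℝ≥0 → Ω → EReal) (J : ℝ≥0 → Ω → ℤˣ) (z : ℝ) (φ : EReal → ℝ≥0∞)
    (ω : Ω) : ℝ≥0∞ :=
  open Classical in
  if (∃ t, J t ω ≠ J 0 ω) ∧ MAP.preSwitch ξ J ω ≠ ⊥ then
    killedExp z (MAP.preSwitch ξ J ω) *
      φ (ξ (MAP.switchTime J ω) ω - MAP.preSwitch ξ J ω) else 0

section
variable (h : IsMAP 𝓖 ξ J P)
include h

lemma exists_ne_iff (ω : Ω) : (∃ t, J t ω ≠ J 0 ω) ↔ firstSwitch (path ξ J ω) ≠ ∞ := by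
  constructor
  · rintro ⟨t, ht⟩ hS
    exact ht ((h.lt_firstSwitch_path_iff ω t).1 (by rw [hS]; simp) t le_rfl)
  · intro hS
    lift firstSwitch (path ξ J ω) to ℝ≥0 using hS with S hS'
    exact ⟨S, snd_firstSwitch_ne (h.rightCts_path ω) hS'.symm⟩

lemma switchTime_eq {ω : Ω} {S : ℝ≥0} (hS : firstSwitch (path ξ J ω) = S) :
    MAP.switchTime J ω = S := by
  refine IsLeast.csInf_eq ⟨snd_firstSwitch_ne (h.rightCts_path ω) hS, fun t ht => ?_⟩
  by_contra hlt
  exact ht ((h.lt_firstSwitch_path_iff ω t).1 (by rw [hS]; exact_mod_cast not_le.1 hlt) t le_rfl)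

lemma preSwitch_eq {ω : Ω} {S : ℝ≥0} (hS : firstSwitch (path ξ J ω) = S) {l : EReal}
    (hl : Tendsto (fun u => ξ u ω) (𝓝[<] S) (𝓝 l)) : MAP.preSwitch ξ J ω = l := by
  have hS0 : 0 < S := by
    have := firstSwitch_pos (h.rightCts_path ω)
    rw [hS] at this
    exact_mod_cast this
  rw [MAP.preSwitch, h.switchTime_eq hS]
  have : (𝓝[<] S).NeBot := nhdsLT_neBot_of_exists_lt ⟨0, hS0⟩
  exact leftLim_eq_of_tendsto hl

lemma preSwitch_of_dead {ω : Ω} {S u : ℝ≥0} (hS : firstSwitch (path ξ J ω) = S) (hu : u < S)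
    (hb : ξ u ω = ⊥) : MAP.preSwitch ξ J ω = ⊥ := by
  refine h.preSwitch_eq hS (tendsto_const_nhds.congr' ?_)
  filter_upwards [Ioo_mem_nhdsLT hu] with v hv
  exact (h.absorbed u v ω hv.1.le hb).symm

/-- The surviving cell shrinks to the switch time: its left end approaches strictly from below and
yields the left limit, its right end approaches from above and yields the value after the jump. If
killing comes first, both sides vanish. -/
lemma tendsto_gridSwitch {z : ℝ} {φ : EReal → ℝ≥0∞} (hφ : ∀ a ≠ ⊤, Tendsto φ (𝓝 a) (𝓝 (φ a)))
    (hφ' : ∀ a, φ a ≠ ∞) (ω : Ω) :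
    Tendsto (fun n => gridSwitch z φ n (path ξ J ω)) atTop (𝓝 (jumpFunctional ξ J z φ ω)) := by
  have hx := h.rightCts_path ω
  cases hS : firstSwitch (path ξ J ω) with
  | top =>
    have : jumpFunctional ξ J z φ ω = 0 := by
      rw [jumpFunctional, if_neg]
      rw [h.exists_ne_iff]
      simp [hS]
    rw [this]
    simp only [gridSwitch_of_eq_top hx z φ _ hS]
    exact tendsto_const_nhds
  | coe S =>
    have hS0 : 0 < S := by
      have := firstSwitch_pos hx
      rw [hS] at this
      exact_mod_cast this
    simp only [gridSwitch_of_eq_coe hx z φ _ hS]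
    have hbefore := tendsto_gridPoint_gridIndexBefore hS0
    rcases h.leftLim_fst S ω with ⟨u, hu, hb⟩ | ⟨l, hl⟩
    · have : jumpFunctional ξ J z φ ω = 0 := by
        rw [jumpFunctional, if_neg]
        simp [h.preSwitch_of_dead hS hu hb]
      rw [this]
      refine tendsto_const_nhds.congr' ?_
      filter_upwards [hbefore.eventually (Ioo_mem_nhdsLT hu)] with n hn
      have := h.absorbed _ _ ω hn.1.le hb
      simp [sojourn, this]
    · have hpre := h.preSwitch_eq hS hl
      have hJ : jumpFunctional ξ J z φ ω = killedExp z l * φ (ξ S ω - l) := by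
        rw [jumpFunctional, if_pos, hpre, h.switchTime_eq hS]
        rw [h.exists_ne_iff, hpre]
        simp [hS]
      rw [hJ]
      have hafter := tendsto_gridPoint_gridIndexBefore_add_one hS0
      have hrc : Tendsto (fun u => ξ u ω) (𝓝[≥] S) (𝓝 (ξ S ω)) :=
        continuousWithinAt_Ioi_iff_Ici.1 (h.rightCts_fst S ω)
      have hrcJ : ∀ᶠ u in 𝓝[≥] S, J u ω = J S ω := by
        rw [← Set.Ioi_insert, nhdsWithin_insert, eventually_sup]
        exact ⟨by simp, h.rightCts_snd S ω⟩
      have h1 : Tendsto (fun n => sojourn z (path ξ J ω) (gridPoint n (gridIndexBefore n S)))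
          atTop (𝓝 (killedExp z l)) := by
        refine ((tendsto_killedExp_of_ne_bot z (EReal.coe_ne_top l) (EReal.coe_ne_bot l)).comp
          (hl.comp hbefore)).congr fun n => ?_
        have : ((gridPoint n (gridIndexBefore n S) : ℝ≥0) : ℝ≥0∞) < firstSwitch (path ξ J ω) := by
          rw [hS]; exact_mod_cast gridPoint_gridIndexBefore_lt hS0 n
        simp [sojourn, this]
      have hneg : Tendsto (fun n => -ξ (gridPoint n (gridIndexBefore n S)) ω) atTop
          (𝓝 (-(l : EReal))) := (continuous_neg.tendsto _).comp (hl.comp hbefore)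
      have hsub : Tendsto (fun n => ξ (gridPoint n (gridIndexBefore n S + 1)) ω -
          ξ (gridPoint n (gridIndexBefore n S)) ω) atTop (𝓝 (ξ S ω - l)) := by
        have hc := (EReal.continuousAt_add (p := (ξ S ω, -(l : EReal)))
          (Or.inr (by rw [← EReal.coe_neg]; exact EReal.coe_ne_bot _))
          (Or.inr (by rw [← EReal.coe_neg]; exact EReal.coe_ne_top _))).tendsto
        have := hc.comp ((hrc.comp hafter).prodMk_nhds hneg)
        simpa [sub_eq_add_neg, Function.comp_def] using this
      have hne : ξ S ω - l ≠ ⊤ := by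
        have := h.ne_top S ω
        generalize ξ S ω = y at this ⊢
        induction y with
        | bot => simp
        | top => exact absurd rfl this
        | coe y => rw [← EReal.coe_sub]; exact EReal.coe_ne_top _
      have h2 : Tendsto (fun n => switchedBy φ (gridPoint n 1)
          (shift (gridPoint n (gridIndexBefore n S)) (path ξ J ω))) atTop
          (𝓝 (φ (ξ S ω - l))) := by
        refine ((hφ _ hne).comp hsub).congr' ?_
        filter_upwards [hafter.eventually hrcJ] with n hn
        have e1 : J (gridPoint n (gridIndexBefore n S)) ω = J 0 ω :=
          (h.lt_firstSwitch_path_iff ω _).1 (by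
            rw [hS]; exact_mod_cast gridPoint_gridIndexBefore_lt hS0 n) _ le_rfl
        have e2 : J S ω ≠ J 0 ω := snd_firstSwitch_ne hx hS
        simp only [switchedBy, shift, path_apply, ← gridPoint_succ, add_zero, hn, e1, e2,
          if_false, Function.comp_apply]
      exact ENNReal.Tendsto.mul h1 (Or.inr (hφ' _)) h2 (Or.inr (killedExp_ne_top z _))

lemma measurable_gridSwitch (z : ℝ) {φ : EReal → ℝ≥0∞} (hφ : Measurable φ) (n : ℕ) :
    Measurable fun ω => gridSwitch z φ n (path ξ J ω) :=
  Measurable.tsum fun _ => (h.measurable_sojourn_path z _).mul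
    ((measurable_switchedBy hφ _).comp (h.measurable_shift_path _))

lemma measurable_jumpFunctional (z : ℝ) {φ : EReal → ℝ≥0∞} (hφm : Measurable φ)
    (hφ : ∀ a ≠ ⊤, Tendsto φ (𝓝 a) (𝓝 (φ a))) (hφ' : ∀ a, φ a ≠ ∞) :
    Measurable (jumpFunctional ξ J z φ) :=
  measurable_of_tendsto_metrizable (fun n => h.measurable_gridSwitch z hφm n)
    (tendsto_pi_nhds.2 fun ω => h.tendsto_gridSwitch hφ hφ' ω)

/-- One factor does not involve `φ` and the other does not involve `z`: this is where the
independence of the jump from the level before it comes from. -/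
lemma lintegral_gridSwitch (z : ℝ) (i : ℤˣ) {φ : EReal → ℝ≥0∞} (hφ : Measurable φ) (n : ℕ) :
    ∫⁻ ω, gridSwitch z φ n (path ξ J ω) ∂(P 0 i) =
      (∑' k : ℕ, sojournMoment ξ J P i z (gridPoint n k)) *
        ∫⁻ ω, switchedBy φ (gridPoint n 1) (path ξ J ω) ∂(P 0 i) := by
  unfold gridSwitch
  rw [lintegral_tsum (f := fun (k : ℕ) ω => sojourn z (path ξ J ω) (gridPoint n k) *
    switchedBy φ (gridPoint n 1) (shift (gridPoint n k) (path ξ J ω))) fun k =>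
    ((h.measurable_sojourn_path z _).mul
    ((measurable_switchedBy hφ _).comp (h.measurable_shift_path _))).aemeasurable,
    ← ENNReal.tsum_mul_right]
  congr 1
  funext k
  have := h.lintegral_sojourn_markov z i (gridPoint n k) (f := fun _ => 1) measurable_const
    (measurable_switchedBy hφ (gridPoint n 1)).hasMeasurableVersion
  simp only [one_mul] at this
  exact this

/-- Convergence of the means of the grid approximations. -/
lemma tendsto_lintegral_gridSwitch {z : ℝ} {i : ℤˣ} {φ : EReal → ℝ≥0∞} (hφm : Measurable φ)
    (hφ : ∀ a ≠ ⊤, Tendsto φ (𝓝 a) (𝓝 (φ a))) {M : ℝ≥0} (hM : ∀ a, φ a ≤ M) {D : Ω → ℝ≥0∞}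
    (hD : ∀ ω u, sojourn z (path ξ J ω) u ≤ D ω) (hDi : ∫⁻ ω, D ω ∂(P 0 i) ≠ ∞) :
    Tendsto (fun n => ∫⁻ ω, gridSwitch z φ n (path ξ J ω) ∂(P 0 i)) atTop
      (𝓝 (∫⁻ ω, jumpFunctional ξ J z φ ω ∂(P 0 i))) ∧
    ∫⁻ ω, jumpFunctional ξ J z φ ω ∂(P 0 i) ≠ ∞ := by
  have hφ' : ∀ a, φ a ≠ ∞ := fun a => ((hM a).trans_lt ENNReal.coe_lt_top).ne
  have hle : ∀ n ω, gridSwitch z φ n (path ξ J ω) ≤ D ω * M := fun n ω =>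
    gridSwitch_le (h.rightCts_path ω) z hM (hD ω) n
  have hfin : ∫⁻ ω, D ω * M ∂(P 0 i) ≠ ∞ := by
    rw [lintegral_mul_const' _ _ ENNReal.coe_ne_top]
    exact ENNReal.mul_ne_top hDi ENNReal.coe_ne_top
  refine ⟨tendsto_lintegral_of_dominated_convergence (fun ω => D ω * M)
    (fun n => h.measurable_gridSwitch z hφm n) (fun n => Eventually.of_forall (hle n)) hfin
    (Eventually.of_forall fun ω => h.tendsto_gridSwitch hφ hφ' ω), ?_⟩
  refine ((lintegral_mono fun ω => ?_).trans_lt hfin.lt_top).ne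
  exact le_of_tendsto (h.tendsto_gridSwitch hφ hφ' ω) (Eventually.of_forall fun n => hle n ω)

omit h mΩ in
lemma sojourn_zero_le_one (ω : Ω) (u : ℝ≥0) : sojourn 0 (path ξ J ω) u ≤ 1 := by
  unfold sojourn killedExp
  split_ifs <;> simp

omit h mΩ in
lemma tendsto_killedExp {z : ℝ} (hz : 0 < z) {a : EReal} (ha : a ≠ ⊤) :
    Tendsto (killedExp z) (𝓝 a) (𝓝 (killedExp z a)) := by
  by_cases hb : a = ⊥
  · subst hb
    rw [killedExp_bot, ENNReal.tendsto_nhds_zero]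
    intro ε hε
    obtain ⟨ε', hε', hlt⟩ := exists_between (show 0 < min ε 1 from lt_min hε one_pos)
    have hfin : ε' ≠ ∞ := (hlt.trans_le ((min_le_right _ _).trans ENNReal.one_lt_top.le)).ne
    have hpos : 0 < ε'.toReal := ENNReal.toReal_pos hε'.ne' hfin
    filter_upwards [gt_mem_nhds (EReal.bot_lt_coe (Real.log ε'.toReal / z))] with b hb
    induction b with
    | bot => simp
    | top => exact absurd hb (by simp)
    | coe b =>
      rw [killedExp_coe]
      have hb' : b < Real.log ε'.toReal / z := by exact_mod_cast hb
      rw [lt_div_iff₀ hz] at hb'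
      have : Real.exp (z * b) ≤ ε'.toReal := by
        rw [← Real.exp_log hpos]
        exact Real.exp_le_exp.2 (by linarith)
      refine (ENNReal.ofReal_le_ofReal this).trans ?_
      rw [ENNReal.ofReal_toReal hfin]
      exact hlt.le.trans (min_le_left _ _)
  · exact tendsto_killedExp_of_ne_bot z ha hb

/-- The jump at the first switch is independent of the level just before it. -/
lemma lintegral_jumpFunctional_mul {z : ℝ} (hz : 0 < z) {i : ℤˣ}
    (he : sojournMoment ξ J P i z 1 < 1) :
    (∫⁻ ω, jumpFunctional ξ J z (killedExp z) ω ∂(P 0 i)) *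
        ∫⁻ ω, jumpFunctional ξ J 0 1 ω ∂(P 0 i) =
      (∫⁻ ω, jumpFunctional ξ J z 1 ω ∂(P 0 i)) *
        ∫⁻ ω, jumpFunctional ξ J 0 (killedExp z) ω ∂(P 0 i) := by
  have := h.isProbabilityMeasure 0 i
  -- Truncation makes the test function bounded, as domination requires; monotone convergence
  -- removes it at the end.
  set φ : ℕ → EReal → ℝ≥0∞ := fun m a => min (killedExp z a) m
  have hφm : ∀ m, Measurable (φ m) := fun m => (measurable_killedExp z).min measurable_const
  have hφ : ∀ m, ∀ a ≠ ⊤, Tendsto (φ m) (𝓝 a) (𝓝 (φ m a)) := fun m a ha =>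
    (tendsto_killedExp hz ha).min tendsto_const_nhds
  have hφM : ∀ m a, φ m a ≤ (m : ℝ≥0) := fun m a => by simp [φ]
  have hφ' : ∀ m a, φ m a ≠ ∞ := fun m a => ((hφM m a).trans_lt ENNReal.coe_lt_top).ne
  have h1c : ∀ a : EReal, a ≠ ⊤ → Tendsto (1 : EReal → ℝ≥0∞) (𝓝 a) (𝓝 ((1 : EReal → ℝ≥0∞) a)) :=
    fun a _ => tendsto_const_nhds
  have hD := fun ω => sojourn_le_sojournBound (h.rightCts_path ω) z
  have hDi := (h.lintegral_sojournBound_lt_top he).ne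
  have hD0 := sojourn_zero_le_one (ξ := ξ) (J := J)
  have hDi0 : ∫⁻ _, 1 ∂(P 0 i) ≠ ∞ := by simp
  have h11 : ∀ a, (1 : EReal → ℝ≥0∞) a ≤ (1 : ℝ≥0) := fun a => by simp
  -- By `lintegral_gridSwitch` the two cross products agree at every mesh, hence in the limit.
  have key : ∀ m, (∫⁻ ω, jumpFunctional ξ J z (φ m) ω ∂(P 0 i)) *
        ∫⁻ ω, jumpFunctional ξ J 0 1 ω ∂(P 0 i) =
      (∫⁻ ω, jumpFunctional ξ J z 1 ω ∂(P 0 i)) *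
        ∫⁻ ω, jumpFunctional ξ J 0 (φ m) ω ∂(P 0 i) := by
    intro m
    obtain ⟨a1, b1⟩ := h.tendsto_lintegral_gridSwitch (hφm m) (hφ m) (hφM m) hD hDi
    obtain ⟨a2, b2⟩ := h.tendsto_lintegral_gridSwitch (φ := 1) measurable_one h1c h11 hD0 hDi0
    obtain ⟨a3, b3⟩ := h.tendsto_lintegral_gridSwitch (φ := 1) measurable_one h1c h11 hD hDi
    obtain ⟨a4, b4⟩ := h.tendsto_lintegral_gridSwitch (hφm m) (hφ m) (hφM m) hD0 hDi0
    have l1 := ENNReal.Tendsto.mul a1 (Or.inr b2) a2 (Or.inr b1)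
    have l2 := ENNReal.Tendsto.mul a3 (Or.inr b4) a4 (Or.inr b3)
    refine tendsto_nhds_unique l1 (l2.congr fun n => ?_)
    rw [h.lintegral_gridSwitch z i measurable_one, h.lintegral_gridSwitch 0 i (hφm m),
      h.lintegral_gridSwitch z i (hφm m), h.lintegral_gridSwitch 0 i measurable_one]
    ring
  have hsup : ∀ a, ⨆ m, φ m a = killedExp z a := by
    intro a
    refine le_antisymm (iSup_le fun m => min_le_left _ _) ?_
    obtain ⟨m, hm⟩ := ENNReal.exists_nat_gt (killedExp_ne_top z a)
    exact le_iSup_of_le m (le_min le_rfl hm.le)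
  have mct : ∀ ζ, ∫⁻ ω, jumpFunctional ξ J ζ (killedExp z) ω ∂(P 0 i) =
      ⨆ m, ∫⁻ ω, jumpFunctional ξ J ζ (φ m) ω ∂(P 0 i) := by
    intro ζ
    rw [← lintegral_iSup (fun m => h.measurable_jumpFunctional ζ (hφm m) (hφ m) (hφ' m))]
    · refine lintegral_congr fun ω => ?_
      unfold jumpFunctional
      split_ifs
      · rw [← ENNReal.mul_iSup, hsup]
      · simp
    · intro m m' hmm ω
      simp only [jumpFunctional]
      split_ifs
      · refine mul_le_mul_right (min_le_min_left _ ?_) _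
        exact_mod_cast hmm
      · exact le_rfl
  rw [mct, mct, ENNReal.iSup_mul, ENNReal.mul_iSup]
  simp only [key]

lemma sojournMoment_gridPoint (i : ℤˣ) (z : ℝ) (n k : ℕ) :
    sojournMoment ξ J P i z (gridPoint n k) = sojournMoment ξ J P i z (gridPoint n 1) ^ k := by
  rw [← h.sojournMoment_nsmul]
  simp [gridPoint, div_eq_mul_inv]

lemma sojournMoment_pow_eq (i : ℤˣ) (z : ℝ) (n : ℕ) :
    sojournMoment ξ J P i z (gridPoint n 1) ^ (2 ^ n) = sojournMoment ξ J P i z 1 := by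
  rw [← h.sojournMoment_gridPoint]
  simp [gridPoint]

lemma sojournMoment_grid_eq_exp {i : ℤˣ} {z : ℝ} (he : sojournMoment ξ J P i z 1 < ∞) (n : ℕ) :
    sojournMoment ξ J P i z (gridPoint n 1) = ENNReal.ofReal
      (Real.exp (Real.log (sojournMoment ξ J P i z 1).toReal * (gridPoint n 1 : ℝ≥0))) := by
  have hp := h.sojournMoment_pow_eq i z n
  have hpos := h.sojournMoment_one_pos z i
  set E := sojournMoment ξ J P i z (gridPoint n 1)
  have hE0 : E ≠ 0 := by
    rintro h0
    rw [← hp, h0, zero_pow (by positivity)] at hpos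
    exact lt_irrefl _ hpos
  have hEt : E ≠ ∞ := by
    rintro h0
    rw [← hp, h0, ENNReal.top_pow (by positivity)] at he
    exact lt_irrefl _ he
  rw [← hp, ENNReal.toReal_pow, Real.log_pow]
  have e : ((2 ^ n : ℕ) : ℝ) * Real.log E.toReal * ((gridPoint n 1 : ℝ≥0) : ℝ) =
      Real.log E.toReal := by
    simp only [gridPoint, NNReal.coe_div, NNReal.coe_natCast, NNReal.coe_pow, NNReal.coe_ofNat]
    push_cast
    field_simp
  rw [e, Real.exp_log (ENNReal.toReal_pos hE0 hEt), ENNReal.ofReal_toReal hEt]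

/-- At mesh `h` the grid mean is the probability of being in `-i` at time `h`, divided by `1 - exp
(F h)` from the geometric series. This is a quotient of two slopes at `0`, with limits `exitRate`
and `-F`. -/
lemma lintegral_jumpFunctional_one {z : ℝ} {i : ℤˣ} (he : sojournMoment ξ J P i z 1 < 1) :
    ∫⁻ ω, jumpFunctional ξ J z 1 ω ∂(P 0 i) = ENNReal.ofReal
      (exitRate ξ J P i / (-Real.log (sojournMoment ξ J P i z 1).toReal)) := by
  have := h.isProbabilityMeasure 0 i
  have hlt := he.trans ENNReal.one_lt_top
  set F := Real.log (sojournMoment ξ J P i z 1).toReal with hF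
  have hF0 : F < 0 := by
    refine Real.log_neg (ENNReal.toReal_pos (h.sojournMoment_one_pos z i).ne' hlt.ne) ?_
    rw [← ENNReal.toReal_one]
    exact (ENNReal.toReal_lt_toReal hlt.ne ENNReal.one_ne_top).2 he
  obtain ⟨a1, b1⟩ := h.tendsto_lintegral_gridSwitch (φ := 1) (M := 1) (i := i) measurable_one
    (fun a _ => tendsto_const_nhds) (fun a => by simp)
    (fun ω => sojourn_le_sojournBound (h.rightCts_path ω) z)
    (h.lintegral_sojournBound_lt_top he).ne
  refine tendsto_nhds_unique a1 ?_
  set a : ℝ → ℝ := fun t => (P 0 i).real {ω | J t.toNNReal ω = -i} with ha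
  have e : ∀ n, ∫⁻ ω, gridSwitch z 1 n (path ξ J ω) ∂(P 0 i) = ENNReal.ofReal
      (slope a 0 (gridPoint n 1 : ℝ≥0) /
        (-slope (fun t : ℝ => Real.exp (F * t)) 0 (gridPoint n 1 : ℝ≥0))) := by
    intro n
    have hg : (0 : ℝ) < (gridPoint n 1 : ℝ≥0) := by simp [gridPoint]
    have hexp : Real.exp (F * (gridPoint n 1 : ℝ≥0)) < 1 := by
      rw [Real.exp_lt_one_iff]
      exact mul_neg_of_neg_of_pos hF0 hg
    have ha0 : a 0 = 0 := by
      have hb := h.prob_state_neg_bounds i 0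
      have h0 : stayProb ξ J P i 0 = 1 := by rw [h.stayProb_eq_exp]; simp
      rw [h0, sub_self] at hb
      simp only [ha, Real.toNNReal_zero]
      exact le_antisymm hb.2 measureReal_nonneg
    rw [h.lintegral_gridSwitch z i measurable_one]
    rw [tsum_congr (h.sojournMoment_gridPoint i z n), ENNReal.tsum_geometric,
      h.sojournMoment_grid_eq_exp hlt, ← hF]
    have e2 : ∫⁻ ω, switchedBy 1 (gridPoint n 1) (path ξ J ω) ∂(P 0 i) =
        ENNReal.ofReal (a (gridPoint n 1 : ℝ≥0)) := by
      have hm : MeasurableSet {ω | J (gridPoint n 1) ω = -i} := h.measurableSet_state_eq _ _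
      simp only [ha, Real.toNNReal_coe]
      rw [ofReal_measureReal, ← lintegral_indicator_one hm]
      refine lintegral_congr_ae ?_
      filter_upwards [h.ae_start i] with ω hω
      simp only [switchedBy, path_apply, hω.2, Pi.one_apply, Set.indicator_apply,
        Set.mem_ofPred_eq, ← intUnits_ne_iff, ne_eq, ite_not]
    rw [e2, ← ENNReal.ofReal_one, ← ENNReal.ofReal_sub _ (Real.exp_pos _).le,
      ← ENNReal.ofReal_inv_of_pos (by linarith), ← ENNReal.ofReal_mul (by
        rw [inv_nonneg]; linarith)]
    congr 1
    simp only [slope_def_field, ha0, sub_zero, mul_zero, Real.exp_zero]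
    have : Real.exp (F * (gridPoint n 1 : ℝ≥0)) - 1 ≠ 0 := by linarith
    have : 1 - Real.exp (F * (gridPoint n 1 : ℝ≥0)) ≠ 0 := by linarith
    rw [← neg_div, neg_sub]
    field_simp
  simp only [e]
  refine ENNReal.tendsto_ofReal ?_
  have hg : Tendsto (fun n => ((gridPoint n 1 : ℝ≥0) : ℝ)) atTop (𝓝[Set.Ici 0 \ {0}] 0) := by
    refine tendsto_nhdsWithin_iff.2 ⟨?_, Eventually.of_forall fun n => ?_⟩
    · simpa using NNReal.tendsto_coe.2 tendsto_gridPoint_one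
    · have : (0 : ℝ) < (gridPoint n 1 : ℝ≥0) := by simp [gridPoint]
      exact ⟨this.le, this.ne'⟩
  have s1 := (hasDerivWithinAt_iff_tendsto_slope.1 (h.hasDerivWithinAt_prob_neg i)).comp hg
  have d2 : HasDerivAt (fun t : ℝ => Real.exp (F * t)) F 0 := by
    have := ((hasDerivAt_id (0 : ℝ)).const_mul F).exp
    simpa using this
  have s2 := (hasDerivWithinAt_iff_tendsto_slope.1 (d2.hasDerivWithinAt (s := Set.Ici 0))).comp hg
  exact s1.div s2.neg (by linarith)

lemma jumpFunctional_killedExp (z : ℝ) (ω : Ω) :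
    jumpFunctional ξ J z (killedExp z) ω = switchWeight z (path ξ J ω) := by
  cases hS : firstSwitch (path ξ J ω) with
  | top =>
    rw [jumpFunctional, if_neg, switchWeight, if_pos hS]
    rw [h.exists_ne_iff]
    simp [hS]
  | coe S =>
    rw [switchWeight, if_neg (by simp [hS]), hS, ENNReal.toNNReal_coe, path_apply]
    rcases h.leftLim_fst S ω with ⟨u, hu, hb⟩ | ⟨l, hl⟩
    · rw [jumpFunctional, if_neg (by simp [h.preSwitch_of_dead hS hu hb]),
        h.absorbed u S ω hu.le hb, killedExp_bot]
    · have hpre := h.preSwitch_eq hS hl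
      rw [jumpFunctional, if_pos, hpre, h.switchTime_eq hS,
        killedExp_mul_killedExp_sub z (h.ne_top S ω) (EReal.coe_ne_top l) (EReal.coe_ne_bot l)]
      rw [h.exists_ne_iff, hpre]
      simp [hS]

omit h mΩ in
/-- The event that a switch occurs before the process is killed. -/
def switchEvent (ξ : ℝ≥0 → Ω → EReal) (J : ℝ≥0 → Ω → ℤˣ) : Set Ω :=
  {ω | (∃ t, J t ω ≠ J 0 ω) ∧ MAP.preSwitch ξ J ω ≠ ⊥}

omit h mΩ in
lemma jumpFunctional_of_mem {z : ℝ} {φ : EReal → ℝ≥0∞} {ω : Ω} (hω : ω ∈ switchEvent ξ J) :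
    jumpFunctional ξ J z φ ω = killedExp z (MAP.preSwitch ξ J ω) *
      φ (ξ (MAP.switchTime J ω) ω - MAP.preSwitch ξ J ω) := if_pos hω

omit h mΩ in
lemma jumpFunctional_of_notMem {z : ℝ} {φ : EReal → ℝ≥0∞} {ω : Ω}
    (hω : ω ∉ switchEvent ξ J) : jumpFunctional ξ J z φ ω = 0 := if_neg hω

omit h mΩ in
lemma jumpFunctional_zero_eq (φ : EReal → ℝ≥0∞) (ω : Ω) : jumpFunctional ξ J 0 φ ω =
    (switchEvent ξ J).indicator
      (fun ω => φ (ξ (MAP.switchTime J ω) ω - MAP.preSwitch ξ J ω)) ω := by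
  by_cases hω : ω ∈ switchEvent ξ J
  · rw [Set.indicator_of_mem hω, jumpFunctional_of_mem hω]
    simp [killedExp, hω.2]
  · rw [Set.indicator_of_notMem hω, jumpFunctional_of_notMem hω]

lemma measurableSet_switchEvent : MeasurableSet (switchEvent ξ J) := by
  have hm := h.measurable_jumpFunctional 0 (φ := 1) measurable_one
    (fun a _ => tendsto_const_nhds) (fun a => by simp)
  convert hm (measurableSet_singleton (1 : ℝ≥0∞)) using 1
  ext ω
  rw [Set.mem_preimage, jumpFunctional_zero_eq]
  by_cases hω : ω ∈ switchEvent ξ J <;> simp [hω]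

lemma jumpMoment_neg_eq (z : ℝ) (i : ℤˣ) : MAP.jumpMoment ξ J P i (-i) z =
    (P 0 i (switchEvent ξ J))⁻¹ *
      ∫⁻ ω, jumpFunctional ξ J 0 (killedExp z) ω ∂(P 0 i) := by
  have hi : i ≠ -i := by rcases Int.units_eq_one_or i with rfl | rfl <;> decide
  -- With two states, the first switch from `i` can only lead to `-i`.
  have hae : {ω | (∃ t, J t ω ≠ J 0 ω) ∧ J (MAP.switchTime J ω) ω = -i ∧
      MAP.preSwitch ξ J ω ≠ ⊥} =ᵐ[P 0 i] switchEvent ξ J := by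
    filter_upwards [h.ae_start i] with ω hω
    refine propext ⟨fun H => ⟨H.1, H.2.2⟩, fun H => ⟨H.1, ?_, H.2⟩⟩
    have hS := (h.exists_ne_iff ω).1 H.1
    lift firstSwitch (path ξ J ω) to ℝ≥0 using hS with S hS'
    rw [h.switchTime_eq hS'.symm, ← intUnits_ne_iff, ← hω.2]
    exact snd_firstSwitch_ne (h.rightCts_path ω) hS'.symm
  simp only [jumpFunctional_zero_eq]
  rw [MAP.jumpMoment, if_neg hi, ProbabilityTheory.cond, measure_congr hae,
    Measure.restrict_congr_set hae, lintegral_smul_measure,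
    lintegral_indicator h.measurableSet_switchEvent]
  rfl

lemma lintegral_jumpFunctional_zero_one (i : ℤˣ) :
    ∫⁻ ω, jumpFunctional ξ J 0 1 ω ∂(P 0 i) = P 0 i (switchEvent ξ J) := by
  simp only [jumpFunctional_zero_eq]
  exact lintegral_indicator_one h.measurableSet_switchEvent

/-- The mean weight at the first switch, in terms of the characteristics. -/
lemma lintegral_switchWeight {z : ℝ} (hz : 0 < z) {i : ℤˣ}
    (he : sojournMoment ξ J P i z 1 < 1) :
    ∫⁻ ω, switchWeight z (path ξ J ω) ∂(P 0 i) = MAP.jumpMoment ξ J P i (-i) z *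
      ENNReal.ofReal (exitRate ξ J P i / (-Real.log (sojournMoment ξ J P i z 1).toReal)) := by
  have := h.isProbabilityMeasure 0 i
  have key := h.lintegral_jumpFunctional_mul hz he
  rw [h.lintegral_jumpFunctional_zero_one, h.lintegral_jumpFunctional_one he] at key
  simp only [h.jumpFunctional_killedExp] at key
  rw [h.jumpMoment_neg_eq]
  -- The conditional mean requires division by this probability; when it is zero both sides vanish.
  by_cases hp : P 0 i (switchEvent ξ J) = 0
  · have h0 : ∀ᵐ ω ∂(P 0 i), ω ∉ switchEvent ξ J := measure_eq_zero_iff_ae_notMem.1 hp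
    have e1 : ∫⁻ ω, switchWeight z (path ξ J ω) ∂(P 0 i) = 0 := by
      rw [← lintegral_zero (μ := P 0 i)]
      refine lintegral_congr_ae ?_
      filter_upwards [h0] with ω hω
      rw [← h.jumpFunctional_killedExp, jumpFunctional_of_notMem hω]
    have e2 : ∫⁻ ω, jumpFunctional ξ J 0 (killedExp z) ω ∂(P 0 i) = 0 := by
      rw [← lintegral_zero (μ := P 0 i)]
      refine lintegral_congr_ae ?_
      filter_upwards [h0] with ω hω
      rw [jumpFunctional_of_notMem hω]
    rw [e1, e2]
    simp
  · have hp' : P 0 i (switchEvent ξ J) ≠ ∞ := measure_ne_top _ _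
    rw [mul_assoc, mul_comm (∫⁻ ω, jumpFunctional ξ J 0 (killedExp z) ω ∂(P 0 i)), ← key,
      mul_comm _ (P 0 i (switchEvent ξ J)), ← mul_assoc, ENNReal.inv_mul_cancel hp hp', one_mul]

/-- Without switches the conditioning event is null and the conditional measure is zero, so
finiteness of this moment imposes nothing when the rate vanishes. -/
lemma jumpMoment_of_exitRate_eq_zero {z : ℝ} {i : ℤˣ} (he : sojournMoment ξ J P i z 1 < 1)
    (hc : exitRate ξ J P i = 0) : MAP.jumpMoment ξ J P i (-i) z = 0 := by
  have h1 := h.lintegral_jumpFunctional_one he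
  rw [hc, zero_div, ENNReal.ofReal_zero, lintegral_eq_zero_iff
    (h.measurable_jumpFunctional z measurable_one (fun a _ => tendsto_const_nhds)
      (fun a => by simp))] at h1
  rw [h.jumpMoment_neg_eq]
  convert mul_zero _
  rw [← lintegral_zero (μ := P 0 i)]
  refine lintegral_congr_ae ?_
  filter_upwards [h1] with ω hω
  rw [jumpFunctional, if_neg]
  intro H
  rw [jumpFunctional, if_pos H] at hω
  exact killedExp_ne_zero z H.2 (by simpa using hω)

end

end IsMAP

/-! ### Necessity: comparing the functional with its tail -/

namespace MAPPath

section
variable {x : MAPPath} (hx : RightCts x)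
include hx

/-- A path alive at time `0` has, by right-continuity, an integrand bounded below by a positive
constant on an initial interval. -/
lemma lintegral_Ioi_lt_totalIntegral {α : ℝ} (h0 : (x 0).1 ≠ ⊥) (hfin : totalIntegral α x ≠ ∞)
    {t : ℝ≥0} (ht : 0 < t) :
    ∫⁻ u in Set.Ioi t, killedExp α (x u).1 ∂timeMeasure < totalIntegral α x := by
  have hsplit : totalIntegral α x = ∫⁻ u in Set.Ioi t, killedExp α (x u).1 ∂timeMeasure +
      ∫⁻ u in (Set.Ioi t)ᶜ, killedExp α (x u).1 ∂timeMeasure :=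
    (lintegral_add_compl _ measurableSet_Ioi).symm
  have hle : ∫⁻ u in Set.Ioi t, killedExp α (x u).1 ∂timeMeasure ≠ ∞ :=
    ((setLIntegral_le_lintegral _ _).trans_lt hfin.lt_top).ne
  rw [hsplit]
  refine ENNReal.lt_add_right hle ?_
  obtain ⟨c, hc0, hc⟩ := exists_between (pos_iff_ne_zero.2 (killedExp_ne_zero α h0))
  obtain ⟨b, hb, hb'⟩ := mem_nhdsGT_iff_exists_Ioc_subset.1
    ((hx.tendsto_killedExp α 0).eventually (lt_mem_nhds hc))
  have hmin : 0 < min b t := lt_min hb ht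
  have h1 : c * timeMeasure (Set.Ioc 0 (min b t)) ≤
      ∫⁻ u in (Set.Ioi t)ᶜ, killedExp α (x u).1 ∂timeMeasure := by
    rw [← setLIntegral_const]
    refine (setLIntegral_mono (measurable_level_path hx α) fun u hu =>
      (hb' ⟨hu.1, hu.2.trans (min_le_left _ _)⟩).le).trans (lintegral_mono_set fun u hu => ?_)
    simpa using hu.2.trans (min_le_right _ _)
  refine (lt_of_lt_of_le ?_ h1).ne'
  rw [timeMeasure_Ioc]
  exact ENNReal.mul_pos hc0.ne' (by simpa using ⟨(show (0 : ℝ≥0) < b from hb).ne', ht.ne'⟩)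

end

/-- The paths whose first switch occurs in the cell `[k 2⁻ⁿ, (k + 1) 2⁻ⁿ)`. -/
def switchCell (n k : ℕ) : Set MAPPath :=
  {x | (gridPoint n k : ℝ≥0∞) ≤ firstSwitch x ∧ firstSwitch x < gridPoint n (k + 1)}

lemma mem_switchCell_iff {x : MAPPath} {S : ℝ≥0} (hS : firstSwitch x = S) (n k : ℕ) :
    x ∈ switchCell n k ↔ k + 1 = gridIndex n S := by
  rw [switchCell, Set.mem_ofPred_eq, hS, ENNReal.coe_le_coe, ENNReal.coe_lt_coe, gridPoint,
    gridPoint, div_le_iff₀ (by positivity), lt_div_iff₀ (by positivity), gridIndex,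
    Nat.add_right_cancel_iff, eq_comm, Nat.floor_eq_iff (by positivity)]
  push_cast
  exact Iff.rfl

/-- A sum over the cells of a grid reduces to the cell which contains the first switch. -/
lemma tsum_switchCell {x : MAPPath} {S : ℝ≥0} (hS : firstSwitch x = S) (n : ℕ)
    {F : ℕ → ℝ≥0∞} (hF : ∀ k, x ∉ switchCell n k → F k = 0) :
    ∑' k, F k = F (gridIndex n S - 1) := by
  refine tsum_eq_single _ fun k hk => hF k fun hmem => hk ?_
  rw [← (mem_switchCell_iff hS n k).1 hmem, Nat.add_sub_cancel]

lemma notMem_switchCell {x : MAPPath} (hS : firstSwitch x = ∞) (n k : ℕ) :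
    x ∉ switchCell n k := by
  simp [switchCell, hS]


end MAPPath

namespace IsMAP

open MAPPath

variable {Ω : Type*} [mΩ : MeasurableSpace Ω] {𝓖 : Filtration ℝ≥0 mΩ}
  {ξ : ℝ≥0 → Ω → EReal} {J : ℝ≥0 → Ω → ℤˣ} {P : ℝ → ℤˣ → Measure Ω}

section
variable (h : IsMAP 𝓖 ξ J P)
include h

omit h mΩ in
/-- The event that the process is alive and `J` is in the state `j` at time `t`. -/
def aliveIn (ξ : ℝ≥0 → Ω → EReal) (J : ℝ≥0 → Ω → ℤˣ) (j : ℤˣ) (t : ℝ≥0) : Set Ω :=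
  {ω | J t ω = j ∧ ξ t ω ≠ ⊥}

lemma measurableSet_aliveIn (j : ℤˣ) (t : ℝ≥0) : MeasurableSet[𝓖 t] (aliveIn ξ J j t) :=
  (h.measurableSet_state le_rfl {j}).inter (h.measurableSet_alive le_rfl)

/-- The Markov property at a random time with values in a sequence. -/
lemma lintegral_tsum_markov (z : ℝ) (i j : ℤˣ) (t : ℕ → ℝ≥0) {f : ℕ → Ω → ℝ≥0∞}
    (hf : ∀ k, Measurable[𝓖 (t k)] (f k)) {Φ : MAPPath → ℝ≥0∞} (hΦ : HasMeasurableVersion Φ) :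
    ∫⁻ ω, ∑' k, (aliveIn ξ J j (t k)).indicator (f k) ω * Φ (shift (t k) (path ξ J ω)) ∂(P z i) =
      (∫⁻ ω, ∑' k, (aliveIn ξ J j (t k)).indicator (f k) ω ∂(P z i)) *
        ∫⁻ ω, Φ (path ξ J ω) ∂(P 0 j) := by
  have hE : ∀ k, MeasurableSet (aliveIn ξ J j (t k)) := fun k =>
    𝓖.le _ _ (h.measurableSet_aliveIn j (t k))
  have hm : ∀ k, Measurable ((aliveIn ξ J j (t k)).indicator (f k)) := fun k =>
    ((hf k).mono (𝓖.le _) le_rfl).indicator (hE k)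
  have hm' : ∀ k, Measurable fun ω => (aliveIn ξ J j (t k)).indicator (f k) ω *
      Φ (shift (t k) (path ξ J ω)) := fun k =>
    (hm k).mul (h.measurable_comp_shift_path hΦ (t k))
  rw [lintegral_tsum fun k => (hm' k).aemeasurable, lintegral_tsum fun k => (hm k).aemeasurable,
    ← ENNReal.tsum_mul_right]
  refine tsum_congr fun k => ?_
  have := h.lintegral_markov_version z i j (t k) (hf k) hΦ
  rw [lintegral_indicator (hE k)]
  refine Eq.trans ?_ this
  rw [show {ω | J (t k) ω = j ∧ ξ (t k) ω ≠ ⊥} = aliveIn ξ J j (t k) from rfl,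
    ← lintegral_indicator (hE k)]
  refine lintegral_congr fun ω => ?_
  by_cases hω : ω ∈ aliveIn ξ J j (t k) <;> simp [hω]

lemma measurableSet_firstSwitch_lt {u t : ℝ≥0} (hut : u ≤ t) :
    MeasurableSet[𝓖 t] {ω | firstSwitch (path ξ J ω) < u} := by
  have e : {ω | firstSwitch (path ξ J ω) < u} = ⋃ (n : ℕ) (k : ℕ) (_ : gridPoint n k < u),
      {ω | (gridPoint n k : ℝ≥0∞) < firstSwitch (path ξ J ω)}ᶜ := by
    ext ω
    simp only [Set.mem_ofPred_eq, Set.mem_iUnion, Set.mem_compl_iff, not_lt, exists_prop]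
    constructor
    · intro H
      lift firstSwitch (path ξ J ω) to ℝ≥0 using H.ne_top with S
      have h2 := ((tendsto_gridPoint_gridIndex S).mono_right nhdsWithin_le_nhds).eventually
        (gt_mem_nhds (ENNReal.coe_lt_coe.1 H))
      obtain ⟨n, hn⟩ := h2.exists
      exact ⟨n, _, hn, ENNReal.coe_le_coe.2 (lt_gridPoint_gridIndex n S).le⟩
    · rintro ⟨n, k, h1, h2⟩
      exact h2.trans_lt (ENNReal.coe_lt_coe.2 h1)
  rw [e]
  exact MeasurableSet.iUnion fun n => MeasurableSet.iUnion fun k => MeasurableSet.iUnion fun hk =>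
    (h.measurableSet_lt_firstSwitch (hk.le.trans hut)).compl

lemma measurableSet_switchCell_inter (n k : ℕ) (t : ℝ≥0) : MeasurableSet[𝓖 t]
    (path ξ J ⁻¹' switchCell n k ∩ {ω | firstSwitch (path ξ J ω) < t}) := by
  have e : path ξ J ⁻¹' switchCell n k ∩ {ω | firstSwitch (path ξ J ω) < t} =
      {ω | firstSwitch (path ξ J ω) < (min (gridPoint n k) t : ℝ≥0)}ᶜ ∩
        {ω | firstSwitch (path ξ J ω) < (min (gridPoint n (k + 1)) t : ℝ≥0)} := by
    ext ω
    simp only [switchCell, Set.mem_inter_iff, Set.mem_preimage, Set.mem_ofPred_eq, Set.mem_compl_iff,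
      ENNReal.coe_min, lt_min_iff, ← not_lt]
    tauto
  rw [e]
  exact (h.measurableSet_firstSwitch_lt (min_le_right _ _)).compl.inter
    (h.measurableSet_firstSwitch_lt (min_le_right _ _))

lemma measurableSet_switchCell (n k : ℕ) :
    MeasurableSet[𝓖 (gridPoint n (k + 1))] (path ξ J ⁻¹' switchCell n k) := by
  have := h.measurableSet_switchCell_inter n k (gridPoint n (k + 1))
  rwa [Set.inter_eq_left.2 fun ω hω => hω.2] at this

lemma snd_firstSwitch_eq_neg {i : ℤˣ} {ω : Ω} (hω : J 0 ω = i) {S : ℝ≥0}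
    (hS : firstSwitch (path ξ J ω) = S) : J S ω = -i := by
  rw [← intUnits_ne_iff, ← hω]
  exact snd_firstSwitch_ne (h.rightCts_path ω) hS

lemma measurable_totalIntegral_rpow (α s : ℝ) :
    Measurable fun ω => totalIntegral α (path ξ J ω) ^ s :=
  h.measurable_comp_path ((hasMeasurableVersion_totalIntegral α).rpow s)

lemma ae_totalIntegral_ne_top {α s : ℝ} (hs : 0 < s) {i : ℤˣ}
    (hm : ∫⁻ ω, totalIntegral α (path ξ J ω) ^ s ∂(P 0 i) ≠ ∞) :
    ∀ᵐ ω ∂(P 0 i), totalIntegral α (path ξ J ω) ≠ ∞ := by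
  filter_upwards [ae_lt_top (h.measurable_totalIntegral_rpow α s) hm] with ω hω htop
  simp [htop, hs] at hω

/-- The part of the exponential functional after a positive time has a strictly smaller
moment. -/
lemma lintegral_lt_of_forall_exists {α s : ℝ} (hs : 0 < s) {i : ℤˣ}
    (hm : ∫⁻ ω, totalIntegral α (path ξ J ω) ^ s ∂(P 0 i) ≠ ∞) {H : Ω → ℝ≥0∞}
    (hH : ∀ ω, ∃ t : ℝ≥0, 0 < t ∧
      H ω ≤ (∫⁻ u in Set.Ioi t, killedExp α (ξ u ω) ∂timeMeasure) ^ s) :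
    ∫⁻ ω, H ω ∂(P 0 i) < ∫⁻ ω, totalIntegral α (path ξ J ω) ^ s ∂(P 0 i) := by
  have := h.isProbabilityMeasure 0 i
  have hlt : ∀ᵐ ω ∂(P 0 i), H ω < totalIntegral α (path ξ J ω) ^ s := by
    filter_upwards [h.ae_start i, h.ae_totalIntegral_ne_top hs hm] with ω hω hfin
    obtain ⟨t, ht, hle⟩ := hH ω
    refine hle.trans_lt (ENNReal.rpow_lt_rpow ?_ hs)
    exact lintegral_Ioi_lt_totalIntegral (h.rightCts_path ω) (by simp [hω.1]) hfin ht
  refine lintegral_strict_mono (IsProbabilityMeasure.ne_zero _)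
    (h.measurable_totalIntegral_rpow α s).aemeasurable ?_ hlt
  exact ((lintegral_mono_ae (hlt.mono fun ω hω => hω.le)).trans_lt hm.lt_top).ne

lemma rpow_lintegral_Ioi {α s : ℝ} (hs : 0 < s) (ω : Ω) (t : ℝ≥0) :
    (∫⁻ u in Set.Ioi t, killedExp α (ξ u ω) ∂timeMeasure) ^ s =
      killedExp (α * s) (ξ t ω) * totalIntegral α (shift t (path ξ J ω)) ^ s := by
  rw [← killedExp_rpow α hs, ← ENNReal.mul_rpow_of_nonneg _ _ hs.le]
  congr 1
  exact lintegral_Ioi_level (h.rightCts_path ω) α t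

/-- By the Markov property the left side is the mean of the s-th power of the tail after time `1`,
on the event of no switch. -/
lemma sojournMoment_mul_lt {α s : ℝ} (hs : 0 < s) {i : ℤˣ}
    (hm : ∫⁻ ω, totalIntegral α (path ξ J ω) ^ s ∂(P 0 i) ≠ ∞) :
    sojournMoment ξ J P i (α * s) 1 * ∫⁻ ω, totalIntegral α (path ξ J ω) ^ s ∂(P 0 i) <
      ∫⁻ ω, totalIntegral α (path ξ J ω) ^ s ∂(P 0 i) := by
  have key := h.lintegral_sojourn_markov (α * s) i 1 (f := fun _ => 1) measurable_const
    ((hasMeasurableVersion_totalIntegral α).rpow s)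
  simp only [one_mul] at key
  rw [sojournMoment, ← key]
  refine h.lintegral_lt_of_forall_exists hs hm fun ω => ⟨1, one_pos, ?_⟩
  rw [h.rpow_lintegral_Ioi hs]
  exact mul_le_mul_left (sojourn_le_killedExp _ _ _) _

/-- The comparison is made with `H`, the power of the tail after the switch. At the grid point just
after the switch the Markov property gives the discretised weight `G n` a mean which, times `m`, is
at most that of `H`; Fatou's lemma then recovers the weight at the switch itself. -/
lemma switchWeight_mul_le {α s : ℝ} (hs : 0 < s) {i : ℤˣ}
    (hm : ∫⁻ ω, totalIntegral α (path ξ J ω) ^ s ∂(P 0 i) ≠ ∞) :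
    (∫⁻ ω, switchWeight (α * s) (path ξ J ω) ∂(P 0 i)) *
        ∫⁻ ω, totalIntegral α (path ξ J ω) ^ s ∂(P 0 (-i)) <
      ∫⁻ ω, totalIntegral α (path ξ J ω) ^ s ∂(P 0 i) := by
  set z := α * s
  set m := ∫⁻ ω, totalIntegral α (path ξ J ω) ^ s ∂(P 0 (-i))
  set H : Ω → ℝ≥0∞ := fun ω => if firstSwitch (path ξ J ω) = ∞ then 0 else
    (∫⁻ u in Set.Ioi (firstSwitch (path ξ J ω)).toNNReal, killedExp α (ξ u ω) ∂timeMeasure) ^ s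
    with hHdef
  set f : ℕ → ℕ → Ω → ℝ≥0∞ := fun n k =>
    (path ξ J ⁻¹' switchCell n k).indicator fun ω => killedExp z (ξ (gridPoint n (k + 1)) ω)
    with hfdef
  set G : ℕ → Ω → ℝ≥0∞ := fun n ω =>
    ∑' k, (aliveIn ξ J (-i) (gridPoint n (k + 1))).indicator (f n k) ω with hGdef
  have hf : ∀ n k, Measurable[𝓖 (gridPoint n (k + 1))] (f n k) := fun n k =>
    ((measurable_killedExp z).comp (h.measurable_fst _)).indicator (h.measurableSet_switchCell n k)
  have hG : ∀ n, Measurable (G n) := fun n => Measurable.tsum fun k =>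
    ((hf n k).mono (𝓖.le _) le_rfl).indicator (𝓖.le _ _ (h.measurableSet_aliveIn _ _))
  have hf0 : ∀ n k ω, path ξ J ω ∉ switchCell n k → f n k ω = 0 := fun n k ω hω =>
    Set.indicator_of_notMem (s := path ξ J ⁻¹' switchCell n k) hω _
  have hfle : ∀ n k ω, f n k ω ≤ killedExp z (ξ (gridPoint n (k + 1)) ω) := fun n k ω =>
    Set.indicator_le_self _ _ _
  have hle : ∀ n, (∫⁻ ω, G n ω ∂(P 0 i)) * m ≤ ∫⁻ ω, H ω ∂(P 0 i) := by
    intro n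
    rw [← h.lintegral_tsum_markov 0 i (-i) (fun k => gridPoint n (k + 1)) (hf n)
      ((hasMeasurableVersion_totalIntegral α).rpow s)]
    refine lintegral_mono fun ω => ?_
    have hterm : ∀ k, (aliveIn ξ J (-i) (gridPoint n (k + 1))).indicator (f n k) ω *
        totalIntegral α (shift (gridPoint n (k + 1)) (path ξ J ω)) ^ s ≤
        f n k ω * totalIntegral α (shift (gridPoint n (k + 1)) (path ξ J ω)) ^ s := fun k =>
      mul_le_mul_left (Set.indicator_le_self _ _ _) _
    refine (ENNReal.tsum_le_tsum hterm).trans ?_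
    by_cases hS : firstSwitch (path ξ J ω) = ∞
    · simp [hf0 n _ ω (notMem_switchCell hS n _)]
    obtain ⟨S, hS : (S : ℝ≥0∞) = firstSwitch (path ξ J ω)⟩ := WithTop.ne_top_iff_exists.1 hS
    have hk : ∀ k, f n k ω * totalIntegral α (shift (gridPoint n (k + 1)) (path ξ J ω)) ^ s ≤
        (path ξ J ⁻¹' switchCell n k).indicator (fun ω => H ω) ω := by
      intro k
      by_cases hmem : ω ∈ path ξ J ⁻¹' switchCell n k
      · rw [Set.indicator_of_mem hmem]
        refine (mul_le_mul_left (hfle n k ω) _).trans ?_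
        rw [← h.rpow_lintegral_Ioi hs]
        simp only [hHdef, ← hS, ENNReal.coe_ne_top, if_false, ENNReal.toNNReal_coe]
        -- The grid point lies after the switch, so the tail from there is the smaller one.
        refine ENNReal.rpow_le_rpow (lintegral_mono_set (Set.Ioi_subset_Ioi ?_)) hs.le
        rw [(mem_switchCell_iff hS.symm n k).1 hmem]
        exact (lt_gridPoint_gridIndex n S).le
      · rw [hf0 n k ω hmem]
        simp
    refine (ENNReal.tsum_le_tsum hk).trans ?_
    rw [tsum_switchCell (F := fun k => (path ξ J ⁻¹' switchCell n k).indicator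
      (fun ω => H ω) ω) hS.symm n fun k hk => Set.indicator_of_notMem
        (s := path ξ J ⁻¹' switchCell n k) hk _]
    exact Set.indicator_le_self _ _ _
  have hHlt : ∫⁻ ω, H ω ∂(P 0 i) < ∫⁻ ω, totalIntegral α (path ξ J ω) ^ s ∂(P 0 i) := by
    refine h.lintegral_lt_of_forall_exists hs hm fun ω => ?_
    by_cases hS : firstSwitch (path ξ J ω) = ∞
    · exact ⟨1, one_pos, by simp [H, hS]⟩
    · refine ⟨(firstSwitch (path ξ J ω)).toNNReal, ENNReal.toNNReal_pos
        (firstSwitch_pos (h.rightCts_path ω)).ne' hS, ?_⟩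
      simp [H, hS]
  have hlim : ∀ᵐ ω ∂(P 0 i), switchWeight z (path ξ J ω) ≤ liminf (fun n => G n ω) atTop := by
    filter_upwards [h.ae_start i] with ω hω
    by_cases hS : firstSwitch (path ξ J ω) = ∞
    · simp [switchWeight, hS]
    obtain ⟨S, hS : (S : ℝ≥0∞) = firstSwitch (path ξ J ω)⟩ := WithTop.ne_top_iff_exists.1 hS
    rw [switchWeight, ← hS, if_neg ENNReal.coe_ne_top, ENNReal.toNNReal_coe, path_apply]
    by_cases hb : ξ S ω = ⊥
    · simp [hb]
    have ht := tendsto_gridPoint_gridIndex S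
    have h1 := ((h.rightCts_path ω).tendsto_killedExp z S).comp ht
    rw [← path_apply (J := J), ← h1.liminf_eq]
    refine liminf_le_liminf ?_
    have h2 := ht.eventually (h.rightCts_snd S ω)
    have h3 := ht.eventually ((h.rightCts_fst S ω).eventually (isOpen_ne.mem_nhds hb))
    filter_upwards [h2, h3] with n hn2 hn3
    have e : gridIndex n S = gridIndex n S - 1 + 1 := by simp [gridIndex]
    have hcell : ω ∈ path ξ J ⁻¹' switchCell n (gridIndex n S - 1) :=
      (mem_switchCell_iff hS.symm n _).2 e.symm
    have hmem : ω ∈ aliveIn ξ J (-i) (gridPoint n (gridIndex n S - 1 + 1)) :=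
      ⟨by rw [← e, hn2]; exact h.snd_firstSwitch_eq_neg hω.2 hS.symm, by rwa [← e]⟩
    refine le_trans ?_ (ENNReal.le_tsum (gridIndex n S - 1))
    rw [Set.indicator_of_mem hmem]
    simp only [hfdef]
    rw [Set.indicator_of_mem hcell, ← e]
    exact le_rfl
  refine lt_of_le_of_lt ?_ hHlt
  rcases eq_or_ne m 0 with hm0 | hm0
  · simp [hm0]
  by_cases hm1 : m = ∞
  -- Only the moment from `i` is assumed finite. An infinite moment from `-i` forces all discretised
  -- weights to have mean zero, and the product is `0 * ∞ = 0`.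
  · have hG0 : ∀ n, ∫⁻ ω, G n ω ∂(P 0 i) = 0 := by
      intro n
      by_contra hne
      have := (hle n).trans_lt (hHlt.trans hm.lt_top)
      rw [hm1, ENNReal.mul_top hne] at this
      exact lt_irrefl _ this
    have : ∫⁻ ω, switchWeight z (path ξ J ω) ∂(P 0 i) ≤ 0 := by
      refine (lintegral_mono_ae hlim).trans ((lintegral_liminf_le hG).trans ?_)
      simp [hG0]
    rw [nonpos_iff_eq_zero.1 this]
    simp
  rw [← ENNReal.le_div_iff_mul_le (Or.inl hm0) (Or.inl hm1)]
  refine (lintegral_mono_ae hlim).trans ((lintegral_liminf_le hG).trans ?_)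
  refine (liminf_le_liminf (Eventually.of_forall fun n =>
    (ENNReal.le_div_iff_mul_le (Or.inl hm0) (Or.inl hm1)).2 (hle n))).trans ?_
  simp

/-- Necessary conditions for finite moments of the exponential functional. -/
lemma moments_lt_of_lintegral_lt_top {α s : ℝ} (hs : 0 < s)
    (hm : ∀ i, ∫⁻ ω, totalIntegral α (path ξ J ω) ^ s ∂(P 0 i) < ∞) :
    (∀ i, sojournMoment ξ J P i (α * s) 1 < 1) ∧
      (∀ i, ∫⁻ ω, switchWeight (α * s) (path ξ J ω) ∂(P 0 i) < ∞) ∧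
      (∫⁻ ω, switchWeight (α * s) (path ξ J ω) ∂(P 0 1)) *
        ∫⁻ ω, switchWeight (α * s) (path ξ J ω) ∂(P 0 (-1)) < 1 := by
  set m : ℤˣ → ℝ≥0∞ := fun i => ∫⁻ ω, totalIntegral α (path ξ J ω) ^ s ∂(P 0 i)
  set K : ℤˣ → ℝ≥0∞ := fun i => ∫⁻ ω, switchWeight (α * s) (path ξ J ω) ∂(P 0 i)
  have h1 : ∀ i, sojournMoment ξ J P i (α * s) 1 * m i < m i := fun i =>
    h.sojournMoment_mul_lt hs (hm i).ne
  have h2 : ∀ i, K i * m (-i) < m i := fun i => h.switchWeight_mul_le hs (hm i).ne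
  have h0 : ∀ i, m i ≠ 0 := fun i => (zero_le.trans_lt (h1 i)).ne'
  refine ⟨fun i => ?_, fun i => ?_, ?_⟩
  · by_contra hge
    exact absurd (h1 i) (not_lt.2 (by simpa using mul_le_mul_left (not_lt.1 hge) (m i)))
  · refine lt_top_iff_ne_top.2 fun htop => ?_
    have := h2 i
    rw [show K i = ∞ from htop, ENNReal.top_mul (h0 (-i))] at this
    exact not_top_lt this
  · by_contra hge
    have h3 : m 1 ≤ K 1 * K (-1) * m 1 := by
      simpa using mul_le_mul_left (not_lt.1 hge) (m 1)
    have h4 := h2 (-1)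
    rw [neg_neg] at h4
    rw [mul_assoc] at h3
    exact absurd ((h3.trans (mul_le_mul_right h4.le _)).trans_lt (h2 1)) (lt_irrefl _)

end

end IsMAP

/-! ### Sufficiency: summing over sojourns -/

lemma tendsto_lintegral_Ioi_zero {f : ℝ≥0 → ℝ≥0∞} (hf : Measurable f) :
    Tendsto (fun r => ∫⁻ u in Set.Ioi r, f u ∂timeMeasure) (𝓝[>] 0)
      (𝓝 (∫⁻ u, f u ∂timeMeasure)) := by
  refine tendsto_of_seq_tendsto fun r hr => ?_
  refine tendsto_of_le_liminf_of_limsup_le ?_ ?_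
  · simp only [← lintegral_indicator measurableSet_Ioi]
    refine le_trans ?_ (lintegral_liminf_le fun n => hf.indicator measurableSet_Ioi)
    have h0 : ∀ᵐ u ∂timeMeasure, u ≠ 0 := by
      rw [ae_iff]
      simp
    refine lintegral_mono_ae ?_
    filter_upwards [h0] with u hu
    refine (Tendsto.liminf_eq (tendsto_const_nhds.congr' ?_)).ge
    filter_upwards [(hr.mono_right nhdsWithin_le_nhds).eventually
      (gt_mem_nhds (pos_iff_ne_zero.2 hu))] with n hn
    rw [Set.indicator_of_mem (show u ∈ Set.Ioi (r n) from hn)]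
  · exact limsup_le_of_le (h := Eventually.of_forall fun n => setLIntegral_le_lintegral _ _)

lemma ENNReal.tendsto_of_mul_tendsto {ι : Type*} {l : Filter ι} {a b c : ι → ℝ≥0∞} {d : ℝ≥0∞}
    (ha : Tendsto a l (𝓝 1)) (hc : Tendsto c l (𝓝 d)) (h : ∀ᶠ r in l, c r = a r * b r) :
    Tendsto b l (𝓝 d) := by
  have := ENNReal.Tendsto.div hc (Or.inr one_ne_zero) ha (Or.inl ENNReal.one_ne_top)
  rw [div_one] at this
  refine this.congr' ?_
  filter_upwards [h, ha.eventually (lt_mem_nhds one_pos),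
    ha.eventually (gt_mem_nhds ENNReal.one_lt_top)] with r hr h0 h1
  rw [hr, mul_comm, ENNReal.mul_div_cancel_right h0.ne' h1.ne]

namespace MAPPath

/-- A jointly measurable version of the evaluation of a path. -/
def evalVersion (p : MAPPath × ℝ≥0) : EReal × ℤˣ :=
  open Classical in
  (liminf (fun n => (p.1 (gridPoint n (gridIndex n p.2))).1) atTop,
    if ∀ᶠ n in atTop, (p.1 (gridPoint n (gridIndex n p.2))).2 = 1 then 1 else -1)

lemma measurable_evalVersion : Measurable evalVersion := by
  have h1 : ∀ n, Measurable fun p : MAPPath × ℝ≥0 => p.1 (gridPoint n (gridIndex n p.2)) := by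
    intro n
    have h1 : Measurable fun q : MAPPath × ℕ => q.1 (gridPoint n q.2) :=
      measurable_from_prod_countable_left fun k => by
        exact measurable_pi_apply (gridPoint n k)
    exact h1.comp (measurable_fst.prodMk ((measurable_gridIndex n).comp measurable_snd))
  refine Measurable.prodMk (Measurable.liminf fun n => (h1 n).fst)
    (Measurable.ite ?_ measurable_const measurable_const)
  have e : {p : MAPPath × ℝ≥0 | ∀ᶠ n in atTop, (p.1 (gridPoint n (gridIndex n p.2))).2 = 1} =
      ⋃ N : ℕ, ⋂ (n : ℕ) (_ : N ≤ n), {p | (p.1 (gridPoint n (gridIndex n p.2))).2 = 1} := by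
    ext p
    simp [eventually_atTop]
  rw [e]
  exact MeasurableSet.iUnion fun N => MeasurableSet.iInter fun n => MeasurableSet.iInter fun _ =>
    (h1 n).snd (measurableSet_singleton 1)

lemma evalVersion_eq {x : MAPPath} (hx : RightCts x) (u : ℝ≥0) : evalVersion (x, u) = x u := by
  have ht := tendsto_gridPoint_gridIndex u
  have h2 := ht.eventually (hx.snd u)
  refine Prod.ext ((hx.fst u).comp ht).liminf_eq ?_
  simp only [evalVersion]
  split_ifs with hev
  · obtain ⟨n, h3, h4⟩ := (hev.and h2).exists
    rw [← h4, h3]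
  · by_contra hne
    refine hev (h2.mono fun n hn => ?_)
    rw [hn]
    simpa using intUnits_ne_iff.1 (Ne.symm hne)

/-- The path after its first switch. -/
def afterSwitch (x : MAPPath) : MAPPath := shift (firstSwitch x).toNNReal x

lemma HasMeasurableVersion.afterSwitch {Φ : MAPPath → ℝ≥0∞} (hΦ : HasMeasurableVersion Φ) :
    HasMeasurableVersion fun x => Φ (afterSwitch x) := by
  obtain ⟨Ψ, hΨ, e⟩ := hΦ
  have hm : ∀ u : ℝ≥0, Measurable fun x : MAPPath =>
      evalVersion (x, (firstSwitch x).toNNReal + u) := fun u =>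
    measurable_evalVersion.comp (measurable_id.prodMk
      (measurable_firstSwitch.ennreal_toNNReal.add_const u))
  refine ⟨fun x => Ψ fun u => ((evalVersion (x, (firstSwitch x).toNNReal + u)).1 -
      (evalVersion (x, (firstSwitch x).toNNReal + 0)).1,
      (evalVersion (x, (firstSwitch x).toNNReal + u)).2), hΨ.comp ?_, fun x hx => ?_⟩
  · exact measurable_pi_lambda _ fun u => ((hm u).fst.sub (hm 0).fst).prodMk (hm u).snd
  · simp only [evalVersion_eq hx, add_zero, MAPPath.afterSwitch, e _ (hx.shift _)]
    rfl

lemma HasMeasurableVersion.mul {Φ Φ' : MAPPath → ℝ≥0∞} (hΦ : HasMeasurableVersion Φ)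
    (hΦ' : HasMeasurableVersion Φ') : HasMeasurableVersion fun x => Φ x * Φ' x := by
  obtain ⟨Ψ, hΨ, e⟩ := hΦ
  obtain ⟨Ψ', hΨ', e'⟩ := hΦ'
  exact ⟨fun x => Ψ x * Ψ' x, hΨ.mul hΨ', fun x hx => by simp only [e x hx, e' x hx]⟩

lemma HasMeasurableVersion.add {Φ Φ' : MAPPath → ℝ≥0∞} (hΦ : HasMeasurableVersion Φ)
    (hΦ' : HasMeasurableVersion Φ') : HasMeasurableVersion fun x => Φ x + Φ' x := by
  obtain ⟨Ψ, hΨ, e⟩ := hΦ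
  obtain ⟨Ψ', hΨ', e'⟩ := hΦ'
  exact ⟨fun x => Ψ x + Ψ' x, hΨ.add hΨ', fun x hx => by simp only [e x hx, e' x hx]⟩

/-- The functional is right-continuous at time `0` along the shifts of a path. -/
def RightRegular (Φ : MAPPath → ℝ≥0∞) : Prop :=
  ∀ x, RightCts x → (x 0).1 = 0 → Tendsto (fun r => Φ (shift r x)) (𝓝[>] 0) (𝓝 (Φ x))

lemma eventually_lt_firstSwitch {x : MAPPath} (hx : RightCts x) :
    ∀ᶠ r : ℝ≥0 in 𝓝[>] 0, (r : ℝ≥0∞) < firstSwitch x :=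
  nhdsWithin_le_nhds ((ENNReal.continuous_coe.tendsto 0).eventually
    (gt_mem_nhds (by simpa using firstSwitch_pos hx)))

/-- The tail after `r` is the weight at `r` times the functional of the shifted path. As `r`
decreases to `0` the tail tends to the whole and the weight to one; no finiteness is needed. -/
lemma rightRegular_sojournIntegral_rpow (α s : ℝ) :
    RightRegular fun x => sojournIntegral α x ^ s := by
  intro x hx h0
  refine ((ENNReal.continuous_rpow_const (y := s)).tendsto _).comp ?_
  have h1 := tendsto_sojourn hx α 0
  rw [sojourn, ENNReal.coe_zero, if_pos (firstSwitch_pos hx), h0, killedExp_zero_right] at h1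
  exact ENNReal.tendsto_of_mul_tendsto h1
    (tendsto_lintegral_Ioi_zero (measurable_sojourn_path hx α))
    (Eventually.of_forall fun r => lintegral_Ioi_sojourn hx α r)

lemma switchWeight_mul_eq {x : MAPPath} (hx : RightCts x) (z : ℝ) (Φ : MAPPath → ℝ≥0∞) {r : ℝ≥0}
    (hr : (r : ℝ≥0∞) < firstSwitch x) : switchWeight z x * Φ (afterSwitch x) =
      killedExp z (x r).1 * (switchWeight z (shift r x) * Φ (afterSwitch (shift r x))) := by
  have hadd := firstSwitch_eq_add hx hr
  by_cases hv : firstSwitch (shift r x) = ∞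
  · have hx' : firstSwitch x = ∞ := by rw [hadd, hv]; simp
    simp [switchWeight, hv, hx']
  · obtain ⟨v, hv⟩ : ∃ v : ℝ≥0, (v : ℝ≥0∞) = firstSwitch (shift r x) :=
      WithTop.ne_top_iff_exists.1 hv
    have hS : firstSwitch x = (r + v : ℝ≥0) := by rw [hadd, ← hv, ENNReal.coe_add]
    simp only [switchWeight, afterSwitch, hS, ← hv, ENNReal.coe_ne_top, if_false,
      ENNReal.toNNReal_coe]
    by_cases hb : (x (r + v)).1 = ⊥
    · rw [← mul_assoc, ← killedExp_add_time hx, hb]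
      simp
    · rw [shift_shift hx r v (fun H => hb (hx.absorbed _ _ le_self_add H)) hb, ← mul_assoc,
        ← killedExp_add_time hx]

/-- No regularity of `Φ` is required: a shift to a time before the first switch does not alter the
path after the switch, provided it is still alive there, and only divides the weight by a factor
tending to one. -/
lemma RightRegular.switchWeight_mul (z : ℝ) (Φ : MAPPath → ℝ≥0∞) :
    RightRegular fun x => switchWeight z x * Φ (afterSwitch x) := by
  intro x hx h0
  have h1 := hx.tendsto_killedExp z 0
  rw [h0, killedExp_zero_right] at h1
  refine ENNReal.tendsto_of_mul_tendsto h1 tendsto_const_nhds ?_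
  filter_upwards [eventually_lt_firstSwitch hx] with r hr
  exact switchWeight_mul_eq hx z Φ hr

lemma RightRegular.add {Φ Φ' : MAPPath → ℝ≥0∞} (hΦ : RightRegular Φ) (hΦ' : RightRegular Φ') :
    RightRegular fun x => Φ x + Φ' x := fun x hx h0 => (hΦ x hx h0).add (hΦ' x hx h0)

/-- The sum over the first `N` sojourns of the `s`-th powers of the exponential functionals. -/
def sojournSum (α s : ℝ) : ℕ → MAPPath → ℝ≥0∞
  | 0, _ => 0
  | N + 1, x => sojournIntegral α x ^ s + switchWeight (α * s) x * sojournSum α s N (afterSwitch x)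

/-- The time of the `N`-th switch. -/
def nthSwitch : ℕ → MAPPath → ℝ≥0∞
  | 0, _ => 0
  | N + 1, x => firstSwitch x + nthSwitch N (afterSwitch x)

lemma hasMeasurableVersion_sojournSum (α s : ℝ) (N : ℕ) :
    HasMeasurableVersion (sojournSum α s N) := by
  induction N with
  | zero => exact (measurable_const (a := (0 : ℝ≥0∞))).hasMeasurableVersion
  | succ N ih =>
    exact ((hasMeasurableVersion_sojournIntegral α).rpow s).add
      ((hasMeasurableVersion_switchWeight _).mul ih.afterSwitch)

lemma rightRegular_sojournSum (α s : ℝ) (N : ℕ) : RightRegular (sojournSum α s N) := by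
  cases N with
  | zero => exact fun x _ _ => tendsto_const_nhds
  | succ N =>
    exact (rightRegular_sojournIntegral_rpow α s).add
      (RightRegular.switchWeight_mul (α * s) (sojournSum α s N))

lemma sojournSum_mono (α s : ℝ) : Monotone (sojournSum α s) := by
  refine monotone_nat_of_le_succ fun N => ?_
  induction N with
  | zero => exact fun x => zero_le
  | succ N ih => exact fun x => add_le_add_right (mul_le_mul_right (ih _) _) _

lemma nthSwitch_mono : Monotone nthSwitch := by
  refine monotone_nat_of_le_succ fun N => ?_
  induction N with
  | zero => exact fun x => zero_le
  | succ N ih => exact fun x => add_le_add_right (ih _) _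

/-- Splitting at the first switch, subadditivity of the power `s ≤ 1` separates the two parts; the
second is the weight at the switch times the same quantity for the path after it. -/
lemma rpow_lintegral_nthSwitch_le (α : ℝ) {s : ℝ} (hs : 0 < s) (hs1 : s ≤ 1) (N : ℕ) :
    ∀ x, RightCts x → (∫⁻ u in {u : ℝ≥0 | (u : ℝ≥0∞) < nthSwitch N x},
      killedExp α (x u).1 ∂timeMeasure) ^ s ≤ sojournSum α s N x := by
  have hmeas : ∀ c : ℝ≥0∞, MeasurableSet {u : ℝ≥0 | (u : ℝ≥0∞) < c} := fun c =>
    measurableSet_lt measurable_coe_nnreal_ennreal measurable_const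
  induction N with
  | zero => simp [nthSwitch, hs]
  | succ N ih =>
    intro x hx
    by_cases hS : firstSwitch x = ∞
    · refine le_add_right (ENNReal.rpow_le_rpow ((setLIntegral_le_lintegral _ _).trans
        (lintegral_mono fun u => ?_)) hs.le)
      simp [sojourn, hS]
    · obtain ⟨S, hS⟩ : ∃ S : ℝ≥0, (S : ℝ≥0∞) = firstSwitch x := WithTop.ne_top_iff_exists.1 hS
      set T := nthSwitch (N + 1) x with hT
      have hafter : afterSwitch x = shift S x := by rw [afterSwitch, ← hS, ENNReal.toNNReal_coe]
      have hTS : T = S + nthSwitch N (shift S x) := by rw [hT, nthSwitch, ← hS, hafter]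
      have h1 : ∫⁻ u in Set.Iic S, killedExp α (x u).1 ∂timeMeasure ≤ sojournIntegral α x := by
        rw [← setLIntegral_congr (Iio_ae_eq_Iic (μ := timeMeasure) (a := S))]
        refine le_trans (setLIntegral_mono' measurableSet_Iio fun u hu => ?_)
          (setLIntegral_le_lintegral _ _)
        rw [sojourn, if_pos (by rw [← hS]; exact_mod_cast hu)]
      have h2 : ∫⁻ u in Set.Ioi S, {u : ℝ≥0 | (u : ℝ≥0∞) < T}.indicator
          (fun u => killedExp α (x u).1) u ∂timeMeasure = killedExp α (x S).1 *
          ∫⁻ u in {u : ℝ≥0 | (u : ℝ≥0∞) < nthSwitch N (shift S x)},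
            killedExp α (shift S x u).1 ∂timeMeasure := by
        rw [← lintegral_timeMeasure_shift S ((measurable_level_path hx α).indicator (hmeas T)),
          ← lintegral_indicator (hmeas _), ← lintegral_const_mul _
            ((measurable_level_path (hx.shift S) α).indicator (hmeas _))]
        refine lintegral_congr fun u => ?_
        have hiff : ((S + u : ℝ≥0) : ℝ≥0∞) < T ↔ (u : ℝ≥0∞) < nthSwitch N (shift S x) := by
          rw [hTS, ENNReal.coe_add, ENNReal.add_lt_add_iff_left ENNReal.coe_ne_top]
        simp only [Set.indicator_apply, Set.mem_ofPred_eq, hiff]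
        split_ifs
        · exact killedExp_add_time hx α S u
        · simp
      have h3 : ∫⁻ u in {u : ℝ≥0 | (u : ℝ≥0∞) < T}, killedExp α (x u).1 ∂timeMeasure ≤
          sojournIntegral α x + killedExp α (x S).1 *
            ∫⁻ u in {u : ℝ≥0 | (u : ℝ≥0∞) < nthSwitch N (shift S x)},
              killedExp α (shift S x u).1 ∂timeMeasure := by
        rw [← h2, ← lintegral_indicator (hmeas T),
          ← lintegral_add_compl _ (measurableSet_Iic (a := S)), Set.compl_Iic]
        refine add_le_add_left (le_trans (lintegral_mono fun u => ?_) h1) _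
        exact Set.indicator_le_self _ _ _
      refine (ENNReal.rpow_le_rpow h3 hs.le).trans
        ((ENNReal.rpow_add_le_add_rpow _ _ hs.le hs1).trans (add_le_add_right ?_ _))
      rw [ENNReal.mul_rpow_of_nonneg _ _ hs.le, killedExp_rpow α hs, switchWeight, ← hS,
        if_neg ENNReal.coe_ne_top, ENNReal.toNNReal_coe, hafter]
      exact mul_le_mul_right (ih _ (hx.shift S)) _

lemma nthSwitch_succ_ne_top (N : ℕ) : ∀ x, RightCts x → nthSwitch (N + 1) x ≠ ∞ →
    ∃ a b : ℝ≥0, nthSwitch N x = a ∧ nthSwitch (N + 1) x = b ∧ a < b ∧ (x a).2 ≠ (x b).2 := by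
  induction N with
  | zero =>
    intro x hx hT
    simp only [nthSwitch, add_zero] at hT ⊢
    obtain ⟨S, hS⟩ : ∃ S : ℝ≥0, (S : ℝ≥0∞) = firstSwitch x := WithTop.ne_top_iff_exists.1 hT
    refine ⟨0, S, by simp, hS.symm, ?_, (snd_firstSwitch_ne hx hS.symm).symm⟩
    have := firstSwitch_pos hx
    rw [← hS] at this
    exact_mod_cast this
  | succ N ih =>
    intro x hx hT
    rw [nthSwitch] at hT
    obtain ⟨h1, h2⟩ := ENNReal.add_ne_top.1 hT
    obtain ⟨S, hS⟩ : ∃ S : ℝ≥0, (S : ℝ≥0∞) = firstSwitch x := WithTop.ne_top_iff_exists.1 h1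
    have hafter : afterSwitch x = shift S x := by rw [afterSwitch, ← hS, ENNReal.toNNReal_coe]
    rw [hafter] at h2
    obtain ⟨a, b, ha, hb, hab, hne⟩ := ih _ (hx.shift S) h2
    refine ⟨S + a, S + b, ?_, ?_, add_lt_add_right hab S, hne⟩
    · rw [nthSwitch, hafter, ha, ← hS, ENNReal.coe_add]
    · rw [nthSwitch, hafter, hb, ← hS, ENNReal.coe_add]

/-- Near a finite accumulation point of switches the left limit of the state would make it constant,
contradicting the change of state between consecutive switches. -/
lemma iSup_nthSwitch {x : MAPPath} (hx : RightCts x)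
    (hleft : ∀ t, ∃ j : ℤˣ, ∀ᶠ u in 𝓝[<] t, (x u).2 = j) : ⨆ N, nthSwitch N x = ∞ := by
  by_contra hne
  obtain ⟨L, hL⟩ : ∃ L : ℝ≥0, (L : ℝ≥0∞) = ⨆ N, nthSwitch N x := WithTop.ne_top_iff_exists.1 hne
  have hle : ∀ N, nthSwitch N x ≤ L := fun N => hL ▸ le_iSup (fun N => nthSwitch N x) N
  have hfin : ∀ N, nthSwitch N x ≠ ∞ := fun N => ((hle N).trans_lt ENNReal.coe_lt_top).ne
  have hstep := fun N => nthSwitch_succ_ne_top N x hx (hfin (N + 1))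
  obtain ⟨j, hj⟩ := hleft L
  have hpos : 0 < L := by
    obtain ⟨a, b, _, hb, hab, _⟩ := hstep 0
    have := hle 1
    rw [hb] at this
    exact (zero_le.trans_lt hab).trans_le (by exact_mod_cast this)
  obtain ⟨l, hl, hl'⟩ := (mem_nhdsLT_iff_exists_Ioo_subset' hpos).1 hj
  have hlt : (l : ℝ≥0∞) < ⨆ N, nthSwitch N x := by
    rw [← hL]
    exact_mod_cast hl
  obtain ⟨N, hN⟩ := lt_iSup_iff.1 hlt
  obtain ⟨a, b, ha, hb, hab, hne'⟩ := hstep N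
  -- A further switch ensures `b < L`, so that both `a` and `b` lie in the open interval.
  obtain ⟨b', c, hb', hc, hbc, _⟩ := hstep (N + 1)
  have hla : l < a := by rw [ha] at hN; exact_mod_cast hN
  have hbL : b < L := by
    rw [hb] at hb'
    have e : b = b' := by exact_mod_cast hb'
    have := hle (N + 1 + 1)
    rw [hc] at this
    rw [e]
    exact hbc.trans_le (by exact_mod_cast this)
  have h1 : (x a).2 = j := hl' ⟨hla, hab.trans hbL⟩
  have h2 : (x b).2 = j := hl' ⟨hla.trans hab, hbL⟩
  exact hne' (h1.trans h2.symm)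

lemma totalIntegral_rpow_le {x : MAPPath} (hx : RightCts x)
    (hleft : ∀ t, ∃ j : ℤˣ, ∀ᶠ u in 𝓝[<] t, (x u).2 = j) (α : ℝ) {s : ℝ} (hs : 0 < s)
    (hs1 : s ≤ 1) : totalIntegral α x ^ s ≤ ⨆ N, sojournSum α s N x := by
  have hmeas : ∀ c : ℝ≥0∞, MeasurableSet {u : ℝ≥0 | (u : ℝ≥0∞) < c} := fun c =>
    measurableSet_lt measurable_coe_nnreal_ennreal measurable_const
  rw [← ENNReal.le_rpow_inv_iff hs]
  have e : totalIntegral α x = ∫⁻ u, ⨆ N, {u : ℝ≥0 | (u : ℝ≥0∞) < nthSwitch N x}.indicator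
      (fun u => killedExp α (x u).1) u ∂timeMeasure := by
    refine lintegral_congr fun u => le_antisymm ?_ (iSup_le fun N => Set.indicator_le_self _ _ _)
    have : (u : ℝ≥0∞) < ⨆ N, nthSwitch N x := by
      rw [iSup_nthSwitch hx hleft]
      exact ENNReal.coe_lt_top
    obtain ⟨N, hN⟩ := lt_iSup_iff.1 this
    refine le_iSup_of_le N ?_
    rw [Set.indicator_of_mem (show u ∈ {u : ℝ≥0 | (u : ℝ≥0∞) < nthSwitch N x} from hN)]
  rw [e, lintegral_iSup (fun N => (measurable_level_path hx α).indicator (hmeas _))]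
  · refine iSup_le fun N => ?_
    rw [lintegral_indicator (hmeas _), ENNReal.le_rpow_inv_iff hs]
    exact (rpow_lintegral_nthSwitch_le α hs hs1 N x hx).trans
      (le_iSup (fun N => sojournSum α s N x) N)
  · intro M N hMN u
    beta_reduce
    by_cases hu : (u : ℝ≥0∞) < nthSwitch M x
    · have hu' := hu.trans_le (nthSwitch_mono hMN x)
      simp only [Set.indicator_apply, Set.mem_ofPred_eq, hu, hu', if_true, le_refl]
    · rw [Set.indicator_of_notMem (show u ∉ {u : ℝ≥0 | (u : ℝ≥0∞) < nthSwitch M x} from hu)]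
      exact zero_le

end MAPPath

namespace IsMAP

open MAPPath

variable {Ω : Type*} [mΩ : MeasurableSpace Ω] {𝓖 : Filtration ℝ≥0 mΩ}
  {ξ : ℝ≥0 → Ω → EReal} {J : ℝ≥0 → Ω → ℤˣ} {P : ℝ → ℤˣ → Measure Ω}

section
variable (h : IsMAP 𝓖 ξ J P)
include h

/-- The approximating times are capped at `t`, so only the past of `t` enters; since the switch
occurs strictly before `t`, the cap is inactive for fine meshes. -/
lemma measurable_switchWeight_adapted (z : ℝ) (t : ℝ≥0) : Measurable[𝓖 t]
    ({ω | firstSwitch (path ξ J ω) < t}.indicator fun ω => switchWeight z (path ξ J ω)) := by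
  set A : Set Ω := {ω | firstSwitch (path ξ J ω) < t}
  have e : (A.indicator fun ω => switchWeight z (path ξ J ω)) = fun ω =>
      liminf (fun m => ∑' l, (path ξ J ⁻¹' switchCell m l ∩ A).indicator
        (fun ω => killedExp z (ξ (min (gridPoint m (l + 1)) t) ω)) ω) atTop := by
    funext ω
    by_cases hA : ω ∈ A
    · have hfin : firstSwitch (path ξ J ω) ≠ ∞ := (lt_of_lt_of_le hA le_top).ne
      obtain ⟨S, hS⟩ : ∃ S : ℝ≥0, (S : ℝ≥0∞) = firstSwitch (path ξ J ω) :=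
        WithTop.ne_top_iff_exists.1 hfin
      have hSt : S < t := by
        have : firstSwitch (path ξ J ω) < t := hA
        rw [← hS] at this
        exact_mod_cast this
      rw [Set.indicator_of_mem hA, switchWeight, ← hS, if_neg ENNReal.coe_ne_top,
        ENNReal.toNNReal_coe]
      have ht := tendsto_gridPoint_gridIndex S
      refine (((h.rightCts_path ω).tendsto_killedExp z S).comp ht).congr' ?_ |>.liminf_eq.symm
      filter_upwards [(ht.mono_right nhdsWithin_le_nhds).eventually (gt_mem_nhds hSt)] with m hm
      have e1 : gridIndex m S = gridIndex m S - 1 + 1 := by simp [gridIndex]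
      rw [tsum_switchCell (F := fun l => (path ξ J ⁻¹' switchCell m l ∩ A).indicator
        (fun ω => killedExp z (ξ (min (gridPoint m (l + 1)) t) ω)) ω) hS.symm m
        fun k hk => Set.indicator_of_notMem (fun H => hk H.1) _]
      have hmem : ω ∈ path ξ J ⁻¹' switchCell m (gridIndex m S - 1) ∩ A :=
        ⟨(mem_switchCell_iff hS.symm m _).2 e1.symm, hA⟩
      rw [Set.indicator_of_mem hmem, ← e1, min_eq_left hm.le]
      rfl
    · rw [Set.indicator_of_notMem hA]
      have : ∀ m l, (path ξ J ⁻¹' switchCell m l ∩ A).indicator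
          (fun ω => killedExp z (ξ (min (gridPoint m (l + 1)) t) ω)) ω = 0 := fun m l =>
        Set.indicator_of_notMem (fun H => hA H.2) _
      simp [this]
  rw [e]
  exact Measurable.liminf fun m => Measurable.ennreal_tsum fun l =>
    ((measurable_killedExp z).comp ((h.measurable_fst _).mono (𝓖.mono (min_le_right _ _))
      le_rfl)).indicator (h.measurableSet_switchCell_inter m l t)

/-- The Markov property at the first switch, as an inequality. -/
lemma lintegral_switchWeight_mul_le (z : ℝ) (i : ℤˣ) {Φ : MAPPath → ℝ≥0∞}
    (hΦ : HasMeasurableVersion Φ) (hreg : RightRegular Φ) :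
    ∫⁻ ω, switchWeight z (path ξ J ω) * Φ (afterSwitch (path ξ J ω)) ∂(P 0 i) ≤
      (∫⁻ ω, switchWeight z (path ξ J ω) ∂(P 0 i)) * ∫⁻ ω, Φ (path ξ J ω) ∂(P 0 (-i)) := by
  -- The exact weight at the switch is kept, being known at the right end of the cell, and only the
  -- argument of `Φ` is discretised. This gives the upper bound `hle` pointwise.
  set f : ℕ → ℕ → Ω → ℝ≥0∞ := fun n k =>
    (path ξ J ⁻¹' switchCell n k).indicator fun ω => switchWeight z (path ξ J ω) with hfdef
  have hf : ∀ n k, Measurable[𝓖 (gridPoint n (k + 1))] (f n k) := by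
    intro n k
    have := (h.measurable_switchWeight_adapted z (gridPoint n (k + 1))).indicator
      (h.measurableSet_switchCell n k)
    rwa [Set.indicator_indicator, Set.inter_eq_left.2 fun ω hω => hω.2] at this
  have hle : ∀ n ω, ∑' k, (aliveIn ξ J (-i) (gridPoint n (k + 1))).indicator (f n k) ω ≤
      switchWeight z (path ξ J ω) := by
    intro n ω
    refine (ENNReal.tsum_le_tsum fun k => Set.indicator_le_self _ _ _).trans ?_
    by_cases hS : firstSwitch (path ξ J ω) = ∞
    · simp [hfdef, Set.indicator_of_notMem (s := path ξ J ⁻¹' switchCell n _)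
        (notMem_switchCell hS n _)]
    obtain ⟨S, hS⟩ : ∃ S : ℝ≥0, (S : ℝ≥0∞) = firstSwitch (path ξ J ω) :=
      WithTop.ne_top_iff_exists.1 hS
    rw [tsum_switchCell (F := fun k => f n k ω) hS.symm n fun k hk => Set.indicator_of_notMem
        (s := path ξ J ⁻¹' switchCell n k) hk _]
    exact Set.indicator_le_self _ _ _
  set G : ℕ → Ω → ℝ≥0∞ := fun n ω => ∑' k, (aliveIn ξ J (-i) (gridPoint n (k + 1))).indicator
    (f n k) ω * Φ (shift (gridPoint n (k + 1)) (path ξ J ω))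
  have hG : ∀ n, Measurable (G n) := fun n => Measurable.tsum fun k =>
    (((hf n k).mono (𝓖.le _) le_rfl).indicator (𝓖.le _ _ (h.measurableSet_aliveIn _ _))).mul
      (h.measurable_comp_shift_path hΦ _)
  have hGle : ∀ n, ∫⁻ ω, G n ω ∂(P 0 i) ≤
      (∫⁻ ω, switchWeight z (path ξ J ω) ∂(P 0 i)) * ∫⁻ ω, Φ (path ξ J ω) ∂(P 0 (-i)) := by
    intro n
    rw [h.lintegral_tsum_markov 0 i (-i) (fun k => gridPoint n (k + 1)) (hf n) hΦ]
    exact mul_le_mul_left (lintegral_mono (hle n)) _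
  have hlim : ∀ᵐ ω ∂(P 0 i), switchWeight z (path ξ J ω) * Φ (afterSwitch (path ξ J ω)) ≤
      liminf (fun n => G n ω) atTop := by
    filter_upwards [h.ae_start i] with ω hω
    by_cases hS : firstSwitch (path ξ J ω) = ∞
    · simp [switchWeight, hS]
    obtain ⟨S, hS⟩ : ∃ S : ℝ≥0, (S : ℝ≥0∞) = firstSwitch (path ξ J ω) :=
      WithTop.ne_top_iff_exists.1 hS
    have hw : switchWeight z (path ξ J ω) = killedExp z (ξ S ω) := by
      rw [switchWeight, ← hS, if_neg ENNReal.coe_ne_top, ENNReal.toNNReal_coe, path_apply]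
    by_cases hb : ξ S ω = ⊥
    · simp [hw, hb]
    have hx := h.rightCts_path ω
    have hy0 : (shift S (path ξ J ω) 0).1 = 0 := by
      have h1 := h.ne_top S ω
      simp only [shift, add_zero, path_apply]
      lift ξ S ω to ℝ using ⟨h1, hb⟩ with a
      rw [← EReal.coe_sub]
      simp
    have ht := tendsto_gridPoint_gridIndex S
    have hr : Tendsto (fun n => gridPoint n (gridIndex n S) - S) atTop (𝓝[>] 0) := by
      refine tendsto_nhdsWithin_iff.2 ⟨?_, Eventually.of_forall fun n =>
        tsub_pos_of_lt (lt_gridPoint_gridIndex n S)⟩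
      simpa using (ht.mono_right nhdsWithin_le_nhds).sub (tendsto_const_nhds (x := S))
    have h1 := ENNReal.Tendsto.const_mul (a := switchWeight z (path ξ J ω))
      ((hreg _ (hx.shift S) hy0).comp hr) (Or.inr (by rw [hw]; exact killedExp_ne_top _ _))
    rw [afterSwitch, ← hS, ENNReal.toNNReal_coe, ← h1.liminf_eq]
    refine liminf_le_liminf ?_
    have h2 := ht.eventually (h.rightCts_snd S ω)
    have h3 := ht.eventually ((h.rightCts_fst S ω).eventually (isOpen_ne.mem_nhds hb))
    filter_upwards [h2, h3] with n hn2 hn3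
    have e : gridIndex n S = gridIndex n S - 1 + 1 := by simp [gridIndex]
    have hcell : ω ∈ path ξ J ⁻¹' switchCell n (gridIndex n S - 1) :=
      (mem_switchCell_iff hS.symm n _).2 e.symm
    have hmem : ω ∈ aliveIn ξ J (-i) (gridPoint n (gridIndex n S - 1 + 1)) :=
      ⟨by rw [← e, hn2]; exact h.snd_firstSwitch_eq_neg hω.2 hS.symm, by rwa [← e]⟩
    refine le_trans ?_ (ENNReal.le_tsum (gridIndex n S - 1))
    have hadd : S + (gridPoint n (gridIndex n S) - S) = gridPoint n (gridIndex n S) :=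
      add_tsub_cancel_of_le (lt_gridPoint_gridIndex n S).le
    rw [Set.indicator_of_mem hmem]
    simp only [hfdef]
    rw [Set.indicator_of_mem hcell, ← e, Function.comp_apply, shift_shift hx S _ hb
      (by rw [hadd]; exact hn3), hadd]
  calc _ ≤ ∫⁻ ω, liminf (fun n => G n ω) atTop ∂(P 0 i) := lintegral_mono_ae hlim
    _ ≤ liminf (fun n => ∫⁻ ω, G n ω ∂(P 0 i)) atTop := lintegral_liminf_le hG
    _ ≤ liminf (fun _ => (∫⁻ ω, switchWeight z (path ξ J ω) ∂(P 0 i)) *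
        ∫⁻ ω, Φ (path ξ J ω) ∂(P 0 (-i))) atTop :=
      liminf_le_liminf (Eventually.of_forall hGle)
    _ = _ := liminf_const _

/-- Sufficient conditions for finite moments of the exponential functional. -/
lemma lintegral_totalIntegral_lt_top {α s : ℝ} (hs : 0 < s) (hs1 : s ≤ 1)
    (he : ∀ i, sojournMoment ξ J P i (α * s) 1 < 1)
    (hK : ∀ i, ∫⁻ ω, switchWeight (α * s) (path ξ J ω) ∂(P 0 i) < ∞)
    (hKK : (∫⁻ ω, switchWeight (α * s) (path ξ J ω) ∂(P 0 1)) *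
        ∫⁻ ω, switchWeight (α * s) (path ξ J ω) ∂(P 0 (-1)) < 1) (i : ℤˣ) :
    ∫⁻ ω, totalIntegral α (path ξ J ω) ^ s ∂(P 0 i) < ∞ := by
  set K : ℤˣ → ℝ≥0∞ := fun i => ∫⁻ ω, switchWeight (α * s) (path ξ J ω) ∂(P 0 i)
  set A : ℤˣ → ℝ≥0∞ := fun i => ∫⁻ ω, sojournIntegral α (path ξ J ω) ^ s ∂(P 0 i)
  have hA : ∀ i, A i < ∞ := fun i => (lintegral_mono fun ω =>
    rpow_sojournIntegral_le (h.rightCts_path ω) α hs hs1).trans_lt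
      (h.lintegral_sojournBound_lt_top (he i))
  have hr : ∀ i, K i * K (-i) < 1 := by
    intro i
    rcases Int.units_eq_one_or i with rfl | rfl
    · exact hKK
    · rw [neg_neg, mul_comm]; exact hKK
  -- This solves `C i = A i + K i * C (-i)`, the fixed-point equation of the recursion satisfied by
  -- the bounds on the means of `sojournSum`.
  set C : ℤˣ → ℝ≥0∞ := fun i => (A i + K i * A (-i)) * (1 - K i * K (-i))⁻¹
  have hC : ∀ i, C i < ∞ := by
    intro i
    refine ENNReal.mul_lt_top (ENNReal.add_lt_top.2
      ⟨hA i, ENNReal.mul_lt_top (hK i) (hA (-i))⟩) ?_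
    exact ENNReal.inv_lt_top.2 (tsub_pos_of_lt (hr i))
  have hrec : ∀ i, A i + K i * C (-i) = C i := by
    intro i
    have hg : (1 - K i * K (-i))⁻¹ = 1 + K i * K (-i) * (1 - K i * K (-i))⁻¹ := by
      have := ENNReal.tsum_geometric (K i * K (-i))
      rw [tsum_eq_zero_add' ENNReal.summable] at this
      simpa only [pow_succ', ENNReal.tsum_mul_left, pow_zero, ENNReal.tsum_geometric]
        using this.symm
    simp only [C, neg_neg, mul_comm (K (-i)) (K i)]
    calc _ = A i * (1 + K i * K (-i) * (1 - K i * K (-i))⁻¹) +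
          K i * A (-i) * (1 - K i * K (-i))⁻¹ := by ring
      _ = _ := by rw [← hg]; ring
  have hbound : ∀ N i, ∫⁻ ω, sojournSum α s N (path ξ J ω) ∂(P 0 i) ≤ C i := by
    intro N
    induction N with
    | zero => simp [sojournSum]
    | succ N ih =>
      intro i
      simp only [sojournSum]
      rw [lintegral_add_left
        (h.measurable_comp_path ((hasMeasurableVersion_sojournIntegral α).rpow s)), ← hrec]
      refine add_le_add_right ((h.lintegral_switchWeight_mul_le _ i
        (hasMeasurableVersion_sojournSum α s N) (rightRegular_sojournSum α s N)).trans ?_) _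
      exact mul_le_mul_right (ih (-i)) _
  refine lt_of_le_of_lt ?_ (hC i)
  calc ∫⁻ ω, totalIntegral α (path ξ J ω) ^ s ∂(P 0 i)
      ≤ ∫⁻ ω, ⨆ N, sojournSum α s N (path ξ J ω) ∂(P 0 i) := lintegral_mono fun ω =>
        totalIntegral_rpow_le (h.rightCts_path ω) (fun t => h.leftLim_snd t ω) α hs hs1
    _ = ⨆ N, ∫⁻ ω, sojournSum α s N (path ξ J ω) ∂(P 0 i) := lintegral_iSup
        (fun N => h.measurable_comp_path (hasMeasurableVersion_sojournSum α s N))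
        fun M N hMN ω => sojournSum_mono α s hMN _
    _ ≤ C i := iSup_le fun N => hbound N i

end

end IsMAP

/-! ### Leading eigenvalues of two-state matrices -/

lemma Matrix.det_intUnits {R : Type*} [CommRing R] (M : Matrix ℤˣ ℤˣ R) :
    M.det = M 1 1 * M (-1) (-1) - M 1 (-1) * M (-1) 1 := by
  let e : Fin 2 ≃ ℤˣ := Equiv.ofBijective ![1, -1] (by decide)
  rw [← Matrix.det_submatrix_equiv_self e, Matrix.det_fin_two]
  rfl

/-- Nonnegative off-diagonal entries make the discriminant of the characteristic polynomial
nonnegative, so both eigenvalues are real. -/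
lemma Matrix.spectrum_intUnits (M : Matrix ℤˣ ℤˣ ℝ) (h12 : 0 ≤ M 1 (-1)) (h21 : 0 ≤ M (-1) 1) :
    Complex.re '' spectrum ℂ (M.map (fun x : ℝ => (x : ℂ))) =
      {(M 1 1 + M (-1) (-1) -
          √((M 1 1 - M (-1) (-1)) ^ 2 + 4 * (M 1 (-1) * M (-1) 1))) / 2,
        (M 1 1 + M (-1) (-1) +
          √((M 1 1 - M (-1) (-1)) ^ 2 + 4 * (M 1 (-1) * M (-1) 1))) / 2} := by
  set D := √((M 1 1 - M (-1) (-1)) ^ 2 + 4 * (M 1 (-1) * M (-1) 1)) with hD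
  have hD2 : (D : ℂ) ^ 2 = ((M 1 1 : ℂ) - M (-1) (-1)) ^ 2 + 4 * (M 1 (-1) * M (-1) 1) := by
    have : D ^ 2 = (M 1 1 - M (-1) (-1)) ^ 2 + 4 * (M 1 (-1) * M (-1) 1) :=
      Real.sq_sqrt (by positivity)
    exact_mod_cast congrArg (fun x : ℝ => (x : ℂ)) this
  have hne : (1 : ℤˣ) ≠ -1 := by decide
  have hspec : spectrum ℂ (M.map (fun x : ℝ => (x : ℂ))) =
      {(((M 1 1 + M (-1) (-1) - D) / 2 : ℝ) : ℂ), (((M 1 1 + M (-1) (-1) + D) / 2 : ℝ) : ℂ)} := by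
    ext l
    rw [spectrum.mem_iff, Matrix.isUnit_iff_isUnit_det, isUnit_iff_ne_zero, not_not,
      Matrix.det_intUnits, Set.mem_insert_iff, Set.mem_singleton_iff,
      ← sub_eq_zero (a := l), ← sub_eq_zero (a := l), ← mul_eq_zero]
    simp only [Matrix.sub_apply, Matrix.algebraMap_matrix_apply, Matrix.map_apply, if_true,
      if_neg hne, if_neg hne.symm]
    push_cast
    refine Eq.congr_left ?_
    simp only [Algebra.algebraMap_self, RingHom.id_apply]
    linear_combination (1 / 4 : ℂ) * hD2
  rw [hspec, Set.image_pair, Complex.ofReal_re, Complex.ofReal_re]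

/-- A two-state matrix with nonnegative off-diagonal entries has a negative leading eigenvalue
if and only if it is a nonsingular `M`-matrix up to sign. -/
lemma Matrix.sSup_re_spectrum_neg_iff (M : Matrix ℤˣ ℤˣ ℝ) (h12 : 0 ≤ M 1 (-1))
    (h21 : 0 ≤ M (-1) 1) : sSup (Complex.re '' spectrum ℂ (M.map (fun x : ℝ => (x : ℂ)))) < 0 ↔
      M 1 1 < 0 ∧ M (-1) (-1) < 0 ∧ M 1 (-1) * M (-1) 1 < M 1 1 * M (-1) (-1) := by
  rw [M.spectrum_intUnits h12 h21]
  set a := M 1 1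
  set d := M (-1) (-1)
  set p := M 1 (-1) * M (-1) 1
  have hp : 0 ≤ p := mul_nonneg h12 h21
  set D := √((a - d) ^ 2 + 4 * p) with hD
  have hD0 : 0 ≤ D := Real.sqrt_nonneg _
  have hD2 : D ^ 2 = (a - d) ^ 2 + 4 * p := Real.sq_sqrt (by positivity)
  rw [csSup_pair, max_eq_right (by linarith)]
  constructor
  · intro H
    -- Squaring `0 ≤ D < -(a + d)` gives `D ^ 2 < (a + d) ^ 2`, which is this inequality times four.
    have h1 : p < a * d := by nlinarith
    have h2 : 0 < a * d := hp.trans_lt h1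
    have h3 : a + d < 0 := by linarith
    rcases mul_pos_iff.1 h2 with ⟨h4, h5⟩ | ⟨h4, h5⟩
    · linarith
    · exact ⟨h4, h5, h1⟩
  · rintro ⟨h1, h2, h3⟩
    have : D < -(a + d) := by
      refine lt_of_pow_lt_pow_left₀ 2 (by linarith) ?_
      rw [hD2]
      nlinarith
    linarith

/-! ### The characteristics in terms of sojourn and switch moments -/

namespace IsMAP

open MAPPath

variable {Ω : Type*} [mΩ : MeasurableSpace Ω] {𝓖 : Filtration ℝ≥0 mΩ}
  {ξ : ℝ≥0 → Ω → EReal} {J : ℝ≥0 → Ω → ℤˣ} {P : ℝ → ℤˣ → Measure Ω}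

section
variable (h : IsMAP 𝓖 ξ J P)
include h

lemma levyMoment_eq (i : ℤˣ) (z : ℝ) : MAP.levyMoment ξ J P i z =
    (ENNReal.ofReal (stayProb ξ J P i 1))⁻¹ * sojournMoment ξ J P i z 1 := by
  have := h.isProbabilityMeasure 0 i
  have hae : {ω | ∀ u : ℝ≥0, u ≤ 1 → J u ω = i} =ᵐ[P 0 i]
      {ω | ((1 : ℝ≥0) : ℝ≥0∞) < firstSwitch (path ξ J ω)} := by
    filter_upwards [h.ae_start i] with ω hω
    refine propext (Iff.trans ?_ (h.lt_firstSwitch_path_iff ω 1).symm)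
    rw [hω.2]
    exact Iff.rfl
  have hm : MeasurableSet {ω | ((1 : ℝ≥0) : ℝ≥0∞) < firstSwitch (path ξ J ω)} :=
    𝓖.le 1 _ (h.measurableSet_lt_firstSwitch le_rfl)
  rw [MAP.levyMoment, ProbabilityTheory.cond, measure_congr hae, Measure.restrict_congr_set hae,
    lintegral_smul_measure, stayProb, ofReal_measureReal, sojournMoment, ← lintegral_indicator hm,
    smul_eq_mul]
  congr 1
  refine lintegral_congr fun ω => ?_
  simp only [sojourn, Set.indicator_apply, Set.mem_ofPred_eq, path_apply]

lemma levyMoment_lt_top_iff (i : ℤˣ) (z : ℝ) :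
    MAP.levyMoment ξ J P i z < ∞ ↔ sojournMoment ξ J P i z 1 < ∞ := by
  have hpos : (ENNReal.ofReal (stayProb ξ J P i 1))⁻¹ ≠ ∞ := by
    simpa using h.stayProb_one_pos i
  rw [h.levyMoment_eq]
  refine ⟨fun H => ?_, fun H => ENNReal.mul_lt_top hpos.lt_top H⟩
  exact ENNReal.lt_top_of_mul_ne_top_right H.ne (by simp)

/-- Conditioning on no switch adds `exitRate` to the logarithm of the moment, and the diagonal entry
of the intensity matrix takes it away again. -/
lemma matrixExponent_self {i : ℤˣ} {z : ℝ} (he : sojournMoment ξ J P i z 1 < ∞) :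
    MAP.matrixExponent ξ J P z i i = Real.log (sojournMoment ξ J P i z 1).toReal := by
  have h1 := h.stayProb_one_pos i
  have h2 : 0 < (sojournMoment ξ J P i z 1).toReal :=
    ENNReal.toReal_pos (h.sojournMoment_one_pos z i).ne' he.ne
  rw [MAP.matrixExponent, Matrix.add_apply, Matrix.diagonal_apply_eq, Matrix.hadamard_apply,
    h.rateMatrix_self, MAP.psi, h.levyMoment_eq, ENNReal.toReal_mul, ENNReal.toReal_inv,
    ENNReal.toReal_ofReal h1.le, Real.log_mul (inv_pos.2 h1).ne' h2.ne', Real.log_inv, exitRate,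
    MAP.jumpMatrix, Matrix.of_apply, MAP.jumpMoment, if_pos rfl, ENNReal.toReal_one]
  ring

lemma matrixExponent_neg (i : ℤˣ) (z : ℝ) : MAP.matrixExponent ξ J P z i (-i) =
    exitRate ξ J P i * (MAP.jumpMoment ξ J P i (-i) z).toReal := by
  have hi : i ≠ -i := by rcases Int.units_eq_one_or i with rfl | rfl <;> decide
  rw [MAP.matrixExponent, Matrix.add_apply, Matrix.diagonal_apply_ne _ hi, Matrix.hadamard_apply,
    h.rateMatrix_neg, MAP.jumpMatrix, Matrix.of_apply, zero_add]

lemma matrixExponent_neg_nonneg (i : ℤˣ) (z : ℝ) : 0 ≤ MAP.matrixExponent ξ J P z i (-i) := by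
  rw [h.matrixExponent_neg]
  exact mul_nonneg (h.exitRate_nonneg i) ENNReal.toReal_nonneg

lemma matrixExponent_self_neg_iff {i : ℤˣ} {z : ℝ} (he : sojournMoment ξ J P i z 1 < ∞) :
    MAP.matrixExponent ξ J P z i i < 0 ↔ sojournMoment ξ J P i z 1 < 1 := by
  rw [h.matrixExponent_self he,
    Real.log_neg_iff (ENNReal.toReal_pos (h.sojournMoment_one_pos z i).ne' he.ne),
    ← ENNReal.toReal_one, ENNReal.toReal_lt_toReal he.ne ENNReal.one_ne_top]

lemma lintegral_switchWeight_toReal {i : ℤˣ} {z : ℝ} (hz : 0 < z)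
    (he : sojournMoment ξ J P i z 1 < 1) :
    (∫⁻ ω, switchWeight z (path ξ J ω) ∂(P 0 i)).toReal =
      MAP.matrixExponent ξ J P z i (-i) / (-MAP.matrixExponent ξ J P z i i) := by
  have hlt := he.trans ENNReal.one_lt_top
  have hneg := (h.matrixExponent_self_neg_iff hlt).2 he
  rw [h.lintegral_switchWeight hz he, ENNReal.toReal_mul, ← h.matrixExponent_self hlt,
    ENNReal.toReal_ofReal (div_nonneg (h.exitRate_nonneg i) (by linarith)), h.matrixExponent_neg]
  ring

/-- The two quantities differ by a finite factor, which is positive unless the exit rate is zero; in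
that case both vanish. -/
lemma lintegral_switchWeight_lt_top_iff {i : ℤˣ} {z : ℝ} (hz : 0 < z)
    (he : sojournMoment ξ J P i z 1 < 1) :
    ∫⁻ ω, switchWeight z (path ξ J ω) ∂(P 0 i) < ∞ ↔ MAP.jumpMoment ξ J P i (-i) z < ∞ := by
  have hlt := he.trans ENNReal.one_lt_top
  have hneg := (h.matrixExponent_self_neg_iff hlt).2 he
  rw [h.lintegral_switchWeight hz he, ← h.matrixExponent_self hlt]
  rcases (h.exitRate_nonneg i).eq_or_lt with hc | hc
  · rw [h.jumpMoment_of_exitRate_eq_zero he hc.symm]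
    simp
  · refine ⟨fun H => ENNReal.lt_top_of_mul_ne_top_left H.ne ?_,
      fun H => ENNReal.mul_lt_top H ENNReal.ofReal_lt_top⟩
    exact (ENNReal.ofReal_pos.2 (div_pos hc (by linarith))).ne'

lemma lintegral_expFunctional_rpow (α s : ℝ) (i : ℤˣ) :
    ∫⁻ ω, (MAP.expFunctional ξ α ω) ^ s ∂(P 0 i) =
      ∫⁻ ω, totalIntegral α (path ξ J ω) ^ s ∂(P 0 i) := by
  refine lintegral_congr fun ω => ?_
  rw [MAP.expFunctional, totalIntegral,
    lintegral_timeMeasure (measurable_level_path (h.rightCts_path ω) α)]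
  rfl

/-- The spectral condition, in terms of the moments of the first sojourn and switch. -/
lemma exponentExists_and_kappa_neg_iff {z : ℝ} (hz : 0 < z) :
    (MAP.ExponentExists ξ J P z ∧ MAP.kappa ξ J P z < 0) ↔
      (∀ i, sojournMoment ξ J P i z 1 < 1) ∧
      (∀ i, ∫⁻ ω, switchWeight z (path ξ J ω) ∂(P 0 i) < ∞) ∧
      (∫⁻ ω, switchWeight z (path ξ J ω) ∂(P 0 1)) *
        ∫⁻ ω, switchWeight z (path ξ J ω) ∂(P 0 (-1)) < 1 := by
  have hnn1 := h.matrixExponent_neg_nonneg 1 z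
  have hnn2 := h.matrixExponent_neg_nonneg (-1) z
  rw [neg_neg] at hnn2
  rw [MAP.kappa, Matrix.sSup_re_spectrum_neg_iff _ hnn1 hnn2, MAP.ExponentExists]
  have hself : ∀ i, MAP.jumpMoment ξ J P i i z < ∞ := fun i => by simp [MAP.jumpMoment]
  have hjump : (∀ i j, MAP.jumpMoment ξ J P i j z < ∞) ↔
      ∀ i, MAP.jumpMoment ξ J P i (-i) z < ∞ := by
    refine ⟨fun H i => H i (-i), fun H i j => ?_⟩
    by_cases hij : j = i
    · rw [hij]; exact hself i
    · rw [intUnits_ne_iff.1 hij]; exact H i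
  have hunits : ∀ p : ℤˣ → Prop, (∀ i, p i) ↔ p 1 ∧ p (-1) := fun p =>
    ⟨fun H => ⟨H 1, H (-1)⟩, fun H i => by
      rcases Int.units_eq_one_or i with rfl | rfl
      exacts [H.1, H.2]⟩
  -- Each mean weight is the off-diagonal entry divided by minus the diagonal one, so the product
  -- condition is positivity of the determinant.
  have hprod : (∀ i, sojournMoment ξ J P i z 1 < 1) →
      (∀ i, ∫⁻ ω, switchWeight z (path ξ J ω) ∂(P 0 i) < ∞) →
      ((∫⁻ ω, switchWeight z (path ξ J ω) ∂(P 0 1)) *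
        ∫⁻ ω, switchWeight z (path ξ J ω) ∂(P 0 (-1)) < 1 ↔
      MAP.matrixExponent ξ J P z 1 (-1) * MAP.matrixExponent ξ J P z (-1) 1 <
        MAP.matrixExponent ξ J P z 1 1 * MAP.matrixExponent ξ J P z (-1) (-1)) := by
    intro he hK
    have h1 := (h.matrixExponent_self_neg_iff ((he 1).trans ENNReal.one_lt_top)).2 (he 1)
    have h2 := (h.matrixExponent_self_neg_iff ((he (-1)).trans ENNReal.one_lt_top)).2 (he (-1))
    have e2 := h.lintegral_switchWeight_toReal hz (he (-1))
    rw [neg_neg] at e2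
    rw [← ENNReal.toReal_lt_toReal (ENNReal.mul_lt_top (hK 1) (hK (-1))).ne ENNReal.one_ne_top,
      ENNReal.toReal_mul, h.lintegral_switchWeight_toReal hz (he 1), e2, ENNReal.toReal_one,
      div_mul_div_comm, neg_mul_neg, div_lt_one (mul_pos_of_neg_of_neg h1 h2)]
  constructor
  · rintro ⟨⟨H1, H2⟩, H3, H4, H5⟩
    have hfin : ∀ i, sojournMoment ξ J P i z 1 < ∞ := fun i =>
      (h.levyMoment_lt_top_iff i z).1 (H1 i)
    have he : ∀ i, sojournMoment ξ J P i z 1 < 1 := (hunits _).2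
      ⟨(h.matrixExponent_self_neg_iff (hfin 1)).1 H3,
        (h.matrixExponent_self_neg_iff (hfin (-1))).1 H4⟩
    have hK : ∀ i, ∫⁻ ω, switchWeight z (path ξ J ω) ∂(P 0 i) < ∞ := fun i =>
      (h.lintegral_switchWeight_lt_top_iff hz (he i)).2 (H2 i (-i))
    exact ⟨he, hK, (hprod he hK).2 H5⟩
  · rintro ⟨he, hK, hKK⟩
    have hfin : ∀ i, sojournMoment ξ J P i z 1 < ∞ := fun i => (he i).trans ENNReal.one_lt_top
    exact ⟨⟨fun i => (h.levyMoment_lt_top_iff i z).2 (hfin i), hjump.2 fun i =>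
      (h.lintegral_switchWeight_lt_top_iff hz (he i)).1 (hK i)⟩,
      (h.matrixExponent_self_neg_iff (hfin 1)).2 (he 1),
      (h.matrixExponent_self_neg_iff (hfin (-1))).2 (he (-1)), (hprod he hK).1 hKK⟩

end

end IsMAP

end

theorem lemma4p5 {Ω : Type*} [mΩ : MeasurableSpace Ω] (𝓖 : Filtration ℝ≥0 mΩ)
    (ξ : ℝ≥0 → Ω → EReal) (J : ℝ≥0 → Ω → ℤˣ) (P : ℝ → ℤˣ → Measure Ω)
    (hMAP : IsMAP 𝓖 ξ J P) (α : ℝ) (hα : 0 < α) (s : ℝ) (hs0 : 0 < s) (hs1 : s < 1) :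
    (MAP.ExponentExists ξ J P (α * s) ∧ MAP.kappa ξ J P (α * s) < 0) ↔
      ∀ i : ℤˣ, ∫⁻ ω, (MAP.expFunctional ξ α ω) ^ s ∂(P 0 i) < ∞ := by
  rw [hMAP.exponentExists_and_kappa_neg_iff (mul_pos hα hs0)]
  simp only [hMAP.lintegral_expFunctional_rpow]
  exact ⟨fun ⟨he, hK, hKK⟩ => hMAP.lintegral_totalIntegral_lt_top hs0 hs1.le he hK hKK,
    fun H => hMAP.moments_lt_of_lintegral_lt_top hs0 H⟩
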